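/- For every sample size $n\ge 1$ consider the Gaussian linear model $y=X\beta^0+\varepsilon=\sum_{g=1}^{G_n}X_g\beta_g^0+\varepsilon$, $\varepsilon\sim N(0,\sigma^2I_n)$, with known $\sigma>0$ not depending on $n$; here $X=X^{(n)}$ is a deterministic design matrix with $G_n$ column blocks $X_g$ of sizes $m_g\ge 1$, and $X$, $\beta^0$, $m_g$ may depend on $n$. Assume that the group sizes are bounded, $s=\sup_n\max_g m_g<\infty$, and that the design is block orthogonal, $X_g^{\mathrm T}X_h=0$ for $g\ne h$. Let $\mathcal A_n=\{g:\beta^0_g\ne 0\}$ be the set of active groups and $G_{\mathcal A_n}=|\mathcal A_n|$. Prior: given $(\tau,(\lambda_g^2)_g)$ the vectors $\beta_g$ are independent with $\beta_g\sim N_{m_g}(0,\lambda_g^2\sigma^2\tau^2(X_g^{\mathrm T}X_g)^{-1})$; the $\lambda_g^2$ are independent of each other and of $\tau$, with density proportional to $t^{-a-1}L(t)$ on $(0,\infty)$, where $a\ge\frac12$, $L:(0,\infty)\to(0,\infty)$ is measurable, slowly varying at infinity ($L(\alpha x)/L(x)\to1$ as $x\to\infty$ for all $\alpha>0$), $\int_0^\infty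 t^{-a-1}L(t)\,dt<\infty$, $L$ is bounded above on $(0,\infty)$, and $L(t)\ge c_0$ for all $t\ge t_0$, for some $c_0,t_0>0$; and $\tau$ has a non-degenerate prior probability distribution $\pi_n$ concentrated on $[\gamma_{1n},\gamma_{2n}]$, $\gamma_{1n}>0$, such that, as $n\to\infty$: (D1) $\gamma_{1n}\to0$, $\gamma_{2n}\to 0$, $G_n\gamma_{2n}[\log(1/\gamma_{2n})]^{\frac s2-1}\to0$, $\log(1/\gamma_{1n})\asymp\log G_n$, $G_n\sqrt{\gamma_{1n}}\log(1/\gamma_{1n})\to\infty$, $\sqrt{\gamma_{1n}}\log(1/\gamma_{1n})=o(1/G_{\mathcal A_n})$, and $\gamma_{2n}/\gamma_{1n}\to\infty$. With $\kappa_g=1/(1+\lambda_g^2\tau^2)$, and with $E(\cdot\mid y)$ the expectation under the posterior distribution of $(\tau,(\lambda_g^2)_g,\beta)$, the full Bayes half-thresholding rule declares group $g$ active if $E(1-\kappa_g\mid y)>\frac12$; its estimator is $\widehat\beta_g^{\mathrm{HT}}=E(\beta_g\mid y)\,I\{E(1-\kappa_g\mid y)>\frac12\}$, and $\widehat{\mathcal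 A}_n=\{g:\widehat\beta_g^{\mathrm{HT}}\ne0\}$. Assume moreover that, for constants independent of $n$, (C1) all eigenvalues of $X^{\mathrm T}X/n$ lie in $[C_1,C_2]$, where $0<C_1\le C_2<\infty$; (C2) $\min_j|\beta^0_{gj}|>C_3$ for all $g\in\mathcal A_n$, where $C_3>0$; (sparsity) $G_n^{\epsilon_1}\lesssim G_{\mathcal A_n}\lesssim G_n^{\epsilon_2}$ for some $0<\epsilon_1<\epsilon_2<\frac12$, where $\lesssim$ means $\le$ up to a constant factor for all large $n$. Then the full Bayes half-thresholding rule is an oracle: (i) $\lim_{n\to\infty}P(\widehat{\mathcal A}_n=\mathcal A_n)=1$; and (ii) for every sequence of (deterministic) unit vectors $\alpha=\alpha_n$, with $\Sigma_{\mathcal A}=X_{\mathcal A}^{\mathrm T}X_{\mathcal A}$ (the Gram matrix of the columns of the active groups) and its positive semidefinite square root $\Sigma_{\mathcal A}^{1/2}$, $\alpha^{\mathrm T}\Sigma_{\mathcal A}^{1/2}(\widehat\beta^{\mathrm{HT}}_{\mathcal A}-\beta^0_{\mathcal A})$ converges in distribution to $N(0,\sigma^2)$. -/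

import Mathlib

open MeasureTheory ProbabilityTheory Filter Topology Asymptotics Set
open scoped Matrix MatrixOrder NNReal ENNReal

namespace GroupHT

noncomputable section

/-! ### The grouped linear model -/

/-- Index set of the regression coefficients: a group `g`, and a position inside that group. -/
abbrev Idx {G : ℕ} (m : Fin G → ℕ) : Type := (g : Fin G) × Fin (m g)

/-- The part `β_g` of a coefficient vector that belongs to group `g`. -/
def groupPart {G : ℕ} {m : Fin G → ℕ} (β : Idx m → ℝ) (g : Fin G) : Fin (m g) → ℝ :=
  fun j => β ⟨g, j⟩

/-- The design matrix `X_g` of group `g`. -/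
def groupBlock {n G : ℕ} {m : Fin G → ℕ} (X : Matrix (Fin n) (Idx m) ℝ) (g : Fin G) :
    Matrix (Fin n) (Fin (m g)) ℝ :=
  X.submatrix id (fun j => ⟨g, j⟩)

/-- Block orthogonality of the design: `X_gᵀ X_h = 0` for distinct groups `g`, `h`. -/
def BlockOrthogonal {n G : ℕ} {m : Fin G → ℕ} (X : Matrix (Fin n) (Idx m) ℝ) : Prop :=
  ∀ g h : Fin G, g ≠ h → (groupBlock X g)ᵀ * groupBlock X h = 0

/-- The set of groups whose coefficient vector is nonzero. -/
def activeSet {G : ℕ} {m : Fin G → ℕ} (β : Idx m → ℝ) : Set (Fin G) :=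
  {g | groupPart β g ≠ 0}

/-- Coordinates that belong to the active groups of `β`. -/
def ActiveIdx {G : ℕ} {m : Fin G → ℕ} (β : Idx m → ℝ) : Type :=
  {p : Idx m // p.1 ∈ activeSet β}

instance {G : ℕ} {m : Fin G → ℕ} (β : Idx m → ℝ) : Fintype (ActiveIdx β) := by
  classical
  exact inferInstanceAs (Fintype {p : Idx m // p.1 ∈ activeSet β})

instance {G : ℕ} {m : Fin G → ℕ} (β : Idx m → ℝ) : DecidableEq (ActiveIdx β) :=
  inferInstanceAs (DecidableEq {p : Idx m // p.1 ∈ activeSet β})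

/-- The law of `y = X β⁰ + ε` with `ε ∼ N(0, σ² I_n)`. -/
def dataLaw {n G : ℕ} {m : Fin G → ℕ} (X : Matrix (Fin n) (Idx m) ℝ) (β0 : Idx m → ℝ) (σ : ℝ) :
    Measure (Fin n → ℝ) :=
  Measure.pi (fun i => gaussianReal ((X *ᵥ β0) i) (σ ^ 2).toNNReal)

instance {n G : ℕ} {m : Fin G → ℕ} (X : Matrix (Fin n) (Idx m) ℝ) (β0 : Idx m → ℝ) (σ : ℝ) :
    IsProbabilityMeasure (dataLaw X β0 σ) := by
  unfold dataLaw
  infer_instance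

/-! ### The prior on the local shrinkage parameters -/

/-- Density of the prior of `λ_g²`: proportional to `t ^ (-a-1) * L t` on `(0, ∞)`. -/
def localPdf (a : ℝ) (L : ℝ → ℝ) (t : ℝ) : ℝ :=
  if 0 < t then (t ^ (-a - 1) * L t) / ∫ u in Ioi (0 : ℝ), u ^ (-a - 1) * L u else 0

/-- The polynomial-tailed class of local priors: `L` is a positive measurable function, slowly
varying at infinity in Karamata's sense, and `t ^ (-a-1) * L t` can be normalised on `(0, ∞)`. -/
structure LocalPriorClass (a : ℝ) (L : ℝ → ℝ) : Prop where
  measurable : Measurable L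
  pos : ∀ t, 0 < t → 0 < L t
  slowly_varying : ∀ α, 0 < α → Tendsto (fun x => L (α * x) / L x) atTop (𝓝 1)
  integrable : IntegrableOn (fun t : ℝ => t ^ (-a - 1) * L t) (Ioi 0)

/-- `L` is bounded on `(0, ∞)`, and bounded away from zero near infinity. -/
def BoundedSlowlyVarying (L : ℝ → ℝ) : Prop :=
  (∃ c₀ t₀ : ℝ, 0 < c₀ ∧ 0 < t₀ ∧ ∀ t, t₀ ≤ t → c₀ ≤ L t) ∧
    ∃ M : ℝ, 0 < M ∧ ∀ t, 0 < t → L t ≤ M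

/-! ### The hierarchical model and its posterior -/

/-- Density of the `N(μ, S)` law on `ι → ℝ`, for a positive definite covariance matrix `S`. -/
def mvnPdf {ι : Type*} [Fintype ι] [DecidableEq ι] (μ : ι → ℝ) (S : Matrix ι ι ℝ) (x : ι → ℝ) :
    ℝ :=
  (√((2 * Real.pi) ^ Fintype.card ι * S.det))⁻¹ *
    Real.exp (-((x - μ) ⬝ᵥ (S⁻¹ *ᵥ (x - μ))) / 2)

/-- Parameters `(τ, (λ_g²)_g, β)` of the hierarchical model. -/
abbrev Param {G : ℕ} (m : Fin G → ℕ) : Type := ℝ × (Fin G → ℝ) × (Idx m → ℝ)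

/-- The density of `(y, β, (λ_g²)_g)` given `τ`:
`y ∣ β ∼ N(Xβ, σ² I)`, `β_g ∣ λ_g², τ ∼ N(0, λ_g² σ² τ² (X_gᵀ X_g)⁻¹)` independently over `g`, and
the `λ_g²` independent with density `localPdf a L`. -/
def jointPdf {n G : ℕ} {m : Fin G → ℕ} (X : Matrix (Fin n) (Idx m) ℝ) (σ a : ℝ) (L : ℝ → ℝ)
    (y : Fin n → ℝ) (θ : Param m) : ℝ :=
  let τ := θ.1
  let lam := θ.2.1
  let β := θ.2.2
  mvnPdf (X *ᵥ β) (σ ^ 2 • (1 : Matrix (Fin n) (Fin n) ℝ)) y *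
    ∏ g, (mvnPdf 0 ((lam g * σ ^ 2 * τ ^ 2) • ((groupBlock X g)ᵀ * groupBlock X g)⁻¹)
      (groupPart β g) * localPdf a L (lam g))

/-- Reference measure on the parameters: the prior `π` for `τ`, Lebesgue measure for the rest. -/
def refMeasure {G : ℕ} (m : Fin G → ℕ) (π : Measure ℝ) : Measure (Param m) :=
  π.prod ((volume : Measure (Fin G → ℝ)).prod (volume : Measure (Idx m → ℝ)))

/-- The posterior law of `(τ, (λ_g²)_g, β)` given the data `y` (Bayes' formula). -/
def posterior {n G : ℕ} {m : Fin G → ℕ} (X : Matrix (Fin n) (Idx m) ℝ) (σ a : ℝ) (L : ℝ → ℝ)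
    (π : Measure ℝ) (y : Fin n → ℝ) : Measure (Param m) :=
  (∫⁻ θ, ENNReal.ofReal (jointPdf X σ a L y θ) ∂(refMeasure m π))⁻¹ •
    (refMeasure m π).withDensity (fun θ => ENNReal.ofReal (jointPdf X σ a L y θ))

/-- The shrinkage coefficient `κ_g = 1 / (1 + λ_g² τ²)`. -/
def kappa {G : ℕ} {m : Fin G → ℕ} (g : Fin G) (θ : Param m) : ℝ :=
  1 / (1 + θ.2.1 g * θ.1 ^ 2)

/-- The posterior shrinkage weight `E(1 - κ_g ∣ y)`. -/
def shrinkWeight {n G : ℕ} {m : Fin G → ℕ} (X : Matrix (Fin n) (Idx m) ℝ) (σ a : ℝ) (L : ℝ → ℝ)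
    (π : Measure ℝ) (y : Fin n → ℝ) (g : Fin G) : ℝ :=
  ∫ θ, (1 - kappa g θ) ∂(posterior X σ a L π y)

/-- The posterior mean `E(β ∣ y)`. -/
def posteriorMean {n G : ℕ} {m : Fin G → ℕ} (X : Matrix (Fin n) (Idx m) ℝ) (σ a : ℝ) (L : ℝ → ℝ)
    (π : Measure ℝ) (y : Fin n → ℝ) : Idx m → ℝ :=
  fun p => ∫ θ, θ.2.2 p ∂(posterior X σ a L π y)

open Classical in
/-- The full Bayes half-thresholding estimator: the posterior mean on the groups with
`E(1 - κ_g ∣ y) > 1/2`, zero on the others. -/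
def htEstimator {n G : ℕ} {m : Fin G → ℕ} (X : Matrix (Fin n) (Idx m) ℝ) (σ a : ℝ) (L : ℝ → ℝ)
    (π : Measure ℝ) (y : Fin n → ℝ) : Idx m → ℝ :=
  fun p => if 1 / 2 < shrinkWeight X σ a L π y p.1 then posteriorMean X σ a L π y p else 0

/-! ### The scaled estimation error on the active groups -/

/-- `X_A`, the columns of the design that belong to the active groups of `β0`. -/
def activeDesign {n G : ℕ} {m : Fin G → ℕ} (X : Matrix (Fin n) (Idx m) ℝ) (β0 : Idx m → ℝ) :
    Matrix (Fin n) (ActiveIdx β0) ℝ :=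
  X.submatrix id (fun p => p.1)

/-- `αᵀ (X_Aᵀ X_A)^{1/2} (b_A - β⁰_A)`, with the positive semidefinite square root. -/
def scaledError {n G : ℕ} {m : Fin G → ℕ} (X : Matrix (Fin n) (Idx m) ℝ) (β0 : Idx m → ℝ)
    (α : EuclideanSpace ℝ (ActiveIdx β0)) (b : Idx m → ℝ) : ℝ :=
  α.ofLp ⬝ᵥ (CFC.sqrt ((activeDesign X β0)ᵀ * activeDesign X β0) *ᵥ
    (fun p : ActiveIdx β0 => b p.1 - β0 p.1))

/-! ### The range of the prior on the global parameter -/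

/-- Conditions on the support `[γ₁ n, γ₂ n]` of the prior of `τ`, where `G n` is the number of
groups, `A n` the number of active groups and `s` the largest group size. -/
structure GlobalPriorRange (G A : ℕ → ℕ) (s : ℕ) (γ₁ γ₂ : ℕ → ℝ) : Prop where
  pos : ∀ n, 1 ≤ n → 0 < γ₁ n
  upper_tendsto : Tendsto γ₂ atTop (𝓝 0)
  upper : Tendsto (fun n => (G n : ℝ) * γ₂ n * Real.log (1 / γ₂ n) ^ ((s : ℝ) / 2 - 1)) atTop (𝓝 0)
  lower_tendsto : Tendsto γ₁ atTop (𝓝 0)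
  lower_log : (fun n => Real.log (1 / γ₁ n)) =Θ[atTop] fun n => Real.log (G n : ℝ)
  lower_large : Tendsto (fun n => (G n : ℝ) * √(γ₁ n) * Real.log (1 / γ₁ n)) atTop atTop
  lower_small : (fun n => √(γ₁ n) * Real.log (1 / γ₁ n)) =o[atTop] fun n => 1 / (A n : ℝ)
  ratio : Tendsto (fun n => γ₂ n / γ₁ n) atTop atTop

end

end GroupHT

open GroupHT

/-! Block orthogonality decouples the groups. Completing the square (`jointPdf_coefOf`) shows that,
given τ, the λ_g² are a posteriori independent; the prior of λ_g² is reweighted by `groupWeight`,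
which sees the data only through z_g = ‖P_g y‖²/σ², with P_g the projection on the columns of X_g.
Given (τ, λ²), the law of β_g is symmetric about (1 - κ_g) times least squares. Hence E(β_g | y) is
E(1 - κ_g | y) times least squares (`posteriorMean_eq`), and only the size of E(1 - κ_g | y)
matters. The posterior of τ mixes all groups, but it never has to be computed: a bound on the
one-group ratio of integrals that holds for almost every τ of the prior passes to the posterior
(`shrinkIntegral_group_le`).

Inactive groups. The ratio has a denominator bounded below (`exists_le_groupMass`) and a numerator
at most τ(e^{z/4} + M·`tailMass`) (`exists_lintegral_shrinkU_le`). For each fixed v = λ²τ² the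
weight is a likelihood ratio against pure noise, so its mean under noise is 1
(`lintegral_groupWeight_noise`). The bound therefore has mean O(τ), and Markov's inequality makes a
false selection have probability O(γ₂). This is enough for s ≥ 2. For s = 1 the extra factor
(log(1/γ₂))^{-1/2} comes from Mills' bound for a scalar Gaussian. A union bound over the G_n groups
then uses the assumption on G_n γ₂ (log(1/γ₂))^{s/2-1}.

Active groups. By (C1), (C2) and Chernoff's bound, z_g ≥ δn simultaneously for all of them, with
probability tending to one. The posterior mean of κ_g is at most C(1 + log z + log(1/γ₁))/z
(`exists_lintegral_shrinkK_le`), and log(1/γ₁) = O(log G_n) with G_n ≤ n, so it is at most z^{-7/8}.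
Such groups are selected, and their squared shrinkage bias is at most (δn)^{-3/4} each. There are
O(n^{1/2}) of them, so the total bias is O(n^{-1/4}).

Both regimes are collected in `exists_good_event`. On that event the scaled error is a linear
functional v·ε of the noise with |v| = 1, exactly N(0, σ²), up to a vanishing bias; Slutsky's
theorem finishes the proof. -/

namespace GroupHT

noncomputable section

/-! ### Block orthogonal designs -/

section Design

variable {n G : ℕ} {m : Fin G → ℕ} (X : Matrix (Fin n) (Idx m) ℝ)

/-- The contribution `X_g v_g` of group `g` to `X v`. -/
def groupImage (g : Fin G) (v : Idx m → ℝ) : Fin n → ℝ :=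
  groupBlock X g *ᵥ groupPart v g

/-- The ordinary least squares estimator. -/
def ols (y : Fin n → ℝ) : Idx m → ℝ :=
  (Xᵀ * X)⁻¹ *ᵥ (Xᵀ *ᵥ y)

/-- The squared norm of the projection of `y` on the columns of group `g`, in units of `σ²`. -/
def groupStat (σ : ℝ) (y : Fin n → ℝ) (g : Fin G) : ℝ :=
  (groupImage X g (ols X y) ⬝ᵥ groupImage X g (ols X y)) / σ ^ 2

/-- `X` is bounded below by `√c`. -/
def BoundedBelow {ι : Type*} [Fintype ι] (A : Matrix (Fin n) ι ℝ) (c : ℝ) : Prop :=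
  ∀ v : ι → ℝ, c * (v ⬝ᵥ v) ≤ (A *ᵥ v) ⬝ᵥ (A *ᵥ v)

/-- The vector that agrees with `v` on group `g` and vanishes elsewhere. -/
def extendGroup (g : Fin G) (v : Idx m → ℝ) : Idx m → ℝ :=
  fun p => if p.1 = g then v p else 0

lemma mulVec_eq_sum_groupImage (v : Idx m → ℝ) : X *ᵥ v = ∑ g, groupImage X g v := by
  ext i
  simp only [Matrix.mulVec, dotProduct, Finset.sum_apply, groupImage, groupBlock, groupPart,
    Matrix.submatrix_apply, id]
  rw [Fintype.sum_sigma]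

lemma groupImage_add (g : Fin G) (v w : Idx m → ℝ) :
    groupImage X g (v + w) = groupImage X g v + groupImage X g w :=
  Matrix.mulVec_add _ _ _

lemma groupImage_smul (g : Fin G) (c : ℝ) (v : Idx m → ℝ) :
    groupImage X g (c • v) = c • groupImage X g v :=
  Matrix.mulVec_smul _ _ _

lemma groupImage_of_groupPart_eq_smul (g : Fin G) (c : ℝ) {v w : Idx m → ℝ}
    (h : ∀ j, v ⟨g, j⟩ = c * w ⟨g, j⟩) : groupImage X g v = c • groupImage X g w := by
  have : groupPart v g = c • groupPart w g := by
    ext j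
    simp [groupPart, h j]
  rw [groupImage, this, Matrix.mulVec_smul, groupImage]

lemma groupImage_eq_zero (g : Fin G) {v : Idx m → ℝ} (h : groupPart v g = 0) :
    groupImage X g v = 0 := by
  simp [groupImage, h]

lemma groupImage_extendGroup_self (g : Fin G) (v : Idx m → ℝ) :
    groupImage X g (extendGroup g v) = groupImage X g v := by
  unfold groupImage
  congr 1
  ext j
  simp [groupPart, extendGroup]

lemma mulVec_extendGroup (g : Fin G) (v : Idx m → ℝ) :
    X *ᵥ extendGroup g v = groupImage X g v := by
  rw [mulVec_eq_sum_groupImage, Finset.sum_eq_single g]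
  · exact groupImage_extendGroup_self X g v
  · intro h _ hne
    apply groupImage_eq_zero
    ext j
    simp [groupPart, extendGroup, hne]
  · simp

variable {X}

lemma BlockOrthogonal.groupImage_dotProduct (hX : BlockOrthogonal X) {g h : Fin G} (hgh : g ≠ h)
    (v w : Idx m → ℝ) : groupImage X g v ⬝ᵥ groupImage X h w = 0 := by
  unfold groupImage
  rw [Matrix.dotProduct_mulVec, Matrix.vecMul_mulVec, hX g h hgh]
  simp

lemma BlockOrthogonal.groupImage_dotProduct_mulVec (hX : BlockOrthogonal X) (g : Fin G)
    (v w : Idx m → ℝ) :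
    groupImage X g v ⬝ᵥ (X *ᵥ w) = groupImage X g v ⬝ᵥ groupImage X g w := by
  rw [mulVec_eq_sum_groupImage, dotProduct_sum, Finset.sum_eq_single g]
  · intro h _ hne
    exact hX.groupImage_dotProduct hne.symm v w
  · simp

lemma BlockOrthogonal.mulVec_dotProduct_mulVec (hX : BlockOrthogonal X) (v w : Idx m → ℝ) :
    (X *ᵥ v) ⬝ᵥ (X *ᵥ w) = ∑ g, groupImage X g v ⬝ᵥ groupImage X g w := by
  rw [mulVec_eq_sum_groupImage X v, sum_dotProduct]
  exact Finset.sum_congr rfl fun g _ => hX.groupImage_dotProduct_mulVec g v w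

lemma BoundedBelow.mulVec_injective {ι : Type*} [Fintype ι] {A : Matrix (Fin n) ι ℝ} {c : ℝ}
    (hc : 0 < c) (hA : BoundedBelow A c) : Function.Injective A.mulVec := by
  intro v w hvw
  have h := hA (v - w)
  rw [Matrix.mulVec_sub, hvw, sub_self, dotProduct_zero] at h
  have h0 : (v - w) ⬝ᵥ (v - w) = 0 := by
    have : 0 ≤ (v - w) ⬝ᵥ (v - w) := Finset.sum_nonneg fun i _ => mul_self_nonneg _
    nlinarith
  exact sub_eq_zero.mp (dotProduct_self_eq_zero.mp h0)

lemma BoundedBelow.isUnit_det {ι : Type*} [Fintype ι] [DecidableEq ι] {A : Matrix (Fin n) ι ℝ}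
    {c : ℝ} (hc : 0 < c) (hA : BoundedBelow A c) : IsUnit (Aᵀ * A).det := by
  rw [isUnit_iff_ne_zero]
  intro h
  obtain ⟨v, hv, hv0⟩ := Matrix.exists_mulVec_eq_zero_iff.mpr h
  apply hv
  apply hA.mulVec_injective hc
  rw [Matrix.mulVec_zero, ← dotProduct_self_eq_zero, Matrix.dotProduct_mulVec,
    Matrix.vecMul_mulVec, ← Matrix.dotProduct_mulVec, hv0, dotProduct_zero]

/-- Padding a vector of one group by zeros preserves its norm and its image, so the constant is
inherited by each block. -/
lemma BoundedBelow.groupBlock {c : ℝ} (hA : BoundedBelow X c) (g : Fin G) :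
    BoundedBelow (groupBlock X g) c := by
  intro v
  let w : Idx m → ℝ := fun p => if h : p.1 = g then v (h ▸ p.2) else 0
  have h := hA (extendGroup g w)
  rw [mulVec_extendGroup] at h
  have h1 : groupPart w g = v := by
    ext j
    simp [w, groupPart]
  have h2 : extendGroup g w ⬝ᵥ extendGroup g w = v ⬝ᵥ v := by
    simp only [dotProduct]
    rw [Fintype.sum_sigma, Finset.sum_eq_single g]
    · simp [extendGroup, w]
    · intro k _ hk
      simp [extendGroup, hk]
    · simp
  rw [h2, groupImage, h1] at h
  exact h

lemma BoundedBelow.groupImage {c : ℝ} (hA : BoundedBelow X c) (g : Fin G) (v : Idx m → ℝ) :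
    c * (groupPart v g ⬝ᵥ groupPart v g) ≤ groupImage X g v ⬝ᵥ groupImage X g v :=
  hA.groupBlock g (groupPart v g)

/-- The normal equations. -/
lemma BoundedBelow.mulVec_dotProduct_ols {c : ℝ} (hc : 0 < c) (hA : BoundedBelow X c)
    (v : Idx m → ℝ) (y : Fin n → ℝ) : (X *ᵥ v) ⬝ᵥ (X *ᵥ ols X y) = (X *ᵥ v) ⬝ᵥ y := by
  have h : Xᵀ *ᵥ (X *ᵥ ols X y) = Xᵀ *ᵥ y := by
    rw [ols, Matrix.mulVec_mulVec, Matrix.mulVec_mulVec, Matrix.mul_nonsing_inv _ (hA.isUnit_det hc),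
      Matrix.one_mulVec]
  rw [dotProduct_comm, Matrix.dotProduct_mulVec, ← Matrix.mulVec_transpose, h,
    Matrix.mulVec_transpose, ← Matrix.dotProduct_mulVec, dotProduct_comm]

/-- Testing the normal equations on a vector supported on one group decouples them: the fitted block
is the projection of y on the columns of that group. -/
lemma BlockOrthogonal.groupImage_dotProduct_ols {c : ℝ} (hX : BlockOrthogonal X) (hc : 0 < c)
    (hA : BoundedBelow X c) (g : Fin G) (v : Idx m → ℝ) (y : Fin n → ℝ) :
    groupImage X g v ⬝ᵥ groupImage X g (ols X y) = groupImage X g v ⬝ᵥ y := by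
  rw [← hX.groupImage_dotProduct_mulVec, ← mulVec_extendGroup, hA.mulVec_dotProduct_ols hc]

lemma BoundedBelow.ols_mulVec_add {c : ℝ} (hc : 0 < c) (hA : BoundedBelow X c) (β : Idx m → ℝ)
    (e : Fin n → ℝ) : ols X (X *ᵥ β + e) = β + ols X e := by
  rw [ols, Matrix.mulVec_add, Matrix.mulVec_add, Matrix.mulVec_mulVec, Matrix.mulVec_mulVec,
    Matrix.mul_assoc, Matrix.nonsing_inv_mul _ (hA.isUnit_det hc), Matrix.one_mulVec, ols]

lemma BoundedBelow.card_le {ι : Type*} [Fintype ι] {A : Matrix (Fin n) ι ℝ} {c : ℝ}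
    (hc : 0 < c) (hA : BoundedBelow A c) : Fintype.card ι ≤ n := by
  have h := LinearMap.finrank_le_finrank_of_injective (f := A.mulVecLin) (hA.mulVec_injective hc)
  simpa using h

/-- An injective design has at most n columns, and each group owns at least one. This turns growth
conditions in the number of groups into conditions in n. -/
lemma BoundedBelow.groups_le {c : ℝ} (hc : 0 < c) (hA : BoundedBelow X c) (hm : ∀ g, 1 ≤ m g) :
    G ≤ n := by
  refine le_trans ?_ (hA.card_le hc)
  rw [Fintype.card_sigma]
  calc G = ∑ _g : Fin G, 1 := by simp
    _ ≤ ∑ g, Fintype.card (Fin (m g)) := Finset.sum_le_sum fun g _ => by simpa using hm g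

lemma groupStat_nonneg (σ : ℝ) (y : Fin n → ℝ) (g : Fin G) : 0 ≤ groupStat X σ y g :=
  div_nonneg (Finset.sum_nonneg fun _ _ => mul_self_nonneg _) (sq_nonneg _)

lemma continuous_ols : Continuous (ols X) := by
  unfold ols
  fun_prop

lemma continuous_groupStat (σ : ℝ) (g : Fin G) : Continuous fun y => groupStat X σ y g := by
  unfold groupStat groupImage groupPart ols
  simp only [dotProduct, Matrix.mulVec]
  fun_prop

/-- A spectral lower bound for `XᵀX / n` bounds the design from below. -/
lemma boundedBelow_of_spectrum {ι : Type*} [Fintype ι] [DecidableEq ι]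
    {A : Matrix (Fin n) ι ℝ} {C₁ C₂ : ℝ} (hn : 1 ≤ n)
    (h : spectrum ℝ ((n : ℝ)⁻¹ • (Aᵀ * A)) ⊆ Set.Icc C₁ C₂) : BoundedBelow A (C₁ * n) := by
  intro v
  have hn' : (0 : ℝ) < n := by exact_mod_cast hn
  have hH : ((n : ℝ)⁻¹ • (Aᵀ * A)).IsHermitian := by
    rw [Matrix.IsHermitian, Matrix.conjTranspose_eq_transpose_of_trivial]
    simp
  -- An eigenvalue of the shifted matrix, increased by C₁, lies in the original spectrum, so it is
  -- nonnegative.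
  have hd : ((n : ℝ)⁻¹ • (Aᵀ * A) - C₁ • (1 : Matrix ι ι ℝ)).PosSemidef := by
    have hH' : ((n : ℝ)⁻¹ • (Aᵀ * A) - C₁ • (1 : Matrix ι ι ℝ)).IsHermitian := by
      refine hH.sub ?_
      rw [Matrix.IsHermitian, Matrix.conjTranspose_eq_transpose_of_trivial]
      simp
    rw [hH'.posSemidef_iff_eigenvalues_nonneg]
    intro i
    have hi := hH'.eigenvalues_mem_spectrum_real i
    have h2 : hH'.eigenvalues i + C₁ ∈ spectrum ℝ ((n : ℝ)⁻¹ • (Aᵀ * A)) := by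
      generalize hH'.eigenvalues i = e at hi
      rwa [spectrum.add_mem_iff, neg_add_eq_sub, Algebra.algebraMap_eq_smul_one]
    have := (h h2).1
    simp only [Pi.zero_apply]
    linarith
  have h3 := hd.dotProduct_mulVec_nonneg v
  simp only [star_trivial, Matrix.sub_mulVec, Matrix.smul_mulVec, Matrix.one_mulVec,
    dotProduct_sub, dotProduct_smul, smul_eq_mul, ← Matrix.mulVec_mulVec] at h3
  have h4 : v ⬝ᵥ (Aᵀ *ᵥ (A *ᵥ v)) = (A *ᵥ v) ⬝ᵥ (A *ᵥ v) := by
    rw [Matrix.mulVec_transpose, dotProduct_comm, ← Matrix.dotProduct_mulVec]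
  rw [h4] at h3
  have h5 : C₁ * (v ⬝ᵥ v) ≤ (n : ℝ)⁻¹ * ((A *ᵥ v) ⬝ᵥ (A *ᵥ v)) := by linarith
  calc C₁ * n * (v ⬝ᵥ v) = n * (C₁ * (v ⬝ᵥ v)) := by ring
    _ ≤ n * ((n : ℝ)⁻¹ * ((A *ᵥ v) ⬝ᵥ (A *ᵥ v))) := by gcongr
    _ = _ := by field_simp

end Design

/-! ### Completing the square in the hierarchical model -/

section Joint

/-- The shrinkage coefficient as a function of `τ` and of `t = λ²`. -/
def shrinkK (τ t : ℝ) : ℝ := 1 / (1 + t * τ ^ 2)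

/-- The complementary coefficient `1 - κ`. -/
def shrinkU (τ t : ℝ) : ℝ := t * τ ^ 2 / (1 + t * τ ^ 2)

/-- The marginal likelihood of a group of size `k` with statistic `z`, given `τ` and `λ² = t`,
up to a factor that does not depend on the parameters. -/
def groupWeight (k : ℕ) (z τ t : ℝ) : ℝ := √(shrinkK τ t) ^ k * Real.exp (shrinkU τ t * z / 2)

/-- The Gaussian kernel `exp (-‖A x‖² / (2σ²))`. -/
def gaussKernel {n : ℕ} {ι : Type*} [Fintype ι] (A : Matrix (Fin n) ι ℝ) (σ : ℝ) (x : ι → ℝ) : ℝ :=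
  Real.exp (-((A *ᵥ x) ⬝ᵥ (A *ᵥ x)) / (2 * σ ^ 2))

lemma shrinkK_pos {τ t : ℝ} (ht : 0 ≤ t) : 0 < shrinkK τ t := by
  unfold shrinkK; positivity

lemma shrinkK_le_one {τ t : ℝ} (ht : 0 ≤ t) : shrinkK τ t ≤ 1 := by
  unfold shrinkK
  rw [div_le_one (by positivity)]
  nlinarith [mul_nonneg ht (sq_nonneg τ)]

lemma shrinkU_eq {τ t : ℝ} (ht : 0 ≤ t) : shrinkU τ t = 1 - shrinkK τ t := by
  unfold shrinkU shrinkK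
  have : 0 < 1 + t * τ ^ 2 := by positivity
  field_simp
  ring

lemma shrinkU_nonneg {τ t : ℝ} (ht : 0 ≤ t) : 0 ≤ shrinkU τ t := by
  unfold shrinkU; positivity

lemma shrinkU_pos {τ t : ℝ} (hτ : 0 < τ) (ht : 0 < t) : 0 < shrinkU τ t := by
  unfold shrinkU; positivity

lemma shrinkU_le_one {τ t : ℝ} (ht : 0 ≤ t) : shrinkU τ t ≤ 1 := by
  rw [shrinkU_eq ht]; linarith [shrinkK_pos (τ := τ) ht]

lemma shrinkU_le {τ t : ℝ} (ht : 0 ≤ t) : shrinkU τ t ≤ t * τ ^ 2 := by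
  unfold shrinkU
  apply div_le_self (by positivity)
  nlinarith [mul_nonneg ht (sq_nonneg τ)]

lemma groupWeight_nonneg (k : ℕ) (z τ t : ℝ) : 0 ≤ groupWeight k z τ t := by
  unfold groupWeight; positivity

lemma groupWeight_pos {k : ℕ} {z τ t : ℝ} (ht : 0 ≤ t) : 0 < groupWeight k z τ t := by
  have := Real.sqrt_pos.mpr (shrinkK_pos (τ := τ) ht)
  unfold groupWeight; positivity

lemma measurable_groupWeight (k : ℕ) :
    Measurable fun p : ℝ × ℝ × ℝ => groupWeight k p.1 p.2.1 p.2.2 := by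
  unfold groupWeight shrinkK shrinkU; fun_prop

variable {n G : ℕ} {m : Fin G → ℕ} {X : Matrix (Fin n) (Idx m) ℝ}

lemma mvnPdf_smul_one {σ : ℝ} (hσ : 0 < σ) (μ y : Fin n → ℝ) :
    mvnPdf μ (σ ^ 2 • (1 : Matrix (Fin n) (Fin n) ℝ)) y =
      (√((2 * Real.pi) ^ n * (σ ^ 2) ^ n))⁻¹ *
        Real.exp (-((y - μ) ⬝ᵥ (y - μ)) / (2 * σ ^ 2)) := by
  have h : (σ ^ 2 • (1 : Matrix (Fin n) (Fin n) ℝ))⁻¹ = (σ ^ 2)⁻¹ • 1 := by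
    apply Matrix.inv_eq_left_inv
    rw [Matrix.smul_mul, Matrix.mul_smul, Matrix.one_mul, smul_smul,
      inv_mul_cancel₀ (by positivity), one_smul]
  unfold mvnPdf
  rw [h]
  simp only [Matrix.det_smul, Matrix.det_one, Fintype.card_fin, mul_one, Matrix.smul_mulVec,
    Matrix.one_mulVec, dotProduct_smul, smul_eq_mul]
  congr 2
  field_simp

/-- The inverse covariance is a multiple of the Gram matrix, which turns the exponent into a norm of
`A *ᵥ v`. The power of √(tτ²) is separated because it is the only part of the normalisation that
depends on the parameters. -/
lemma mvnPdf_prior {k : ℕ} {A : Matrix (Fin n) (Fin k) ℝ} {c : ℝ} (hc : 0 < c)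
    (hA : BoundedBelow A c) {σ τ t : ℝ} (hσ : 0 < σ) (hτ : 0 < τ) (ht : 0 < t) (v : Fin k → ℝ) :
    mvnPdf 0 ((t * σ ^ 2 * τ ^ 2) • (Aᵀ * A)⁻¹) v =
      (√((2 * Real.pi) ^ k * (σ ^ 2 • (Aᵀ * A)⁻¹).det))⁻¹ * (√(t * τ ^ 2) ^ k)⁻¹ *
        Real.exp (-((A *ᵥ v) ⬝ᵥ (A *ᵥ v)) / (2 * σ ^ 2 * (t * τ ^ 2))) := by
  have hdet := hA.isUnit_det hc
  have h : ((t * σ ^ 2 * τ ^ 2) • (Aᵀ * A)⁻¹)⁻¹ = (t * σ ^ 2 * τ ^ 2)⁻¹ • (Aᵀ * A) := by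
    apply Matrix.inv_eq_left_inv
    rw [Matrix.smul_mul, Matrix.mul_smul, Matrix.mul_nonsing_inv _ hdet, smul_smul,
      inv_mul_cancel₀ (by positivity), one_smul]
  have h4 : v ⬝ᵥ ((Aᵀ * A) *ᵥ v) = (A *ᵥ v) ⬝ᵥ (A *ᵥ v) := by
    rw [← Matrix.mulVec_mulVec, Matrix.mulVec_transpose, dotProduct_comm,
      ← Matrix.dotProduct_mulVec]
  unfold mvnPdf
  rw [h]
  simp only [sub_zero, Matrix.smul_mulVec, dotProduct_smul, smul_eq_mul, h4]
  rw [← mul_inv]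
  congr 2
  · have hw : √(t * τ ^ 2) ^ k = √((t * τ ^ 2) ^ k) := by
      have h2 : (t * τ ^ 2) ^ k = (√(t * τ ^ 2) ^ k) ^ 2 := by
        rw [← pow_mul, mul_comm k 2, pow_mul, Real.sq_sqrt (by positivity)]
      rw [h2, Real.sqrt_sq (by positivity)]
    rw [hw, ← Real.sqrt_mul' _ (by positivity), Matrix.det_smul, Matrix.det_smul, Fintype.card_fin]
    congr 1
    ring
  · field_simp

/-- The factor of the joint density that depends on the data only. -/
def dataFactor (X : Matrix (Fin n) (Idx m) ℝ) (σ : ℝ) (y : Fin n → ℝ) : ℝ :=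
  (√((2 * Real.pi) ^ n * (σ ^ 2) ^ n))⁻¹ * Real.exp (-(y ⬝ᵥ y) / (2 * σ ^ 2)) *
    ∏ g, (√((2 * Real.pi) ^ m g * (σ ^ 2 • ((groupBlock X g)ᵀ * groupBlock X g)⁻¹).det))⁻¹

/-- The affine change of variables that standardises the coefficients given `τ` and `λ²`. -/
def coefOf (X : Matrix (Fin n) (Idx m) ℝ) (y : Fin n → ℝ) (τ : ℝ) (lam : Fin G → ℝ)
    (x : Idx m → ℝ) : Idx m → ℝ :=
  fun p => √(shrinkU τ (lam p.1)) * x p + shrinkU τ (lam p.1) * ols X y p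

lemma groupImage_coefOf (y : Fin n → ℝ) (τ : ℝ) (lam : Fin G → ℝ) (x : Idx m → ℝ) (g : Fin G) :
    groupImage X g (coefOf X y τ lam x) = √(shrinkU τ (lam g)) • groupImage X g x +
      shrinkU τ (lam g) • groupImage X g (ols X y) := by
  rw [← groupImage_smul, ← groupImage_smul, ← groupImage_add]
  unfold groupImage
  congr 1

lemma dataFactor_pos {c σ : ℝ} (hc : 0 < c) (hA : BoundedBelow X c) (hσ : 0 < σ) (y : Fin n → ℝ) :
    0 < dataFactor X σ y := by
  unfold dataFactor
  refine mul_pos (by positivity) (Finset.prod_pos fun g _ => ?_)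
  have h1 : 0 < ((groupBlock X g)ᵀ * groupBlock X g).det := by
    have h := (Matrix.posSemidef_conjTranspose_mul_self (groupBlock X g)).det_nonneg
    rw [Matrix.conjTranspose_eq_transpose_of_trivial] at h
    exact lt_of_le_of_ne h ((hA.groupBlock g).isUnit_det hc).ne_zero.symm
  rw [Matrix.det_smul, Matrix.det_nonsing_inv, Ring.inverse_eq_inv']
  positivity

/-- Put w = λ²τ² and u = w/(1+w), so that 1 + 1/w = 1/u. For a fitted block b and its least squares
value b̂, the exponent contains ‖b‖²/u - 2⟨b, b̂⟩; substituting b = √u x + u b̂ makes it ‖x‖² -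
u‖b̂‖². The term u‖b̂‖² is the source of `groupWeight`, and x becomes independent of (τ, λ²). -/
lemma jointPdf_coefOf {c σ a τ : ℝ} (L : ℝ → ℝ) (hX : BlockOrthogonal X) (hc : 0 < c)
    (hA : BoundedBelow X c) (hσ : 0 < σ) (hτ : 0 < τ) {lam : Fin G → ℝ} (hlam : ∀ g, 0 < lam g)
    (y : Fin n → ℝ) (x : Idx m → ℝ) :
    jointPdf X σ a L y (τ, lam, coefOf X y τ lam x) =
      dataFactor X σ y *
        (∏ g, groupWeight (m g) (groupStat X σ y g) τ (lam g) * localPdf a L (lam g)) *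
        (∏ p : Idx m, √(shrinkU τ (lam p.1)))⁻¹ * gaussKernel X σ x := by
  have hprior : ∀ g, mvnPdf 0 ((lam g * σ ^ 2 * τ ^ 2) • ((groupBlock X g)ᵀ * groupBlock X g)⁻¹)
      (groupPart (coefOf X y τ lam x) g) = _ := fun g =>
    mvnPdf_prior hc (hA.groupBlock g) hσ hτ (hlam g) _
  have hexp : -((y - X *ᵥ coefOf X y τ lam x) ⬝ᵥ (y - X *ᵥ coefOf X y τ lam x)) / (2 * σ ^ 2) +
      ∑ g, -(groupImage X g (coefOf X y τ lam x) ⬝ᵥ groupImage X g (coefOf X y τ lam x)) /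
        (2 * σ ^ 2 * (lam g * τ ^ 2)) =
      -(y ⬝ᵥ y) / (2 * σ ^ 2) + ∑ g, shrinkU τ (lam g) * groupStat X σ y g / 2 +
        -((X *ᵥ x) ⬝ᵥ (X *ᵥ x)) / (2 * σ ^ 2) := by
    have h1 : (y - X *ᵥ coefOf X y τ lam x) ⬝ᵥ (y - X *ᵥ coefOf X y τ lam x) =
        y ⬝ᵥ y + ∑ g, (groupImage X g (coefOf X y τ lam x) ⬝ᵥ groupImage X g (coefOf X y τ lam x)
          - 2 * (groupImage X g (coefOf X y τ lam x) ⬝ᵥ groupImage X g (ols X y))) := by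
      rw [sub_dotProduct, dotProduct_sub, dotProduct_sub, Finset.sum_sub_distrib,
        ← hX.mulVec_dotProduct_mulVec, ← Finset.mul_sum, ← hX.mulVec_dotProduct_mulVec,
        hA.mulVec_dotProduct_ols hc, dotProduct_comm y (X *ᵥ _)]
      ring
    rw [h1, hX.mulVec_dotProduct_mulVec, neg_add, add_div, add_assoc, add_assoc]
    congr 1
    rw [neg_div, neg_div, Finset.sum_div, Finset.sum_div, ← Finset.sum_neg_distrib,
      ← Finset.sum_neg_distrib, ← Finset.sum_add_distrib, ← Finset.sum_add_distrib]
    refine Finset.sum_congr rfl fun g _ => ?_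
    have ht := hlam g
    have hu := Real.sq_sqrt (shrinkU_pos hτ ht).le
    rw [groupImage_coefOf, groupStat]
    simp only [add_dotProduct, dotProduct_add, smul_dotProduct, dotProduct_smul, smul_eq_mul]
    rw [dotProduct_comm (groupImage X g (ols X y)) (groupImage X g x)]
    generalize groupImage X g x ⬝ᵥ groupImage X g x = A
    generalize groupImage X g x ⬝ᵥ groupImage X g (ols X y) = B
    generalize groupImage X g (ols X y) ⬝ᵥ groupImage X g (ols X y) = C
    have hv : shrinkU τ (lam g) * (1 + lam g * τ ^ 2) = lam g * τ ^ 2 := by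
      unfold shrinkU
      field_simp
    set r := √(shrinkU τ (lam g))
    rw [← hu] at hv ⊢
    have hw : 0 < lam g * τ ^ 2 := by positivity
    generalize lam g * τ ^ 2 = w at hv hw
    field_simp
    linear_combination (-A - 2 * r * B - r ^ 2 * C) * hv
  -- Since u = wκ, the prior normalisation w^{-1/2} equals κ^{1/2} u^{-1/2}: the first factor goes
  -- into the group weight, the second will cancel the Jacobian of `coefOf`.
  have hprod : ∏ g, (√(lam g * τ ^ 2) ^ m g)⁻¹ =
      (∏ g, √(shrinkK τ (lam g)) ^ m g) * (∏ p : Idx m, √(shrinkU τ (lam p.1)))⁻¹ := by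
    rw [Fintype.prod_sigma, ← Finset.prod_inv_distrib, ← Finset.prod_mul_distrib]
    refine Finset.prod_congr rfl fun g _ => ?_
    have ht := hlam g
    have hk := Real.sqrt_pos.mpr (shrinkK_pos (τ := τ) ht.le)
    have hw : 0 < √(lam g * τ ^ 2) := Real.sqrt_pos.mpr (by positivity)
    have hu : shrinkU τ (lam g) = lam g * τ ^ 2 * shrinkK τ (lam g) := by
      unfold shrinkU shrinkK
      ring
    simp only [Finset.prod_const, Finset.card_univ, Fintype.card_fin]
    rw [hu, Real.sqrt_mul (x := lam g * τ ^ 2) (by positivity) (shrinkK τ (lam g))]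
    generalize √(lam g * τ ^ 2) = r at hw
    rw [mul_pow]
    field_simp
  have hgroup : ∀ g, groupBlock X g *ᵥ groupPart (coefOf X y τ lam x) g =
      groupImage X g (coefOf X y τ lam x) := fun g => rfl
  simp only [hgroup] at hprior
  simp only [jointPdf, mvnPdf_smul_one hσ, hprior, groupWeight, dataFactor, gaussKernel]
  simp only [Finset.prod_mul_distrib, ← Real.exp_sum]
  rw [hprod]
  have hexp' := congrArg Real.exp hexp
  rw [Real.exp_add, Real.exp_add, Real.exp_add] at hexp'
  generalize Real.exp (-((y - X *ᵥ coefOf X y τ lam x) ⬝ᵥ (y - X *ᵥ coefOf X y τ lam x)) /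
    (2 * σ ^ 2)) = e1 at hexp' ⊢
  generalize Real.exp (∑ g, -(groupImage X g (coefOf X y τ lam x) ⬝ᵥ
    groupImage X g (coefOf X y τ lam x)) / (2 * σ ^ 2 * (lam g * τ ^ 2))) = e2 at hexp' ⊢
  generalize (√((2 * Real.pi) ^ n * (σ ^ 2) ^ n))⁻¹ = d1
  generalize ∏ g, (√((2 * Real.pi) ^ m g *
    (σ ^ 2 • ((groupBlock X g)ᵀ * groupBlock X g)⁻¹).det))⁻¹ = d2
  linear_combination (d1 * d2 * (∏ g, √(shrinkK τ (lam g)) ^ m g) *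
    (∏ p : Idx m, √(shrinkU τ (lam p.1)))⁻¹ * ∏ g, localPdf a L (lam g)) * hexp'

end Joint

/-! ### Products of lower integrals -/

section Pi

/-- Tonelli by induction on the number of coordinates. It makes the integral over all λ_g² factorise
once τ is fixed. -/
lemma lintegral_fin_prod_eq_prod {n : ℕ} {E : Fin n → Type*}
    {mE : ∀ i, MeasurableSpace (E i)} {μ : (i : Fin n) → Measure (E i)} [∀ i, SigmaFinite (μ i)]
    {f : (i : Fin n) → E i → ℝ≥0∞} (hf : ∀ i, Measurable (f i)) :
    ∫⁻ x : (i : Fin n) → E i, ∏ i, f i (x i) ∂(Measure.pi μ) = ∏ i, ∫⁻ x, f i x ∂(μ i) := by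
  induction n with
  | zero => simp
  | succ n ih =>
      calc
        _ = ∫⁻ x : E 0 × ((i : Fin n) → E (Fin.succ i)),
            f 0 x.1 * ∏ i : Fin n, f (Fin.succ i) (x.2 i)
            ∂((μ 0).prod (Measure.pi (fun i ↦ μ i.succ))) := by
          rw [← ((measurePreserving_piFinSuccAbove μ 0).symm).lintegral_comp_emb
            (MeasurableEquiv.measurableEmbedding _)]
          refine lintegral_congr fun x => ?_
          rw [Fin.prod_univ_succ]
          rfl
        _ = (∫⁻ x, f 0 x ∂μ 0)
            * ∏ i : Fin n, ∫⁻ (x : E (Fin.succ i)), f (Fin.succ i) x ∂(μ i.succ) := by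
          rw [← ih fun i => hf i.succ, ← lintegral_prod_mul (hf 0).aemeasurable]
          exact (Finset.measurable_prod _ fun i _ =>
            (hf i.succ).comp (measurable_pi_apply i)).aemeasurable
        _ = ∏ i, ∫⁻ x, f i x ∂(μ i) := by rw [Fin.prod_univ_succ]

/-- It suffices to compare the measures on boxes, where the indicator factorises as well. -/
lemma pi_withDensity_fin {n : ℕ} {μ : Measure ℝ} [SigmaFinite μ] {f : ℝ → ℝ≥0∞} (hf : Measurable f)
    [SigmaFinite (μ.withDensity f)] :
    Measure.pi (fun _ : Fin n => μ.withDensity f) =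
      (Measure.pi fun _ : Fin n => μ).withDensity fun x => ∏ i, f (x i) := by
  refine Measure.pi_eq fun s hs => ?_
  rw [withDensity_apply _ (MeasurableSet.univ_pi hs), ← lintegral_indicator (MeasurableSet.univ_pi hs)]
  have : (Set.pi Set.univ s).indicator (fun x : Fin n → ℝ => ∏ i, f (x i)) =
      fun x => ∏ i, (s i).indicator f (x i) := by
    ext x
    by_cases hx : x ∈ Set.pi Set.univ s
    · rw [Set.indicator_of_mem hx]
      exact Finset.prod_congr rfl fun i _ => (Set.indicator_of_mem (hx i (Set.mem_univ i)) f).symm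
    · rw [Set.indicator_of_notMem hx]
      simp only [Set.mem_pi, Set.mem_univ, true_implies, not_forall] at hx
      obtain ⟨i, hi⟩ := hx
      exact (Finset.prod_eq_zero (Finset.mem_univ i) (Set.indicator_of_notMem hi f)).symm
  rw [this, lintegral_fin_prod_eq_prod fun i => hf.indicator (hs i)]
  refine Finset.prod_congr rfl fun i _ => ?_
  rw [lintegral_indicator (hs i), withDensity_apply _ (hs i)]

end Pi

/-! ### The law of the local shrinkage parameters -/

section LocalLaw

variable {a : ℝ} {L : ℝ → ℝ}

/-- The prior law of `λ²`. -/
def localLaw (a : ℝ) (L : ℝ → ℝ) : Measure ℝ :=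
  volume.withDensity fun t => ENNReal.ofReal (localPdf a L t)

lemma LocalPriorClass.integral_pos (hL : LocalPriorClass a L) :
    0 < ∫ u in Ioi (0 : ℝ), u ^ (-a - 1) * L u := by
  rw [setIntegral_pos_iff_support_of_nonneg_ae _ hL.integrable]
  · have : Function.support (fun u : ℝ => u ^ (-a - 1) * L u) ∩ Ioi 0 = Ioi 0 := by
      apply Set.inter_eq_right.mpr
      intro u hu
      exact (mul_pos (Real.rpow_pos_of_pos hu _) (hL.pos u hu)).ne'
    rw [this]
    simp
  · filter_upwards [ae_restrict_mem measurableSet_Ioi] with u hu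
    exact (mul_pos (Real.rpow_pos_of_pos hu _) (hL.pos u hu)).le

lemma LocalPriorClass.localPdf_nonneg (hL : LocalPriorClass a L) (t : ℝ) : 0 ≤ localPdf a L t := by
  unfold localPdf
  split_ifs with ht
  · exact div_nonneg (mul_pos (Real.rpow_pos_of_pos ht _) (hL.pos t ht)).le hL.integral_pos.le
  · exact le_rfl

lemma localPdf_of_nonpos {t : ℝ} (ht : t ≤ 0) : localPdf a L t = 0 := by
  unfold localPdf
  rw [if_neg (not_lt.mpr ht)]

lemma LocalPriorClass.measurable_localPdf (hL : LocalPriorClass a L) :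
    Measurable (localPdf a L) := by
  have := hL.measurable
  unfold localPdf
  refine Measurable.ite measurableSet_Ioi ?_ measurable_const
  fun_prop

lemma LocalPriorClass.isProbabilityMeasure (hL : LocalPriorClass a L) :
    IsProbabilityMeasure (localLaw a L) := by
  constructor
  have h1 : ∀ t, ENNReal.ofReal (localPdf a L t) = (Ioi (0 : ℝ)).indicator (fun t =>
      ENNReal.ofReal (t ^ (-a - 1) * L t / ∫ u in Ioi (0 : ℝ), u ^ (-a - 1) * L u)) t := by
    intro t
    by_cases ht : 0 < t
    · rw [Set.indicator_of_mem (show t ∈ Ioi (0 : ℝ) from ht), localPdf, if_pos ht]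
    · rw [Set.indicator_of_notMem (show t ∉ Ioi (0 : ℝ) from ht), localPdf, if_neg ht,
        ENNReal.ofReal_zero]
  rw [localLaw, withDensity_apply _ MeasurableSet.univ, Measure.restrict_univ]
  simp_rw [h1]
  rw [lintegral_indicator measurableSet_Ioi, ← ofReal_integral_eq_lintegral_ofReal, integral_div,
    div_self hL.integral_pos.ne', ENNReal.ofReal_one]
  · exact hL.integrable.div_const _
  · filter_upwards [ae_restrict_mem measurableSet_Ioi] with u hu
    exact div_nonneg (mul_pos (Real.rpow_pos_of_pos hu _) (hL.pos u hu)).le hL.integral_pos.le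

lemma LocalPriorClass.ae_pos (hL : LocalPriorClass a L) : ∀ᵐ t ∂(localLaw a L), 0 < t := by
  rw [localLaw, ae_withDensity_iff hL.measurable_localPdf.ennreal_ofReal]
  refine ae_of_all _ fun t ht => ?_
  by_contra h
  exact ht (by rw [localPdf_of_nonpos (not_lt.mp h), ENNReal.ofReal_zero])

lemma LocalPriorClass.lintegral_eq (hL : LocalPriorClass a L) {f : ℝ → ℝ≥0∞} (hf : Measurable f) :
    ∫⁻ t, f t ∂(localLaw a L) = ∫⁻ t, ENNReal.ofReal (localPdf a L t) * f t := by
  rw [localLaw, lintegral_withDensity_eq_lintegral_mul _ hL.measurable_localPdf.ennreal_ofReal hf]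
  rfl

lemma LocalPriorClass.lintegral_pi (hL : LocalPriorClass a L) {G : ℕ} {f : (Fin G → ℝ) → ℝ≥0∞}
    (hf : Measurable f) :
    ∫⁻ lam, f lam ∂(Measure.pi fun _ => localLaw a L) =
      ∫⁻ lam : Fin G → ℝ, (∏ g, ENNReal.ofReal (localPdf a L (lam g))) * f lam := by
  have := hL.isProbabilityMeasure
  have hm : Measurable fun lam : Fin G → ℝ => ∏ g, ENNReal.ofReal (localPdf a L (lam g)) :=
    Finset.measurable_prod _ fun g _ =>
      (hL.measurable_localPdf.comp (measurable_pi_apply g)).ennreal_ofReal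
  unfold localLaw at this ⊢
  rw [pi_withDensity_fin hL.measurable_localPdf.ennreal_ofReal,
    lintegral_withDensity_eq_lintegral_mul _ hm hf]
  rfl

lemma LocalPriorClass.ae_pos_pi (hL : LocalPriorClass a L) (G : ℕ) :
    ∀ᵐ lam ∂(Measure.pi fun _ : Fin G => localLaw a L), ∀ g, 0 < lam g := by
  have := hL.isProbabilityMeasure
  rw [ae_all_iff]
  intro g
  exact (measurePreserving_eval (fun _ : Fin G => localLaw a L) g).quasiMeasurePreserving.ae
    hL.ae_pos

end LocalLaw

/-! ### Gaussian kernels -/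

section Kernel

variable {n : ℕ} {ι : Type*} [Fintype ι] {A : Matrix (Fin n) ι ℝ} {c σ : ℝ}

lemma continuous_gaussKernel : Continuous (gaussKernel A σ) := by
  unfold gaussKernel
  simp only [dotProduct, Matrix.mulVec]
  fun_prop

lemma gaussKernel_pos (x : ι → ℝ) : 0 < gaussKernel A σ x := Real.exp_pos _

lemma gaussKernel_le (hA : BoundedBelow A c) (hσ : 0 < σ) (x : ι → ℝ) :
    gaussKernel A σ x ≤ Real.exp (-(c / (2 * σ ^ 2)) * ∑ i, x i ^ 2) := by
  unfold gaussKernel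
  apply Real.exp_le_exp.mpr
  have h := hA x
  have h2 : x ⬝ᵥ x = ∑ i, x i ^ 2 := by
    simp only [dotProduct, sq]
  rw [h2] at h
  rw [neg_div, neg_mul, neg_le_neg_iff, div_mul_eq_mul_div]
  gcongr

lemma integrable_exp_neg_sum_sq {b : ℝ} (hb : 0 < b) :
    Integrable fun x : ι → ℝ => Real.exp (-b * ∑ i, x i ^ 2) := by
  simp_rw [Finset.mul_sum, Real.exp_sum]
  exact Integrable.fintype_prod fun _ => integrable_exp_neg_mul_sq hb

lemma integrable_gaussKernel (hc : 0 < c) (hA : BoundedBelow A c) (hσ : 0 < σ) :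
    Integrable (gaussKernel A σ) := by
  refine (integrable_exp_neg_sum_sq (b := c / (2 * σ ^ 2)) (by positivity)).mono'
    continuous_gaussKernel.aestronglyMeasurable (ae_of_all _ fun x => ?_)
  rw [Real.norm_of_nonneg (gaussKernel_pos x).le]
  exact gaussKernel_le hA hσ x

lemma integrable_abs_mul_gaussKernel (hc : 0 < c) (hA : BoundedBelow A c) (hσ : 0 < σ) (i : ι) :
    Integrable fun x => |x i| * gaussKernel A σ x := by
  -- Half of the Gaussian decay rate: one half of the exponent absorbs the factor `|x i|`, the other
  -- keeps the bound integrable.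
  set b := c / (4 * σ ^ 2) with hb
  have hb0 : 0 < b := by positivity
  refine ((integrable_exp_neg_sum_sq hb0).const_mul (1 + 1 / b)).mono'
    (((continuous_apply i).abs.mul continuous_gaussKernel).aestronglyMeasurable)
    (ae_of_all _ fun x => ?_)
  rw [Real.norm_of_nonneg (mul_nonneg (abs_nonneg _) (gaussKernel_pos x).le)]
  have h1 := gaussKernel_le hA hσ x
  have h2 : -(c / (2 * σ ^ 2)) * ∑ i, x i ^ 2 =
      -b * ∑ i, x i ^ 2 + -b * ∑ i, x i ^ 2 := by
    rw [hb]; field_simp; ring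
  have h3 : |x i| ≤ (1 + 1 / b) * Real.exp (b * ∑ i, x i ^ 2) := by
    have hs : x i ^ 2 ≤ ∑ i, x i ^ 2 :=
      Finset.single_le_sum (f := fun i => x i ^ 2) (fun _ _ => sq_nonneg _) (Finset.mem_univ i)
    have he := Real.add_one_le_exp (b * ∑ i, x i ^ 2)
    have h4 : |x i| ≤ 1 + x i ^ 2 := by
      rw [← sq_abs]; nlinarith [sq_nonneg (|x i| - 1)]
    have h5 : x i ^ 2 ≤ 1 / b * Real.exp (b * ∑ i, x i ^ 2) := by
      rw [div_mul_eq_mul_div, one_mul, le_div_iff₀ hb0]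
      nlinarith
    have h6 : 1 ≤ Real.exp (b * ∑ i, x i ^ 2) := by
      apply Real.one_le_exp; positivity
    linarith
  calc |x i| * gaussKernel A σ x
      ≤ ((1 + 1 / b) * Real.exp (b * ∑ i, x i ^ 2)) *
        Real.exp (-(c / (2 * σ ^ 2)) * ∑ i, x i ^ 2) := by
        gcongr
        exact (gaussKernel_pos x).le
    _ = (1 + 1 / b) * Real.exp (-b * ∑ i, x i ^ 2) := by
        rw [mul_assoc, ← Real.exp_add, h2]
        ring_nf

/-- The total mass of the Gaussian kernel. -/
def kernelMass (A : Matrix (Fin n) ι ℝ) (σ : ℝ) : ℝ≥0∞ := ∫⁻ x, ENNReal.ofReal (gaussKernel A σ x)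

lemma kernelMass_ne_top (hc : 0 < c) (hA : BoundedBelow A c) (hσ : 0 < σ) :
    kernelMass A σ ≠ ∞ :=
  (integrable_gaussKernel hc hA hσ).lintegral_lt_top.ne

lemma kernelMass_ne_zero : kernelMass A σ ≠ 0 := by
  unfold kernelMass
  rw [ne_eq, lintegral_eq_zero_iff continuous_gaussKernel.measurable.ennreal_ofReal]
  intro h
  have : ∀ᵐ _x : ι → ℝ, False := by
    filter_upwards [h] with x hx
    simp only [Pi.zero_apply, ENNReal.ofReal_eq_zero] at hx
    exact absurd (gaussKernel_pos x) (not_lt.mpr hx)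
  exact NeZero.ne (volume : Measure (ι → ℝ)) (by simpa using this)

end Kernel

/-- Rescaling the coordinates in a Lebesgue integral. -/
lemma lintegral_comp_diagonal {ι : Type*} [Fintype ι] [DecidableEq ι] {D : ι → ℝ}
    (hD : ∀ i, 0 < D i) (v : ι → ℝ) {f : (ι → ℝ) → ℝ≥0∞} (hf : Measurable f) :
    ∫⁻ x, f x = ENNReal.ofReal (∏ i, D i) * ∫⁻ x : ι → ℝ, f (fun i => D i * x i + v i) := by
  have hdet : (Matrix.diagonal D).det = ∏ i, D i := Matrix.det_diagonal
  have hpos : 0 < ∏ i, D i := Finset.prod_pos fun i _ => hD i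
  have h := Real.smul_map_diagonal_volume_pi (D := D) (by rw [hdet]; exact hpos.ne')
  rw [hdet, abs_of_pos hpos] at h
  rw [← lintegral_add_right_eq_self f v]
  conv_lhs => rw [← h]
  rw [lintegral_smul_measure, lintegral_map (by fun_prop) (by fun_prop), smul_eq_mul]
  congr 1
  refine lintegral_congr fun x => ?_
  congr 1
  ext i
  simp [Matrix.mulVec_diagonal]

/-! ### Posterior expectations -/

section Posterior

variable {n G : ℕ} {m : Fin G → ℕ} {X : Matrix (Fin n) (Idx m) ℝ} {c σ a : ℝ} {L : ℝ → ℝ}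
  {π : Measure ℝ}

/-- The inverse of `coefOf`. -/
def standardize (X : Matrix (Fin n) (Idx m) ℝ) (y : Fin n → ℝ) (θ : Param m) : Idx m → ℝ :=
  fun p => (θ.2.2 p - shrinkU θ.1 (θ.2.1 p.1) * ols X y p) / √(shrinkU θ.1 (θ.2.1 p.1))

/-- The joint density after completing the square. -/
def jointSquared (X : Matrix (Fin n) (Idx m) ℝ) (σ a : ℝ) (L : ℝ → ℝ) (y : Fin n → ℝ)
    (θ : Param m) : ℝ :=
  dataFactor X σ y *
    (∏ g, groupWeight (m g) (groupStat X σ y g) θ.1 (θ.2.1 g) * localPdf a L (θ.2.1 g)) *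
    (∏ p : Idx m, √(shrinkU θ.1 (θ.2.1 p.1)))⁻¹ * gaussKernel X σ (standardize X y θ)

lemma standardize_coefOf {τ : ℝ} (hτ : 0 < τ) {lam : Fin G → ℝ} (hlam : ∀ g, 0 < lam g)
    (y : Fin n → ℝ) (x : Idx m → ℝ) : standardize X y (τ, lam, coefOf X y τ lam x) = x := by
  ext p
  have := Real.sqrt_pos.mpr (shrinkU_pos hτ (hlam p.1))
  simp only [standardize, coefOf]
  field_simp
  ring

lemma coefOf_standardize {τ : ℝ} (hτ : 0 < τ) {lam : Fin G → ℝ} (hlam : ∀ g, 0 < lam g)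
    (y : Fin n → ℝ) (β : Idx m → ℝ) : coefOf X y τ lam (standardize X y (τ, lam, β)) = β := by
  ext p
  have := Real.sqrt_pos.mpr (shrinkU_pos hτ (hlam p.1))
  simp only [standardize, coefOf]
  field_simp
  ring

lemma prod_localPdf_eq_zero {lam : Fin G → ℝ} {g : Fin G} (hg : lam g ≤ 0) (f : Fin G → ℝ) :
    ∏ g, f g * localPdf a L (lam g) = 0 :=
  Finset.prod_eq_zero (Finset.mem_univ g) (by rw [localPdf_of_nonpos hg, mul_zero])

/-- Where some λ_g² ≤ 0 the prior density kills both sides; elsewhere this is `jointPdf_coefOf` at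
the standardised coefficients. Measurability of the joint density is read off from the completed
square, which contains no parameter-dependent matrix inverse. -/
lemma jointPdf_eq_jointSquared (hX : BlockOrthogonal X) (hc : 0 < c) (hA : BoundedBelow X c)
    (hσ : 0 < σ) (y : Fin n → ℝ) {θ : Param m} (hτ : 0 < θ.1) :
    jointPdf X σ a L y θ = jointSquared X σ a L y θ := by
  by_cases hlam : ∀ g, 0 < θ.2.1 g
  · have h := jointPdf_coefOf (a := a) L hX hc hA hσ hτ hlam y
      (standardize X y (θ.1, θ.2.1, θ.2.2))
    rw [coefOf_standardize hτ hlam] at h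
    exact h
  · push Not at hlam
    obtain ⟨g, hg⟩ := hlam
    rw [jointPdf, jointSquared, prod_localPdf_eq_zero hg, prod_localPdf_eq_zero hg]
    simp

lemma measurable_jointSquared (hL : LocalPriorClass a L) (y : Fin n → ℝ) :
    Measurable (jointSquared X σ a L y) := by
  have h1 := hL.measurable_localPdf
  unfold jointSquared
  refine Measurable.mul (Measurable.mul (Measurable.mul measurable_const ?_) ?_) ?_
  · refine Finset.measurable_prod _ fun g _ => Measurable.mul ?_ ?_
    · exact (measurable_groupWeight (m g)).comp (by fun_prop : Measurable fun θ : Param m =>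
        (groupStat X σ y g, θ.1, θ.2.1 g))
    · exact h1.comp (by fun_prop)
  · refine (Finset.measurable_prod _ fun p _ => ?_).inv
    unfold shrinkU
    fun_prop
  · refine continuous_gaussKernel.measurable.comp ?_
    unfold standardize shrinkU
    fun_prop

lemma ae_refMeasure [SFinite π] (hπ : ∀ᵐ τ ∂π, 0 < τ) : ∀ᵐ θ ∂(refMeasure m π), 0 < θ.1 :=
  Measure.quasiMeasurePreserving_fst.ae hπ

lemma measurable_coefOf (y : Fin n → ℝ) :
    Measurable fun q : ℝ × (Fin G → ℝ) × (Idx m → ℝ) => coefOf X y q.1 q.2.1 q.2.2 := by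
  unfold coefOf shrinkU
  fun_prop

/-- The product of the group weights. -/
def lamWeight (X : Matrix (Fin n) (Idx m) ℝ) (σ : ℝ) (y : Fin n → ℝ) (τ : ℝ) (lam : Fin G → ℝ) :
    ℝ≥0∞ :=
  ∏ g, ENNReal.ofReal (groupWeight (m g) (groupStat X σ y g) τ (lam g))

lemma measurable_lamWeight :
    Measurable fun q : (Fin n → ℝ) × ℝ × (Fin G → ℝ) => lamWeight X σ q.1 q.2.1 q.2.2 := by
  unfold lamWeight
  refine Finset.measurable_prod _ fun g _ => ENNReal.measurable_ofReal.comp ?_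
  have h := (continuous_groupStat (X := X) σ g).measurable
  exact (measurable_groupWeight (m g)).comp
    (by fun_prop : Measurable fun q : (Fin n → ℝ) × ℝ × (Fin G → ℝ) =>
      (groupStat X σ q.1 g, q.2.1, q.2.2 g))

lemma measurable_lamWeight_left (y : Fin n → ℝ) :
    Measurable fun q : ℝ × (Fin G → ℝ) => lamWeight X σ y q.1 q.2 := by
  have h := measurable_lamWeight (X := X) (σ := σ)
  have h2 : Measurable fun q : ℝ × (Fin G → ℝ) => (y, q) := by fun_prop
  simpa only [Function.comp_def] using h.comp h2

lemma measurable_lamWeight_lam (y : Fin n → ℝ) (τ : ℝ) :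
    Measurable fun lam : Fin G → ℝ => lamWeight X σ y τ lam := by
  have h := measurable_lamWeight_left (X := X) (σ := σ) y
  have h2 : Measurable fun q : Fin G → ℝ => (τ, q) := by fun_prop
  simpa only [Function.comp_def] using h.comp h2

/-- Tonelli in the order τ, λ², β, followed by the substitution β = `coefOf`. Its Jacobian ∏√u
cancels the inverse product left by `jointPdf_coefOf`, and the local densities are absorbed into
`localLaw`. -/
lemma lintegral_jointPdf [IsProbabilityMeasure π] (hX : BlockOrthogonal X) (hc : 0 < c)
    (hA : BoundedBelow X c) (hσ : 0 < σ) (hL : LocalPriorClass a L) (hπ : ∀ᵐ τ ∂π, 0 < τ)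
    (y : Fin n → ℝ) {F : Param m → ℝ≥0∞} (hF : Measurable F) :
    ∫⁻ θ, ENNReal.ofReal (jointPdf X σ a L y θ) * F θ ∂(refMeasure m π) =
      ENNReal.ofReal (dataFactor X σ y) * ∫⁻ τ, ∫⁻ lam : Fin G → ℝ, lamWeight X σ y τ lam *
        (∫⁻ x, F (τ, lam, coefOf X y τ lam x) * ENNReal.ofReal (gaussKernel X σ x))
        ∂(Measure.pi fun _ : Fin G => localLaw a L) ∂π := by
  have := hL.isProbabilityMeasure
  have hJ : Measurable fun θ => ENNReal.ofReal (jointSquared X σ a L y θ) :=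
    (measurable_jointSquared hL y).ennreal_ofReal
  have h1 : ∫⁻ θ, ENNReal.ofReal (jointPdf X σ a L y θ) * F θ ∂(refMeasure m π) =
      ∫⁻ θ, ENNReal.ofReal (jointSquared X σ a L y θ) * F θ ∂(refMeasure m π) := by
    refine lintegral_congr_ae ?_
    filter_upwards [ae_refMeasure hπ] with θ hθ
    rw [jointPdf_eq_jointSquared hX hc hA hσ y hθ]
  have hJF : Measurable fun θ => ENNReal.ofReal (jointSquared X σ a L y θ) * F θ := hJ.mul hF
  rw [h1, refMeasure, lintegral_prod _ hJF.aemeasurable]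
  have hK : Measurable fun q : ℝ × (Fin G → ℝ) => ∫⁻ x,
      F (q.1, q.2, coefOf X y q.1 q.2 x) * ENNReal.ofReal (gaussKernel X σ x) := by
    have : Measurable fun q : (ℝ × (Fin G → ℝ)) × (Idx m → ℝ) =>
        F (q.1.1, q.1.2, coefOf X y q.1.1 q.1.2 q.2) *
          ENNReal.ofReal (gaussKernel X σ q.2) := by
      refine (hF.comp ?_).mul (continuous_gaussKernel.measurable.comp measurable_snd).ennreal_ofReal
      exact (by fun_prop : Measurable fun q : (ℝ × (Fin G → ℝ)) × (Idx m → ℝ) => q.1.1).prodMk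
        ((by fun_prop : Measurable fun q : (ℝ × (Fin G → ℝ)) × (Idx m → ℝ) => q.1.2).prodMk
        ((measurable_coefOf y).comp (by fun_prop :
          Measurable fun q : (ℝ × (Fin G → ℝ)) × (Idx m → ℝ) => (q.1.1, q.1.2, q.2))))
    exact this.lintegral_prod_right'
  have hWK : Measurable fun q : ℝ × (Fin G → ℝ) => lamWeight X σ y q.1 q.2 * ∫⁻ x,
      F (q.1, q.2, coefOf X y q.1 q.2 x) * ENNReal.ofReal (gaussKernel X σ x) :=
    (measurable_lamWeight_left (X := X) (σ := σ) y).mul hK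
  rw [← lintegral_const_mul _ hWK.lintegral_prod_right']
  refine lintegral_congr_ae ?_
  filter_upwards [hπ] with τ hτ
  have hWKτ : Measurable fun lam => lamWeight X σ y τ lam *
      ∫⁻ x, F (τ, lam, coefOf X y τ lam x) * ENNReal.ofReal (gaussKernel X σ x) :=
    by simpa only [Function.comp_def] using
      hWK.comp (by fun_prop : Measurable fun lam : Fin G → ℝ => (τ, lam))
  have hJτ : Measurable fun q : (Fin G → ℝ) × (Idx m → ℝ) =>
      ENNReal.ofReal (jointSquared X σ a L y (τ, q)) * F (τ, q) :=
    by simpa only [Function.comp_def] using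
      hJF.comp (by fun_prop : Measurable fun q : (Fin G → ℝ) × (Idx m → ℝ) => (τ, q))
  rw [lintegral_prod _ hJτ.aemeasurable, hL.lintegral_pi hWKτ,
    ← lintegral_const_mul _ (by
      refine Measurable.mul (Finset.measurable_prod _ fun g _ => ?_) hWKτ
      exact (hL.measurable_localPdf.comp (measurable_pi_apply g)).ennreal_ofReal)]
  refine lintegral_congr fun lam => ?_
  by_cases hlam : ∀ g, 0 < lam g
  · have hD : ∀ p : Idx m, 0 < √(shrinkU τ (lam p.1)) := fun p =>
      Real.sqrt_pos.mpr (shrinkU_pos hτ (hlam p.1))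
    have hP : 0 < ∏ p : Idx m, √(shrinkU τ (lam p.1)) := Finset.prod_pos fun p _ => hD p
    have hJβ : Measurable fun β : Idx m → ℝ =>
        ENNReal.ofReal (jointSquared X σ a L y (τ, lam, β)) * F (τ, lam, β) :=
      hJτ.comp (by fun_prop : Measurable fun β : Idx m → ℝ => (lam, β))
    rw [lintegral_comp_diagonal hD (fun p => shrinkU τ (lam p.1) * ols X y p) hJβ]
    have hval : ∀ x, jointSquared X σ a L y (τ, lam, coefOf X y τ lam x) =
        dataFactor X σ y *
          (∏ g, groupWeight (m g) (groupStat X σ y g) τ (lam g) * localPdf a L (lam g)) *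
          (∏ p : Idx m, √(shrinkU τ (lam p.1)))⁻¹ * gaussKernel X σ x := by
      intro x
      rw [jointSquared, standardize_coefOf hτ hlam]
    have hval' : ∀ x, ENNReal.ofReal (jointSquared X σ a L y (τ, lam, coefOf X y τ lam x)) *
        F (τ, lam, coefOf X y τ lam x) =
        ENNReal.ofReal (dataFactor X σ y * (∏ g, groupWeight (m g) (groupStat X σ y g) τ (lam g) *
          localPdf a L (lam g)) * (∏ p : Idx m, √(shrinkU τ (lam p.1)))⁻¹) *
        (F (τ, lam, coefOf X y τ lam x) * ENNReal.ofReal (gaussKernel X σ x)) := by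
      intro x
      rw [hval, ENNReal.ofReal_mul' (gaussKernel_pos x).le]
      ring
    have hd := (dataFactor_pos hc hA hσ y).le
    change _ * ∫⁻ x, ENNReal.ofReal (jointSquared X σ a L y (τ, lam, coefOf X y τ lam x)) *
        F (τ, lam, coefOf X y τ lam x) = _
    simp_rw [hval']
    rw [lintegral_const_mul _ (by
      refine (hF.comp ?_).mul continuous_gaussKernel.measurable.ennreal_ofReal
      exact measurable_const.prodMk (measurable_const.prodMk ((measurable_coefOf y).comp
        (by fun_prop : Measurable fun x : Idx m → ℝ => (τ, lam, x)))))]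
    have h2 : ∏ g, ENNReal.ofReal (localPdf a L (lam g)) =
        ENNReal.ofReal (∏ g, localPdf a L (lam g)) :=
      (ENNReal.ofReal_prod_of_nonneg fun g _ => hL.localPdf_nonneg _).symm
    have h3 : lamWeight X σ y τ lam =
        ENNReal.ofReal (∏ g, groupWeight (m g) (groupStat X σ y g) τ (lam g)) :=
      (ENNReal.ofReal_prod_of_nonneg fun g _ => groupWeight_nonneg _ _ _ _).symm
    have h4 := Finset.prod_nonneg fun g (_ : g ∈ Finset.univ) => hL.localPdf_nonneg (lam g)
    have h5 := Finset.prod_nonneg fun g (_ : g ∈ Finset.univ) =>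
      groupWeight_nonneg (m g) (groupStat X σ y g) τ (lam g)
    rw [h2, h3, Finset.prod_mul_distrib, ← mul_assoc, ← ENNReal.ofReal_mul hP.le,
      ← mul_assoc (ENNReal.ofReal _) (ENNReal.ofReal _) (∫⁻ x, _), ← ENNReal.ofReal_mul h4,
      ← mul_assoc (ENNReal.ofReal _) (ENNReal.ofReal _) (∫⁻ x, _), ← ENNReal.ofReal_mul hd]
    congr 2
    field_simp
  · push Not at hlam
    obtain ⟨g, hg⟩ := hlam
    have h0 : ∏ g, ENNReal.ofReal (localPdf a L (lam g)) = 0 :=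
      Finset.prod_eq_zero (Finset.mem_univ g) (by rw [localPdf_of_nonpos hg, ENNReal.ofReal_zero])
    rw [h0]
    simp [jointSquared, prod_localPdf_eq_zero hg]

end Posterior

/-! ### Posterior moments of the shrinkage coefficients and of the regression coefficients. -/

section PosteriorMoments

variable {n G : ℕ} {m : Fin G → ℕ} {X : Matrix (Fin n) (Idx m) ℝ} {c σ a : ℝ} {L : ℝ → ℝ}
  {π : Measure ℝ}

/-- The unnormalised posterior integral of a function of `(τ, λ²)`. -/
def shrinkIntegral (X : Matrix (Fin n) (Idx m) ℝ) (σ a : ℝ) (L : ℝ → ℝ) (π : Measure ℝ)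
    (y : Fin n → ℝ) (F : ℝ → (Fin G → ℝ) → ℝ≥0∞) : ℝ≥0∞ :=
  ∫⁻ τ, ∫⁻ lam : Fin G → ℝ, lamWeight X σ y τ lam * F τ lam
    ∂(Measure.pi fun _ : Fin G => localLaw a L) ∂π

lemma lamWeight_le {τ : ℝ} {lam : Fin G → ℝ} (hlam : ∀ g, 0 < lam g) (y : Fin n → ℝ) :
    lamWeight X σ y τ lam ≤ ∏ g, ENNReal.ofReal (Real.exp (groupStat X σ y g / 2)) := by
  refine Finset.prod_le_prod' fun g _ => ENNReal.ofReal_le_ofReal ?_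
  have h1 := shrinkK_le_one (τ := τ) (hlam g).le
  have h2 := shrinkU_le_one (τ := τ) (hlam g).le
  have h3 := shrinkU_nonneg (τ := τ) (hlam g).le
  have h4 := groupStat_nonneg (X := X) σ y g
  unfold groupWeight
  calc √(shrinkK τ (lam g)) ^ m g * Real.exp (shrinkU τ (lam g) * groupStat X σ y g / 2)
      ≤ 1 * Real.exp (groupStat X σ y g / 2) := by
        gcongr
        · exact pow_le_one₀ (Real.sqrt_nonneg _) (Real.sqrt_le_iff.mpr ⟨zero_le_one, by simpa using h1⟩)
        · nlinarith
    _ = _ := one_mul _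

lemma lamWeight_ne_zero {τ : ℝ} {lam : Fin G → ℝ} (hlam : ∀ g, 0 < lam g) (y : Fin n → ℝ) :
    lamWeight X σ y τ lam ≠ 0 := by
  unfold lamWeight
  rw [Finset.prod_ne_zero_iff]
  intro g _
  simpa using groupWeight_pos (hlam g).le

lemma shrinkIntegral_lt_top [IsProbabilityMeasure π] (hL : LocalPriorClass a L) (y : Fin n → ℝ)
    {F : ℝ → (Fin G → ℝ) → ℝ≥0∞} {K : ℝ≥0∞} (hK : K ≠ ∞)
    (hF : ∀ τ lam, (∀ g, 0 < lam g) → F τ lam ≤ K) : shrinkIntegral X σ a L π y F < ∞ := by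
  have := hL.isProbabilityMeasure
  have h : shrinkIntegral X σ a L π y F ≤ ∫⁻ _τ, ∫⁻ _lam : Fin G → ℝ,
      (∏ g, ENNReal.ofReal (Real.exp (groupStat X σ y g / 2))) * K
      ∂(Measure.pi fun _ : Fin G => localLaw a L) ∂π := by
    refine lintegral_mono fun τ => lintegral_mono_ae ?_
    filter_upwards [hL.ae_pos_pi G] with lam hlam
    exact mul_le_mul' (lamWeight_le hlam y) (hF τ lam hlam)
  refine h.trans_lt ?_
  simp only [lintegral_const, measure_univ, mul_one]
  exact ENNReal.mul_lt_top (ENNReal.prod_lt_top fun _ _ => ENNReal.ofReal_lt_top) hK.lt_top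

lemma shrinkIntegral_one_ne_zero [IsProbabilityMeasure π] (hL : LocalPriorClass a L)
    (y : Fin n → ℝ) : shrinkIntegral X σ a L π y (fun _ _ => 1) ≠ 0 := by
  have := hL.isProbabilityMeasure
  have hm := measurable_lamWeight_left (X := X) (σ := σ) y
  intro h
  simp only [shrinkIntegral, mul_one] at h
  rw [lintegral_eq_zero_iff hm.lintegral_prod_right'] at h
  have hf : ∀ᵐ _τ ∂π, False := by
    filter_upwards [h] with τ hτ
    simp only [Pi.zero_apply] at hτ
    rw [lintegral_eq_zero_iff (measurable_lamWeight_lam y τ)] at hτ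
    have hf : ∀ᵐ _lam ∂(Measure.pi fun _ : Fin G => localLaw a L), False := by
      filter_upwards [hτ, hL.ae_pos_pi G] with lam h1 h2
      exact lamWeight_ne_zero h2 y h1
    exact IsProbabilityMeasure.ne_zero _ (by simpa using hf)
  exact IsProbabilityMeasure.ne_zero π (by simpa using hf)

lemma shrinkIntegral_one_lt_top [IsProbabilityMeasure π] (hL : LocalPriorClass a L)
    (y : Fin n → ℝ) : shrinkIntegral X σ a L π y (fun _ _ => 1) < ∞ :=
  shrinkIntegral_lt_top hL y ENNReal.one_ne_top fun _ _ _ => le_rfl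

lemma aemeasurable_jointPdf [SFinite π] (hX : BlockOrthogonal X) (hc : 0 < c)
    (hA : BoundedBelow X c) (hσ : 0 < σ) (hL : LocalPriorClass a L) (hπ : ∀ᵐ τ ∂π, 0 < τ)
    (y : Fin n → ℝ) :
    AEMeasurable (fun θ => ENNReal.ofReal (jointPdf X σ a L y θ)) (refMeasure m π) := by
  refine (measurable_jointSquared (X := X) (σ := σ) hL y).ennreal_ofReal.aemeasurable.congr ?_
  filter_upwards [ae_refMeasure hπ] with θ hθ
  rw [jointPdf_eq_jointSquared hX hc hA hσ y hθ]

/-- The data factor cancels between Bayes' numerator and denominator. In the denominator the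
Gaussian integral over x does not involve (τ, λ²) and splits off as `kernelMass`. -/
lemma lintegral_posterior [IsProbabilityMeasure π] (hX : BlockOrthogonal X) (hc : 0 < c)
    (hA : BoundedBelow X c) (hσ : 0 < σ) (hL : LocalPriorClass a L) (hπ : ∀ᵐ τ ∂π, 0 < τ)
    (y : Fin n → ℝ) {F : Param m → ℝ≥0∞} (hF : Measurable F) :
    ∫⁻ θ, F θ ∂(posterior X σ a L π y) =
      shrinkIntegral X σ a L π y (fun τ lam =>
        ∫⁻ x, F (τ, lam, coefOf X y τ lam x) * ENNReal.ofReal (gaussKernel X σ x)) /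
      (shrinkIntegral X σ a L π y (fun _ _ => 1) * kernelMass X σ) := by
  have h1 := lintegral_jointPdf hX hc hA hσ hL hπ y (F := fun _ => 1) measurable_const
  simp only [mul_one, one_mul] at h1
  have h2 : ∫⁻ τ, ∫⁻ lam : Fin G → ℝ, lamWeight X σ y τ lam *
      (∫⁻ x, ENNReal.ofReal (gaussKernel X σ x)) ∂(Measure.pi fun _ : Fin G => localLaw a L) ∂π =
      shrinkIntegral X σ a L π y (fun _ _ => 1) * kernelMass X σ := by
    have := hL.isProbabilityMeasure
    simp only [shrinkIntegral, mul_one]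
    rw [← lintegral_mul_const _ (measurable_lamWeight_left (X := X) y).lintegral_prod_right']
    refine lintegral_congr fun τ => ?_
    rw [lintegral_mul_const _ (measurable_lamWeight_lam y τ)]
    rfl
  rw [h2] at h1
  rw [posterior, lintegral_smul_measure,
    lintegral_withDensity_eq_lintegral_mul₀ (aemeasurable_jointPdf hX hc hA hσ hL hπ y)
      hF.aemeasurable]
  simp only [Pi.mul_apply]
  rw [lintegral_jointPdf hX hc hA hσ hL hπ y hF, h1, smul_eq_mul]
  have hd0 : ENNReal.ofReal (dataFactor X σ y) ≠ 0 := by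
    simpa using dataFactor_pos hc hA hσ y
  rw [mul_comm, ← div_eq_mul_inv]
  exact ENNReal.mul_div_mul_left _ _ hd0 ENNReal.ofReal_ne_top

lemma lintegral_posterior_shrink [IsProbabilityMeasure π] (hX : BlockOrthogonal X) (hc : 0 < c)
    (hA : BoundedBelow X c) (hσ : 0 < σ) (hL : LocalPriorClass a L) (hπ : ∀ᵐ τ ∂π, 0 < τ)
    (y : Fin n → ℝ) {F : ℝ → (Fin G → ℝ) → ℝ≥0∞}
    (hF : Measurable fun q : ℝ × (Fin G → ℝ) => F q.1 q.2) :
    ∫⁻ θ, F θ.1 θ.2.1 ∂(posterior X σ a L π y) =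
      shrinkIntegral X σ a L π y F / shrinkIntegral X σ a L π y (fun _ _ => 1) := by
  have := hL.isProbabilityMeasure
  have hF' : Measurable fun θ : Param m => F θ.1 θ.2.1 :=
    hF.comp (by fun_prop : Measurable fun θ : Param m => (θ.1, θ.2.1))
  have hWF : Measurable fun q : ℝ × (Fin G → ℝ) => lamWeight X σ y q.1 q.2 * F q.1 q.2 :=
    (measurable_lamWeight_left (X := X) (σ := σ) y).mul hF
  rw [lintegral_posterior hX hc hA hσ hL hπ y hF']
  have h : shrinkIntegral X σ a L π y (fun τ lam =>
        ∫⁻ x, F τ lam * ENNReal.ofReal (gaussKernel X σ x)) =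
      shrinkIntegral X σ a L π y F * kernelMass X σ := by
    unfold shrinkIntegral
    rw [← lintegral_mul_const _ hWF.lintegral_prod_right']
    refine lintegral_congr fun τ => ?_
    have hWFτ : Measurable fun lam => lamWeight X σ y τ lam * F τ lam := by
      simpa only [Function.comp_def] using
        hWF.comp (by fun_prop : Measurable fun lam : Fin G → ℝ => (τ, lam))
    rw [← lintegral_mul_const _ hWFτ]
    refine lintegral_congr fun lam => ?_
    rw [mul_assoc, kernelMass,
      ← lintegral_const_mul _ continuous_gaussKernel.measurable.ennreal_ofReal]
  rw [h]
  exact ENNReal.mul_div_mul_right _ _ kernelMass_ne_zero (kernelMass_ne_top hc hA hσ)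

lemma isProbabilityMeasure_posterior [IsProbabilityMeasure π] (hX : BlockOrthogonal X) (hc : 0 < c)
    (hA : BoundedBelow X c) (hσ : 0 < σ) (hL : LocalPriorClass a L) (hπ : ∀ᵐ τ ∂π, 0 < τ)
    (y : Fin n → ℝ) : IsProbabilityMeasure (posterior X σ a L π y) := by
  constructor
  have h := lintegral_posterior_shrink hX hc hA hσ hL hπ y (F := fun _ _ => 1) measurable_const
  rw [lintegral_one] at h
  rw [h]
  exact ENNReal.div_self (shrinkIntegral_one_ne_zero hL y) (shrinkIntegral_one_lt_top hL y).ne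

/-- The reference measure charges nonpositive λ_g², where κ_g is not a shrinkage factor; the prior
density removes this region from the posterior. -/
lemma ae_posterior_pos [IsProbabilityMeasure π] (hX : BlockOrthogonal X) (hc : 0 < c)
    (hA : BoundedBelow X c) (hσ : 0 < σ) (hL : LocalPriorClass a L) (hπ : ∀ᵐ τ ∂π, 0 < τ)
    (y : Fin n → ℝ) : ∀ᵐ θ ∂(posterior X σ a L π y), ∀ g, 0 < θ.2.1 g := by
  rw [ae_all_iff]
  intro g
  have hs : MeasurableSet {t : ℝ | t ≤ 0} := measurableSet_Iic
  have h := lintegral_posterior_shrink hX hc hA hσ hL hπ y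
    (F := fun _ lam => {t : ℝ | t ≤ 0}.indicator 1 (lam g))
    ((measurable_one.indicator hs).comp (by fun_prop))
  have h0 : shrinkIntegral X σ a L π y (fun _ lam => {t : ℝ | t ≤ 0}.indicator 1 (lam g)) = 0 := by
    have : ∀ τ, ∫⁻ lam : Fin G → ℝ, lamWeight X σ y τ lam * {t : ℝ | t ≤ 0}.indicator 1 (lam g)
        ∂(Measure.pi fun _ : Fin G => localLaw a L) = 0 := by
      intro τ
      refine lintegral_eq_zero_of_ae_eq_zero ?_
      filter_upwards [hL.ae_pos_pi G] with lam hlam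
      have : lam g ∉ {t : ℝ | t ≤ 0} := not_le.mpr (hlam g)
      rw [Set.indicator_of_notMem this, mul_zero, Pi.zero_apply]
    simp only [shrinkIntegral, this, lintegral_zero]
  have hmeas : Measurable fun θ : Param m => {t : ℝ | t ≤ 0}.indicator (1 : ℝ → ℝ≥0∞) (θ.2.1 g) :=
    (measurable_one.indicator hs).comp (by fun_prop)
  rw [h0, ENNReal.zero_div, lintegral_eq_zero_iff hmeas] at h
  filter_upwards [h] with θ hθ
  by_contra hneg
  have : θ.2.1 g ∈ {t : ℝ | t ≤ 0} := not_lt.mp hneg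
  rw [Set.indicator_of_mem this] at hθ
  simp at hθ

/-- Comparing unnormalised posterior integrals group by group. -/
lemma shrinkIntegral_group_le [IsProbabilityMeasure π] (hL : LocalPriorClass a L) (y : Fin n → ℝ)
    (g : Fin G) {f : ℝ → ℝ → ℝ≥0∞} (hf : ∀ τ, Measurable (f τ)) {r : ℝ≥0∞}
    (h : ∀ᵐ τ ∂π,
      ∫⁻ t, ENNReal.ofReal (groupWeight (m g) (groupStat X σ y g) τ t) * f τ t ∂(localLaw a L) ≤
      r * ∫⁻ t, ENNReal.ofReal (groupWeight (m g) (groupStat X σ y g) τ t) ∂(localLaw a L)) :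
    shrinkIntegral X σ a L π y (fun τ lam => f τ (lam g)) ≤
      r * shrinkIntegral X σ a L π y (fun _ _ => 1) := by
  have := hL.isProbabilityMeasure
  simp only [shrinkIntegral, mul_one]
  rw [← lintegral_const_mul _ (measurable_lamWeight_left (X := X) y).lintegral_prod_right']
  refine lintegral_mono_ae ?_
  filter_upwards [h] with τ hτ
  have hw : ∀ k, Measurable fun t =>
      ENNReal.ofReal (groupWeight (m k) (groupStat X σ y k) τ t) := fun k =>
    ((measurable_groupWeight (m k)).comp
      (by fun_prop : Measurable fun t : ℝ => (groupStat X σ y k, τ, t))).ennreal_ofReal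
  -- A function of the single coordinate `lam g` is written as a product over all groups with
  -- trivial factors, so both integrals factorise and differ in the factor of g only.
  have h1 : ∀ lam : Fin G → ℝ, lamWeight X σ y τ lam * f τ (lam g) =
      ∏ k, (ENNReal.ofReal (groupWeight (m k) (groupStat X σ y k) τ (lam k)) *
        (if k = g then f τ (lam k) else 1)) := by
    intro lam
    rw [Finset.prod_mul_distrib, Finset.prod_ite_eq' Finset.univ g, if_pos (Finset.mem_univ g)]
    rfl
  have hmeas : ∀ k : Fin G, Measurable fun t =>
      ENNReal.ofReal (groupWeight (m k) (groupStat X σ y k) τ t) *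
        (if k = g then f τ t else 1) := by
    intro k
    refine (hw k).mul ?_
    split_ifs
    · exact hf τ
    · exact measurable_const
  simp_rw [h1]
  rw [lintegral_fin_prod_eq_prod (μ := fun _ : Fin G => localLaw a L) hmeas]
  have h2 : ∫⁻ lam : Fin G → ℝ, lamWeight X σ y τ lam
      ∂(Measure.pi fun _ : Fin G => localLaw a L) =
      ∏ k, ∫⁻ t, ENNReal.ofReal (groupWeight (m k) (groupStat X σ y k) τ t) ∂(localLaw a L) :=
    lintegral_fin_prod_eq_prod (μ := fun _ : Fin G => localLaw a L) hw
  have h3 : r = ∏ k, if k = g then r else 1 := by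
    rw [Finset.prod_ite_eq' Finset.univ g, if_pos (Finset.mem_univ g)]
  rw [h2]
  conv_rhs => rw [h3]
  rw [← Finset.prod_mul_distrib]
  refine Finset.prod_le_prod' fun k _ => ?_
  by_cases hk : k = g
  · subst hk
    simpa using hτ
  · simp [hk]

lemma shrinkWeight_eq [IsProbabilityMeasure π] (hX : BlockOrthogonal X) (hc : 0 < c)
    (hA : BoundedBelow X c) (hσ : 0 < σ) (hL : LocalPriorClass a L) (hπ : ∀ᵐ τ ∂π, 0 < τ)
    (y : Fin n → ℝ) (g : Fin G) :
    shrinkWeight X σ a L π y g =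
      (shrinkIntegral X σ a L π y (fun τ lam => ENNReal.ofReal (shrinkU τ (lam g))) /
        shrinkIntegral X σ a L π y (fun _ _ => 1)).toReal := by
  have hm : Measurable fun q : ℝ × (Fin G → ℝ) => shrinkU q.1 (q.2 g) := by
    unfold shrinkU; fun_prop
  rw [← lintegral_posterior_shrink hX hc hA hσ hL hπ y hm.ennreal_ofReal, shrinkWeight,
    ← integral_eq_lintegral_of_nonneg_ae]
  · refine integral_congr_ae ?_
    filter_upwards [ae_posterior_pos hX hc hA hσ hL hπ y] with θ hθ
    rw [shrinkU_eq (hθ g).le]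
    rfl
  · filter_upwards [ae_posterior_pos hX hc hA hσ hL hπ y] with θ hθ
    exact shrinkU_nonneg (hθ g).le
  · exact (hm.comp (by fun_prop : Measurable fun θ : Param m =>
      (θ.1, θ.2.1))).aestronglyMeasurable

lemma integrable_kappa [IsProbabilityMeasure π] (hX : BlockOrthogonal X) (hc : 0 < c)
    (hA : BoundedBelow X c) (hσ : 0 < σ) (hL : LocalPriorClass a L) (hπ : ∀ᵐ τ ∂π, 0 < τ)
    (y : Fin n → ℝ) (g : Fin G) : Integrable (kappa g) (posterior X σ a L π y) := by
  have := isProbabilityMeasure_posterior hX hc hA hσ hL hπ y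
  refine Integrable.of_bound (C := 1) ?_ ?_
  · unfold kappa
    exact Measurable.aestronglyMeasurable (by fun_prop)
  · filter_upwards [ae_posterior_pos hX hc hA hσ hL hπ y] with θ hθ
    change ‖shrinkK θ.1 (θ.2.1 g)‖ ≤ 1
    rw [Real.norm_of_nonneg (shrinkK_pos (hθ g).le).le]
    exact shrinkK_le_one (hθ g).le

lemma one_sub_shrinkWeight_eq [IsProbabilityMeasure π] (hX : BlockOrthogonal X) (hc : 0 < c)
    (hA : BoundedBelow X c) (hσ : 0 < σ) (hL : LocalPriorClass a L) (hπ : ∀ᵐ τ ∂π, 0 < τ)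
    (y : Fin n → ℝ) (g : Fin G) :
    1 - shrinkWeight X σ a L π y g =
      (shrinkIntegral X σ a L π y (fun τ lam => ENNReal.ofReal (shrinkK τ (lam g))) /
        shrinkIntegral X σ a L π y (fun _ _ => 1)).toReal := by
  have := isProbabilityMeasure_posterior hX hc hA hσ hL hπ y
  have hm : Measurable fun q : ℝ × (Fin G → ℝ) => shrinkK q.1 (q.2 g) := by
    unfold shrinkK; fun_prop
  have h1 : shrinkWeight X σ a L π y g = 1 - ∫ θ, kappa g θ ∂(posterior X σ a L π y) := by
    rw [shrinkWeight, integral_sub (integrable_const _) (integrable_kappa hX hc hA hσ hL hπ y g)]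
    simp
  rw [h1, sub_sub_cancel, ← lintegral_posterior_shrink hX hc hA hσ hL hπ y hm.ennreal_ofReal,
    ← integral_eq_lintegral_of_nonneg_ae]
  · rfl
  · filter_upwards [ae_posterior_pos hX hc hA hσ hL hπ y] with θ hθ
    exact (shrinkK_pos (hθ g).le).le
  · exact (hm.comp (by fun_prop : Measurable fun θ : Param m =>
      (θ.1, θ.2.1))).aestronglyMeasurable

lemma toReal_shrinkIntegral_div_le [IsProbabilityMeasure π] (hL : LocalPriorClass a L)
    (y : Fin n → ℝ) {I : ℝ≥0∞} {r : ℝ} (hr : 0 ≤ r)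
    (h : I ≤ ENNReal.ofReal r * shrinkIntegral X σ a L π y (fun _ _ => 1)) :
    (I / shrinkIntegral X σ a L π y (fun _ _ => 1)).toReal ≤ r := by
  refine ENNReal.toReal_le_of_le_ofReal hr ?_
  rwa [ENNReal.div_le_iff (shrinkIntegral_one_ne_zero hL y) (shrinkIntegral_one_lt_top hL y).ne]

/-- This removes the prior on τ and all other groups from the analysis: what remains is a
one-dimensional comparison at each fixed τ. -/
lemma shrinkWeight_le [IsProbabilityMeasure π] (hX : BlockOrthogonal X) (hc : 0 < c)
    (hA : BoundedBelow X c) (hσ : 0 < σ) (hL : LocalPriorClass a L) (hπ : ∀ᵐ τ ∂π, 0 < τ)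
    (y : Fin n → ℝ) (g : Fin G) {r : ℝ} (hr : 0 ≤ r)
    (h : ∀ᵐ τ ∂π, ∫⁻ t, ENNReal.ofReal (groupWeight (m g) (groupStat X σ y g) τ t) *
        ENNReal.ofReal (shrinkU τ t) ∂(localLaw a L) ≤ ENNReal.ofReal r *
      ∫⁻ t, ENNReal.ofReal (groupWeight (m g) (groupStat X σ y g) τ t) ∂(localLaw a L)) :
    shrinkWeight X σ a L π y g ≤ r := by
  rw [shrinkWeight_eq hX hc hA hσ hL hπ]
  refine toReal_shrinkIntegral_div_le hL y hr ?_
  refine shrinkIntegral_group_le hL y g (f := fun τ t => ENNReal.ofReal (shrinkU τ t))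
    (fun τ => ?_) h
  unfold shrinkU
  fun_prop

lemma one_sub_shrinkWeight_le [IsProbabilityMeasure π] (hX : BlockOrthogonal X) (hc : 0 < c)
    (hA : BoundedBelow X c) (hσ : 0 < σ) (hL : LocalPriorClass a L) (hπ : ∀ᵐ τ ∂π, 0 < τ)
    (y : Fin n → ℝ) (g : Fin G) {r : ℝ} (hr : 0 ≤ r)
    (h : ∀ᵐ τ ∂π, ∫⁻ t, ENNReal.ofReal (groupWeight (m g) (groupStat X σ y g) τ t) *
        ENNReal.ofReal (shrinkK τ t) ∂(localLaw a L) ≤ ENNReal.ofReal r *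
      ∫⁻ t, ENNReal.ofReal (groupWeight (m g) (groupStat X σ y g) τ t) ∂(localLaw a L)) :
    1 - shrinkWeight X σ a L π y g ≤ r := by
  rw [one_sub_shrinkWeight_eq hX hc hA hσ hL hπ]
  refine toReal_shrinkIntegral_div_le hL y hr ?_
  refine shrinkIntegral_group_le hL y g (f := fun τ t => ENNReal.ofReal (shrinkK τ t))
    (fun τ => ?_) h
  unfold shrinkK
  fun_prop

lemma shrinkWeight_le_one [IsProbabilityMeasure π] (hX : BlockOrthogonal X) (hc : 0 < c)
    (hA : BoundedBelow X c) (hσ : 0 < σ) (hL : LocalPriorClass a L) (hπ : ∀ᵐ τ ∂π, 0 < τ)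
    (y : Fin n → ℝ) (g : Fin G) : shrinkWeight X σ a L π y g ≤ 1 := by
  have h := one_sub_shrinkWeight_eq hX hc hA hσ hL hπ y g
  have := h ▸ ENNReal.toReal_nonneg
  linarith

lemma measurable_shrinkWeight [IsProbabilityMeasure π] (hX : BlockOrthogonal X) (hc : 0 < c)
    (hA : BoundedBelow X c) (hσ : 0 < σ) (hL : LocalPriorClass a L) (hπ : ∀ᵐ τ ∂π, 0 < τ)
    (g : Fin G) : Measurable fun y => shrinkWeight X σ a L π y g := by
  have := hL.isProbabilityMeasure
  simp_rw [shrinkWeight_eq hX hc hA hσ hL hπ]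
  have hint : ∀ F : ℝ → (Fin G → ℝ) → ℝ≥0∞, (Measurable fun q : ℝ × (Fin G → ℝ) => F q.1 q.2) →
      Measurable fun y => shrinkIntegral X σ a L π y F := by
    intro F hF
    have h1 : Measurable fun q : ((Fin n → ℝ) × ℝ) × (Fin G → ℝ) =>
        lamWeight X σ q.1.1 q.1.2 q.2 * F q.1.2 q.2 := by
      have h2 := (measurable_lamWeight (X := X) (σ := σ)).comp
        (by fun_prop : Measurable fun q : ((Fin n → ℝ) × ℝ) × (Fin G → ℝ) =>
          (q.1.1, q.1.2, q.2))
      have h3 := hF.comp (by fun_prop : Measurable fun q : ((Fin n → ℝ) × ℝ) × (Fin G → ℝ) =>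
          (q.1.2, q.2))
      simpa only [Function.comp_def, Pi.mul_def] using h2.mul h3
    have h4 : Measurable fun q : (Fin n → ℝ) × ℝ => ∫⁻ lam, lamWeight X σ q.1 q.2 lam * F q.2 lam
        ∂(Measure.pi fun _ : Fin G => localLaw a L) := h1.lintegral_prod_right'
    exact h4.lintegral_prod_right'
  refine Measurable.ennreal_toReal (Measurable.div (hint _ ?_) (hint _ measurable_const))
  unfold shrinkU
  fun_prop

/-- The posterior mean shrinks the least squares estimator group by group. -/
lemma posteriorMean_eq [IsProbabilityMeasure π] (hX : BlockOrthogonal X) (hc : 0 < c)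
    (hA : BoundedBelow X c) (hσ : 0 < σ) (hL : LocalPriorClass a L) (hπ : ∀ᵐ τ ∂π, 0 < τ)
    (y : Fin n → ℝ) (p : Idx m) :
    posteriorMean X σ a L π y p = shrinkWeight X σ a L π y p.1 * ols X y p := by
  have hprob := isProbabilityMeasure_posterior hX hc hA hσ hL hπ y
  have hpos := ae_posterior_pos hX hc hA hσ hL hπ y
  have hint : Integrable (fun θ : Param m => θ.2.2 p) (posterior X σ a L π y) := by
    refine ⟨Measurable.aestronglyMeasurable (by fun_prop), ?_⟩
    rw [HasFiniteIntegral, lintegral_posterior hX hc hA hσ hL hπ y (by fun_prop)]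
    refine ENNReal.div_lt_top ?_ (mul_ne_zero (shrinkIntegral_one_ne_zero hL y) kernelMass_ne_zero)
    refine (shrinkIntegral_lt_top hL y (K := ∫⁻ x, ENNReal.ofReal
      (|x p| * gaussKernel X σ x + |ols X y p| * gaussKernel X σ x)) ?_ ?_).ne
    · exact ((integrable_abs_mul_gaussKernel hc hA hσ p).add
        ((integrable_gaussKernel hc hA hσ).const_mul _)).lintegral_lt_top.ne
    · intro τ lam hlam
      refine lintegral_mono fun x => ?_
      rw [← ofReal_norm, ← ENNReal.ofReal_mul (norm_nonneg _), ← add_mul]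
      refine ENNReal.ofReal_le_ofReal (mul_le_mul_of_nonneg_right ?_ (gaussKernel_pos x).le)
      have h1 := shrinkU_le_one (τ := τ) (hlam p.1).le
      have h2 := shrinkU_nonneg (τ := τ) (hlam p.1).le
      have h3 : √(shrinkU τ (lam p.1)) ≤ 1 := Real.sqrt_le_iff.mpr ⟨zero_le_one, by simpa using h1⟩
      simp only [coefOf]
      refine (norm_add_le _ _).trans ?_
      rw [Real.norm_eq_abs, Real.norm_eq_abs, abs_mul, abs_mul, abs_of_nonneg h2,
        abs_of_nonneg (Real.sqrt_nonneg _)]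
      exact add_le_add (mul_le_of_le_one_left (abs_nonneg _) h3)
        (mul_le_of_le_one_left (abs_nonneg _) h1)
  -- The reflection of β about (1 - κ) times least squares. In standardised coordinates it is x ↦
  -- -x, and the Gaussian kernel is even, so the posterior is invariant. Averaging a coordinate with
  -- its reflection then gives the mean without computing a Gaussian first moment.
  let T : Param m → Param m := fun θ =>
    (θ.1, θ.2.1, fun p => 2 * (shrinkU θ.1 (θ.2.1 p.1) * ols X y p) - θ.2.2 p)
  have hTm : Measurable T := by
    unfold T shrinkU
    fun_prop
  have hT : MeasurePreserving T (posterior X σ a L π y) (posterior X σ a L π y) := by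
    refine ⟨hTm, ?_⟩
    ext s hs
    rw [Measure.map_apply hTm hs, ← lintegral_indicator_one (hTm hs), ← lintegral_indicator_one hs,
      lintegral_posterior hX hc hA hσ hL hπ y (measurable_one.indicator (hTm hs)),
      lintegral_posterior hX hc hA hσ hL hπ y (measurable_one.indicator hs)]
    congr 2
    ext τ lam
    rw [← lintegral_neg_eq_self]
    refine lintegral_congr fun x => ?_
    congr 1
    · have : T (τ, lam, coefOf X y τ lam (-x)) = (τ, lam, coefOf X y τ lam x) := by
        simp only [T, coefOf, Prod.mk.injEq, true_and]
        ext p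
        simp only [Pi.neg_apply]
        change _ = √(shrinkU τ (lam p.1)) * x p + shrinkU τ (lam p.1) * ols X y p
        ring
      rw [← this]
      rfl
    · simp [gaussKernel, Matrix.mulVec_neg]
  have h1 : ∫ θ, (T θ).2.2 p ∂(posterior X σ a L π y) = ∫ θ, θ.2.2 p ∂(posterior X σ a L π y) := by
    conv_rhs => rw [← hT.map_eq]
    rw [integral_map hTm.aemeasurable (Measurable.aestronglyMeasurable (by fun_prop))]
  have h2 : ∫ θ, (T θ).2.2 p ∂(posterior X σ a L π y) =
      2 * (shrinkWeight X σ a L π y p.1 * ols X y p) - ∫ θ, θ.2.2 p ∂(posterior X σ a L π y) := by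
    have h3 : ∫ θ, (T θ).2.2 p ∂(posterior X σ a L π y) =
        ∫ θ, ((1 - kappa p.1 θ) * (2 * ols X y p) - θ.2.2 p) ∂(posterior X σ a L π y) := by
      refine integral_congr_ae ?_
      filter_upwards [hpos] with θ hθ
      simp only [T, shrinkU_eq (hθ p.1).le]
      change _ = (1 - shrinkK θ.1 (θ.2.1 p.1)) * (2 * ols X y p) - θ.2.2 p
      ring
    rw [h3, integral_sub _ hint, integral_mul_const, shrinkWeight]
    · ring
    · exact ((integrable_const _).sub (integrable_kappa hX hc hA hσ hL hπ y p.1)).mul_const _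
  rw [posteriorMean]
  linarith

end PosteriorMoments

/-! ### One-dimensional estimates for a single group -/

section GroupBounds

variable {a : ℝ} {L : ℝ → ℝ}

/-- The marginal likelihood of a group given `τ`, up to a constant factor. -/
def groupMass (a : ℝ) (L : ℝ → ℝ) (k : ℕ) (z τ : ℝ) : ℝ≥0∞ :=
  ∫⁻ t, ENNReal.ofReal (groupWeight k z τ t) ∂(localLaw a L)

lemma measurable_groupWeight_t (k : ℕ) (z τ : ℝ) : Measurable (groupWeight k z τ) := by
  unfold groupWeight shrinkK shrinkU
  fun_prop

lemma measurable_shrinkU_t (τ : ℝ) : Measurable (shrinkU τ) := by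
  unfold shrinkU
  fun_prop

/-- The mass of a group is bounded away from zero uniformly in `τ ≤ 1`. -/
lemma exists_le_groupMass (hL : LocalPriorClass a L) (s : ℕ) :
    ∃ d : ℝ, 0 < d ∧ ∀ k ≤ s, ∀ z τ : ℝ, 0 ≤ z → 0 < τ → τ ≤ 1 →
      ENNReal.ofReal d ≤ groupMass a L k z τ := by
  have := hL.isProbabilityMeasure
  have hm : Measurable fun t : ℝ => ENNReal.ofReal (√(1 / (1 + t)) ^ s) := by fun_prop
  -- A minorant of the weight that is free of k, z and τ: for τ ≤ 1 one has κ ≥ 1/(1+t), and the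
  -- exponential is at least 1.
  set D := ∫⁻ t, ENNReal.ofReal (√(1 / (1 + t)) ^ s) ∂(localLaw a L) with hD
  have hD0 : D ≠ 0 := by
    intro h
    rw [hD, lintegral_eq_zero_iff hm] at h
    have hf : ∀ᵐ _t ∂(localLaw a L), False := by
      filter_upwards [h, hL.ae_pos] with t ht h0
      have : 0 < √(1 / (1 + t)) ^ s := pow_pos (Real.sqrt_pos.mpr (by positivity)) _
      simp only [Pi.zero_apply, ENNReal.ofReal_eq_zero] at ht
      linarith
    exact IsProbabilityMeasure.ne_zero (localLaw a L) (by simpa using hf)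
  have hD1 : D ≤ 1 := by
    calc D ≤ ∫⁻ _t, 1 ∂(localLaw a L) := by
          refine lintegral_mono_ae ?_
          filter_upwards [hL.ae_pos] with t ht
          rw [ENNReal.ofReal_le_one]
          refine pow_le_one₀ (Real.sqrt_nonneg _) (Real.sqrt_le_iff.mpr ⟨zero_le_one, ?_⟩)
          rw [one_pow, div_le_one (by linarith)]
          linarith
      _ = 1 := by simp
  have hDt : D ≠ ∞ := (hD1.trans_lt ENNReal.one_lt_top).ne
  refine ⟨D.toReal, ENNReal.toReal_pos hD0 hDt, fun k hk z τ hz hτ hτ1 => ?_⟩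
  rw [ENNReal.ofReal_toReal hDt]
  refine lintegral_mono_ae ?_
  filter_upwards [hL.ae_pos] with t ht
  refine ENNReal.ofReal_le_ofReal ?_
  have h1 : 1 / (1 + t) ≤ shrinkK τ t := by
    unfold shrinkK
    refine one_div_le_one_div_of_le (by positivity) ?_
    have : τ ^ 2 ≤ 1 := pow_le_one₀ hτ.le hτ1
    nlinarith
  have h2 : √(1 / (1 + t)) ≤ 1 := by
    refine Real.sqrt_le_iff.mpr ⟨zero_le_one, ?_⟩
    rw [one_pow, div_le_one (by linarith)]
    linarith
  have h3 : 1 ≤ Real.exp (shrinkU τ t * z / 2) := by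
    apply Real.one_le_exp
    have := shrinkU_nonneg (τ := τ) ht.le
    positivity
  calc √(1 / (1 + t)) ^ s ≤ √(1 / (1 + t)) ^ k := pow_le_pow_of_le_one (Real.sqrt_nonneg _) h2 hk
    _ ≤ √(shrinkK τ t) ^ k := by gcongr
    _ ≤ groupWeight k z τ t := le_mul_of_one_le_right (by positivity) h3

/-- The limiting shape of the posterior mass of large shrinkage coefficients. -/
def tailMass (k : ℕ) (z : ℝ) : ℝ≥0∞ :=
  ∫⁻ v in Ioi (0 : ℝ), ENNReal.ofReal (v ^ (-(3 : ℝ) / 2) * shrinkU 1 v) *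
    ENNReal.ofReal (groupWeight k z 1 v)

/-- The total mass of `v ^ (-1/2) / (1 + v)`. -/
def tailTotal : ℝ≥0∞ := ∫⁻ v in Ioi (0 : ℝ), ENNReal.ofReal (v ^ (-(3 : ℝ) / 2) * shrinkU 1 v)

lemma measurable_tail : Measurable fun v : ℝ => ENNReal.ofReal (v ^ (-(3 : ℝ) / 2) * shrinkU 1 v) := by
  unfold shrinkU
  fun_prop

/-- Near zero u ≤ v leaves the integrable v^{-1/2}; at infinity u ≤ 1 leaves v^{-3/2}. -/
lemma tailTotal_lt_top : tailTotal < ∞ := by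
  have h1 : IntegrableOn (fun v : ℝ => v ^ (-(1 : ℝ) / 2)) (Ioc 0 1) := by
    rw [← intervalIntegrable_iff_integrableOn_Ioc_of_le zero_le_one]
    exact intervalIntegral.intervalIntegrable_rpow' (by norm_num)
  have h2 : IntegrableOn (fun v : ℝ => v ^ (-(3 : ℝ) / 2)) (Ioi 1) :=
    integrableOn_Ioi_rpow_of_lt (by norm_num) one_pos
  have hu : Ioi (0 : ℝ) = Ioc 0 1 ∪ Ioi 1 := (Ioc_union_Ioi_eq_Ioi zero_le_one).symm
  have hint : IntegrableOn (fun v : ℝ => v ^ (-(3 : ℝ) / 2) * shrinkU 1 v) (Ioi 0) := by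
    have hms : Measurable fun v : ℝ => v ^ (-(3 : ℝ) / 2) * shrinkU 1 v := by
      unfold shrinkU; fun_prop
    rw [hu]
    refine IntegrableOn.union (h1.mono' hms.aestronglyMeasurable ?_)
      (h2.mono' hms.aestronglyMeasurable ?_)
    · filter_upwards [ae_restrict_mem measurableSet_Ioc] with v hv
      have hv0 : 0 < v := hv.1
      have h4 := shrinkU_nonneg (τ := 1) hv0.le
      rw [Real.norm_of_nonneg (by positivity)]
      calc v ^ (-(3 : ℝ) / 2) * shrinkU 1 v ≤ v ^ (-(3 : ℝ) / 2) * v := by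
            gcongr
            simpa using shrinkU_le (τ := 1) hv0.le
        _ = v ^ (-(1 : ℝ) / 2) := by
            nth_rewrite 2 [← Real.rpow_one v]
            rw [← Real.rpow_add hv0]
            norm_num
    · filter_upwards [ae_restrict_mem measurableSet_Ioi] with v hv
      have hv0 : 0 < v := zero_lt_one.trans hv
      have h4 := shrinkU_nonneg (τ := 1) hv0.le
      rw [Real.norm_of_nonneg (by positivity)]
      exact mul_le_of_le_one_right (by positivity) (shrinkU_le_one hv0.le)
  exact hint.lintegral_lt_top

/-- A pointwise bound, for the case in which the statistic is kept below a threshold instead of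
being averaged over the noise. -/
lemma tailMass_le (k : ℕ) {z : ℝ} (hz : 0 ≤ z) :
    tailMass k z ≤ tailTotal * ENNReal.ofReal (Real.exp (z / 2)) := by
  unfold tailMass tailTotal
  rw [← lintegral_mul_const _ measurable_tail]
  refine setLIntegral_mono' measurableSet_Ioi fun v (hv : 0 < v) => ?_
  gcongr
  have h1 := shrinkK_le_one (τ := 1) hv.le
  have h2 := shrinkU_le_one (τ := 1) hv.le
  unfold groupWeight
  calc √(shrinkK 1 v) ^ k * Real.exp (shrinkU 1 v * z / 2) ≤ 1 * Real.exp (z / 2) := by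
        gcongr
        · exact pow_le_one₀ (Real.sqrt_nonneg _)
            (Real.sqrt_le_iff.mpr ⟨zero_le_one, by simpa using h1⟩)
        · nlinarith
    _ = _ := one_mul _

lemma shrinkU_scale (τ t : ℝ) : shrinkU τ t = shrinkU 1 (τ ^ 2 * t) := by
  unfold shrinkU; ring_nf

lemma shrinkK_scale (τ t : ℝ) : shrinkK τ t = shrinkK 1 (τ ^ 2 * t) := by
  unfold shrinkK; ring_nf

lemma groupWeight_scale (k : ℕ) (z τ t : ℝ) :
    groupWeight k z τ t = groupWeight k z 1 (τ ^ 2 * t) := by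
  unfold groupWeight
  rw [shrinkU_scale τ t, shrinkK_scale τ t]

lemma setLIntegral_Ioi_scale {b : ℝ} (hb : 0 < b) {f : ℝ → ℝ≥0∞} (hf : Measurable f) :
    ∫⁻ v in Ioi (0 : ℝ), f v = ENNReal.ofReal b * ∫⁻ t in Ioi (0 : ℝ), f (b * t) := by
  rw [← lintegral_indicator measurableSet_Ioi, ← lintegral_indicator measurableSet_Ioi]
  conv_lhs => rw [← Real.smul_map_volume_mul_left hb.ne']
  rw [lintegral_smul_measure, lintegral_map (hf.indicator measurableSet_Ioi) (by fun_prop),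
    abs_of_pos hb, smul_eq_mul]
  congr 1
  refine lintegral_congr fun t => ?_
  by_cases ht : 0 < t
  · rw [Set.indicator_of_mem (show b * t ∈ Ioi (0 : ℝ) from mul_pos hb ht),
      Set.indicator_of_mem (show t ∈ Ioi (0 : ℝ) from ht)]
  · rw [Set.indicator_of_notMem (show b * t ∉ Ioi (0 : ℝ) from fun h =>
      ht ((mul_pos_iff_of_pos_left hb).mp h)),
      Set.indicator_of_notMem (show t ∉ Ioi (0 : ℝ) from ht)]

/-- Substituting v = τ²t gives t^{-3/2} dt = τ v^{-3/2} dv, and the rest of the integrand depends on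
τ²t only. This is where the linear order in τ comes from. -/
lemma setLIntegral_tail_scale (k : ℕ) (z : ℝ) {τ : ℝ} (hτ : 0 < τ) :
    ∫⁻ t in Ioi (0 : ℝ), ENNReal.ofReal (t ^ (-(3 : ℝ) / 2) * shrinkU τ t) *
      ENNReal.ofReal (groupWeight k z τ t) = ENNReal.ofReal τ * tailMass k z := by
  have hm : Measurable fun v : ℝ => ENNReal.ofReal (v ^ (-(3 : ℝ) / 2) * shrinkU 1 v) *
      ENNReal.ofReal (groupWeight k z 1 v) :=
    measurable_tail.mul (measurable_groupWeight_t k z 1).ennreal_ofReal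
  have hm' : Measurable fun t : ℝ =>
      ENNReal.ofReal ((τ ^ 2 * t) ^ (-(3 : ℝ) / 2) * shrinkU 1 (τ ^ 2 * t)) *
      ENNReal.ofReal (groupWeight k z 1 (τ ^ 2 * t)) := hm.comp (measurable_const_mul _)
  unfold tailMass
  rw [setLIntegral_Ioi_scale (b := τ ^ 2) (by positivity) hm,
    ← mul_assoc, ← ENNReal.ofReal_mul hτ.le, ← lintegral_const_mul _ hm']
  refine setLIntegral_congr_fun measurableSet_Ioi fun t (ht : 0 < t) => ?_
  simp only [← groupWeight_scale, ← shrinkU_scale]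
  rw [← mul_assoc, ← ENNReal.ofReal_mul (p := τ * τ ^ 2) (by positivity)]
  congr 2
  have h1 : (τ ^ 2 * t) ^ (-(3 : ℝ) / 2) = (τ ^ 3)⁻¹ * t ^ (-(3 : ℝ) / 2) := by
    rw [Real.mul_rpow (by positivity) ht.le, ← Real.rpow_natCast τ 2, ← Real.rpow_mul hτ.le,
      ← Real.rpow_natCast τ 3, ← Real.rpow_neg hτ.le]
    norm_num
  rw [h1]
  field_simp

/-- The posterior mass of large shrinkage coefficients is of order `τ`. -/
lemma exists_lintegral_shrinkU_le (ha : 1 / 2 ≤ a) (hL : LocalPriorClass a L)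
    (hLb : BoundedSlowlyVarying L) :
    ∃ M : ℝ, 0 < M ∧ ∀ (k : ℕ) (z τ : ℝ), 0 ≤ z → 0 < τ → τ ≤ 1 / 2 →
      ∫⁻ t, ENNReal.ofReal (groupWeight k z τ t) * ENNReal.ofReal (shrinkU τ t) ∂(localLaw a L) ≤
        ENNReal.ofReal τ * (ENNReal.ofReal (Real.exp (z / 4)) + ENNReal.ofReal M * tailMass k z) := by
  have := hL.isProbabilityMeasure
  obtain ⟨-, M₀, hM₀, hM⟩ := hLb
  set I := ∫ u in Ioi (0 : ℝ), u ^ (-a - 1) * L u with hI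
  have hI0 : 0 < I := hL.integral_pos
  refine ⟨M₀ / I, by positivity, fun k z τ hz hτ hτ2 => ?_⟩
  have hgw := (measurable_groupWeight_t k z τ).ennreal_ofReal
  have hsu := (measurable_shrinkU_t τ).ennreal_ofReal
  -- The boundary exponent a = 1/2 is the worst case on t ≥ 1, and L is bounded above.
  have hpdf : ∀ t, 1 ≤ t → localPdf a L t ≤ M₀ / I * t ^ (-(3 : ℝ) / 2) := by
    intro t ht
    have ht0 : 0 < t := by linarith
    have hLt := (hL.pos t ht0).le
    rw [localPdf, if_pos ht0, ← hI, div_mul_eq_mul_div, mul_comm M₀]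
    gcongr
    · linarith
    · exact hM t ht0
  have hpt : ∀ t, 0 < t → ENNReal.ofReal (localPdf a L t) *
      (ENNReal.ofReal (groupWeight k z τ t) * ENNReal.ofReal (shrinkU τ t)) ≤
      ENNReal.ofReal (localPdf a L t) * ENNReal.ofReal (τ * Real.exp (z / 4)) +
      ENNReal.ofReal (M₀ / I) * (ENNReal.ofReal (t ^ (-(3 : ℝ) / 2) * shrinkU τ t) *
        ENNReal.ofReal (groupWeight k z τ t)) := by
    intro t ht
    have hu0 := shrinkU_nonneg (τ := τ) ht.le
    have hg0 := groupWeight_nonneg k z τ t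
    -- For t ≤ 1, u ≤ τ² ≤ τ/2 ≤ 1/4, so the exponential stays below e^{z/4} and u supplies the
    -- factor τ. For t > 1 the power bound on the density applies.
    by_cases h1 : t ≤ 1
    · refine le_add_right ?_
      gcongr
      rw [← ENNReal.ofReal_mul hg0]
      refine ENNReal.ofReal_le_ofReal ?_
      have h2 : shrinkU τ t ≤ τ ^ 2 := (shrinkU_le ht.le).trans
        (mul_le_of_le_one_left (sq_nonneg _) h1)
      have h3 : τ ^ 2 ≤ 1 / 2 * τ := by nlinarith
      have hk := shrinkK_le_one (τ := τ) ht.le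
      have hexp : Real.exp (shrinkU τ t * z / 2) ≤ Real.exp (z / 4) :=
        Real.exp_le_exp.mpr (by nlinarith)
      have hu1 : shrinkU τ t ≤ τ := by nlinarith
      unfold groupWeight
      calc √(shrinkK τ t) ^ k * Real.exp (shrinkU τ t * z / 2) * shrinkU τ t
          ≤ 1 * Real.exp (z / 4) * τ := by
            gcongr
            exact pow_le_one₀ (Real.sqrt_nonneg _)
              (Real.sqrt_le_iff.mpr ⟨zero_le_one, by simpa using hk⟩)
        _ = τ * Real.exp (z / 4) := by ring
    · refine le_add_left ?_
      have h2 := hpdf t (not_le.mp h1).le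
      rw [← ENNReal.ofReal_mul hg0, ← ENNReal.ofReal_mul (hL.localPdf_nonneg t),
        ← ENNReal.ofReal_mul (by positivity), ← ENNReal.ofReal_mul (by positivity)]
      refine ENNReal.ofReal_le_ofReal ?_
      calc localPdf a L t * (groupWeight k z τ t * shrinkU τ t)
          ≤ (M₀ / I * t ^ (-(3 : ℝ) / 2)) * (groupWeight k z τ t * shrinkU τ t) := by gcongr
        _ = _ := by ring
  have hpdfm := hL.measurable_localPdf.ennreal_ofReal
  have htail : Measurable fun t : ℝ => ENNReal.ofReal (t ^ (-(3 : ℝ) / 2) * shrinkU τ t) *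
        ENNReal.ofReal (groupWeight k z τ t) := by
    have := measurable_shrinkU_t τ
    exact Measurable.mul (by fun_prop) hgw
  have hgs : Measurable fun t =>
      ENNReal.ofReal (groupWeight k z τ t) * ENNReal.ofReal (shrinkU τ t) := hgw.mul hsu
  rw [hL.lintegral_eq hgs]
  have hIoi : ∫⁻ t, ENNReal.ofReal (localPdf a L t) *
      (ENNReal.ofReal (groupWeight k z τ t) * ENNReal.ofReal (shrinkU τ t)) =
      ∫⁻ t in Ioi 0, ENNReal.ofReal (localPdf a L t) *
      (ENNReal.ofReal (groupWeight k z τ t) * ENNReal.ofReal (shrinkU τ t)) := by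
    rw [← lintegral_indicator measurableSet_Ioi]
    refine lintegral_congr fun t => ?_
    by_cases ht : 0 < t
    · rw [Set.indicator_of_mem (show t ∈ Ioi (0 : ℝ) from ht)]
    · rw [Set.indicator_of_notMem (show t ∉ Ioi (0 : ℝ) from ht),
        localPdf_of_nonpos (not_lt.mp ht), ENNReal.ofReal_zero, zero_mul]
  have hone : ∫⁻ t, ENNReal.ofReal (localPdf a L t) = 1 := by
    have h := hL.lintegral_eq (f := fun _ => 1) measurable_const
    simpa using h.symm
  calc ∫⁻ t, ENNReal.ofReal (localPdf a L t) *
        (ENNReal.ofReal (groupWeight k z τ t) * ENNReal.ofReal (shrinkU τ t))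
      ≤ ∫⁻ t in Ioi 0, (ENNReal.ofReal (localPdf a L t) * ENNReal.ofReal (τ * Real.exp (z / 4)) +
        ENNReal.ofReal (M₀ / I) * (ENNReal.ofReal (t ^ (-(3 : ℝ) / 2) * shrinkU τ t) *
        ENNReal.ofReal (groupWeight k z τ t))) := by
        rw [hIoi]
        exact setLIntegral_mono' measurableSet_Ioi fun t ht => hpt t ht
    _ = (∫⁻ t in Ioi 0, ENNReal.ofReal (localPdf a L t)) * ENNReal.ofReal (τ * Real.exp (z / 4)) +
        ENNReal.ofReal (M₀ / I) * (ENNReal.ofReal τ * tailMass k z) := by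
        rw [lintegral_add_right _ (htail.const_mul _), lintegral_mul_const _ hpdfm,
          lintegral_const_mul _ htail, setLIntegral_tail_scale k z hτ]
    _ ≤ 1 * ENNReal.ofReal (τ * Real.exp (z / 4)) +
        ENNReal.ofReal (M₀ / I) * (ENNReal.ofReal τ * tailMass k z) := by
        gcongr
        exact (setLIntegral_le_lintegral _ _).trans hone.le
    _ = _ := by
        rw [ENNReal.ofReal_mul hτ.le]
        ring

/-- A lower bound for the mass of a group with a large statistic. -/
lemma exists_exp_le_groupMass (hL : LocalPriorClass a L) (hLb : BoundedSlowlyVarying L)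
    (ha : 0 ≤ a) (s : ℕ) :
    ∃ z₀ C : ℝ, 1 ≤ z₀ ∧ 0 < C ∧ ∀ k ≤ s, ∀ z τ : ℝ, z₀ ≤ z → 0 < τ → τ ≤ 1 →
      ENNReal.ofReal (Real.exp (z / 2 - C * (1 + Real.log z + Real.log (1 / τ)))) ≤
        groupMass a L k z τ := by
  obtain ⟨⟨c₀, t₀, hc₀, ht₀, hc⟩, -⟩ := hLb
  set I := ∫ u in Ioi (0 : ℝ), u ^ (-a - 1) * L u with hI
  have hI0 : 0 < I := hL.integral_pos
  -- Absolute value of the terms of the final logarithm that involve neither z nor τ.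
  set C₁ := |1 / 2 + s / 2 * Real.log 3 + Real.log (I / c₀) + (a + 1) * Real.log 2| with hC₁
  refine ⟨max t₀ 1, C₁ + 1 + s + 2 * a, le_max_right _ _, by positivity,
    fun k hk z τ hz hτ hτ1 => ?_⟩
  have hz1 : 1 ≤ z := (le_max_right _ _).trans hz
  have hzt : t₀ ≤ z := (le_max_left _ _).trans hz
  have hz0 : 0 < z := by linarith
  have hτ2 : τ ^ 2 ≤ 1 := pow_le_one₀ hτ.le hτ1
  -- On the window t ∈ [w, 2w] one has z ≤ tτ² ≤ 2z. Hence κz ≤ 1, so the exponential loses at most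
  -- e^{-1/2} from e^{z/2}, while κ ≥ 1/(3z) because z ≥ 1. The window also lies in t ≥ t₀, where L
  -- ≥ c₀. The other losses are powers of z and τ.
  set w := z / τ ^ 2 with hw
  have hwz : z ≤ w := by
    rw [hw, le_div_iff₀ (by positivity)]
    nlinarith
  have hw0 : 0 < w := by positivity
  have hwτ : w * τ ^ 2 = z := by rw [hw]; field_simp
  have hmass : groupMass a L k z τ = ∫⁻ t, ENNReal.ofReal (localPdf a L t) *
      ENNReal.ofReal (groupWeight k z τ t) :=
    hL.lintegral_eq (measurable_groupWeight_t k z τ).ennreal_ofReal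
  set D := c₀ / I * (2 * w) ^ (-a - 1) * (√(1 / (3 * z)) ^ s * Real.exp (z / 2 - 1 / 2)) with hD
  have hpt : ∀ t ∈ Icc w (2 * w), ENNReal.ofReal D ≤ ENNReal.ofReal (localPdf a L t) *
      ENNReal.ofReal (groupWeight k z τ t) := by
    intro t ht
    have ht0 : 0 < t := hw0.trans_le ht.1
    rw [← ENNReal.ofReal_mul (hL.localPdf_nonneg t)]
    refine ENNReal.ofReal_le_ofReal (mul_le_mul ?_ ?_ (by positivity) (hL.localPdf_nonneg t))
    · rw [localPdf, if_pos ht0, ← hI, div_mul_eq_mul_div, mul_comm c₀]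
      gcongr ?_ / _
      refine mul_le_mul ?_ (hc t (hzt.trans (hwz.trans ht.1))) hc₀.le (by positivity)
      exact Real.rpow_le_rpow_of_nonpos ht0 ht.2 (by linarith)
    · have h1 : z ≤ t * τ ^ 2 := by
        calc z = w * τ ^ 2 := hwτ.symm
          _ ≤ t * τ ^ 2 := by gcongr; exact ht.1
      have h2 : t * τ ^ 2 ≤ 2 * z := by
        calc t * τ ^ 2 ≤ 2 * w * τ ^ 2 := by gcongr; exact ht.2
          _ = 2 * z := by rw [mul_assoc, hwτ]
      have h3 : 1 / (3 * z) ≤ shrinkK τ t := by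
        unfold shrinkK
        exact one_div_le_one_div_of_le (by positivity) (by linarith)
      have h4 : shrinkK τ t * z ≤ 1 := by
        unfold shrinkK
        rw [div_mul_eq_mul_div, one_mul, div_le_one (by positivity)]
        linarith
      have h5 : √(1 / (3 * z)) ≤ 1 := by
        refine Real.sqrt_le_iff.mpr ⟨zero_le_one, ?_⟩
        rw [one_pow, div_le_one (by linarith)]
        linarith
      unfold groupWeight
      gcongr ?_ * ?_
      · calc √(1 / (3 * z)) ^ s ≤ √(1 / (3 * z)) ^ k :=
              pow_le_pow_of_le_one (Real.sqrt_nonneg _) h5 hk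
          _ ≤ √(shrinkK τ t) ^ k := by gcongr
      · apply Real.exp_le_exp.mpr
        rw [shrinkU_eq ht0.le]
        linarith
  have hlow : ENNReal.ofReal D * ENNReal.ofReal w ≤ groupMass a L k z τ := by
    rw [hmass]
    calc ENNReal.ofReal D * ENNReal.ofReal w = ∫⁻ _t in Icc w (2 * w), ENNReal.ofReal D := by
          rw [setLIntegral_const, Real.volume_Icc]
          congr 2
          ring
      _ ≤ ∫⁻ t in Icc w (2 * w), ENNReal.ofReal (localPdf a L t) *
            ENNReal.ofReal (groupWeight k z τ t) :=
          setLIntegral_mono' measurableSet_Icc hpt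
      _ ≤ _ := setLIntegral_le_lintegral _ _
  refine le_trans ?_ hlow
  rw [← ENNReal.ofReal_mul (by positivity)]
  refine ENNReal.ofReal_le_ofReal ?_
  have hlz : 0 ≤ Real.log z := Real.log_nonneg hz1
  have hlτ : 0 ≤ Real.log (1 / τ) := Real.log_nonneg (by rw [le_div_iff₀ hτ]; linarith)
  have hDw : 0 < D * w := by positivity
  rw [← Real.le_log_iff_exp_le hDw]
  have hs3 : Real.log (√(1 / (3 * z)) ^ s) = -(s / 2 * Real.log 3) - s / 2 * Real.log z := by
    rw [Real.log_pow, Real.log_sqrt (by positivity), one_div, Real.log_inv,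
      Real.log_mul (by norm_num) hz0.ne']
    ring
  have hlw : Real.log w = Real.log z + 2 * Real.log (1 / τ) := by
    rw [hw, Real.log_div hz0.ne' (by positivity), Real.log_pow, one_div, Real.log_inv]
    push_cast
    ring
  have hlog : Real.log (D * w) = z / 2 - (1 / 2 + s / 2 * Real.log 3 + Real.log (I / c₀) +
      (a + 1) * Real.log 2) - (s / 2 + a) * Real.log z - 2 * a * Real.log (1 / τ) := by
    rw [hD, Real.log_mul (by positivity) hw0.ne', Real.log_mul (by positivity) (by positivity),
      Real.log_mul (by positivity) (by positivity), Real.log_mul (by positivity) (by positivity),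
      Real.log_rpow (by positivity), Real.log_exp, hs3, Real.log_mul (by norm_num) hw0.ne', hlw,
      ← inv_div I c₀, Real.log_inv]
    ring
  rw [hlog]
  have h6 := le_abs_self (1 / 2 + s / 2 * Real.log 3 + Real.log (I / c₀) + (a + 1) * Real.log 2)
  rw [← hC₁] at h6
  have hC0 : 0 ≤ C₁ := abs_nonneg _
  have hs0 : (0 : ℝ) ≤ s := Nat.cast_nonneg s
  nlinarith [mul_nonneg hC0 hlz, mul_nonneg hC0 hlτ, mul_nonneg hs0 hlz, mul_nonneg hs0 hlτ,
    mul_nonneg ha hlz, mul_nonneg ha hlτ]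

/-- A group with a large statistic `z` is shrunk by a factor of order at most `log z / z`. -/
lemma exists_lintegral_shrinkK_le (hL : LocalPriorClass a L) (hLb : BoundedSlowlyVarying L)
    (ha : 0 ≤ a) (s : ℕ) :
    ∃ z₀ C : ℝ, 1 ≤ z₀ ∧ 0 < C ∧ ∀ k ≤ s, ∀ z τ : ℝ, z₀ ≤ z → 0 < τ → τ ≤ 1 →
      ∫⁻ t, ENNReal.ofReal (groupWeight k z τ t) * ENNReal.ofReal (shrinkK τ t) ∂(localLaw a L) ≤
        ENNReal.ofReal (C * (1 + Real.log z + Real.log (1 / τ)) / z) * groupMass a L k z τ := by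
  have := hL.isProbabilityMeasure
  obtain ⟨z₀, C, hz₀, hC, h⟩ := exists_exp_le_groupMass hL hLb ha s
  refine ⟨z₀, 2 * (C + 1), hz₀, by positivity, fun k hk z τ hz hτ hτ1 => ?_⟩
  have hlow := h k hk z τ hz hτ hτ1
  have hz1 : 1 ≤ z := hz₀.trans hz
  have hz0 : 0 < z := by linarith
  have hlz : 0 ≤ Real.log z := Real.log_nonneg hz1
  have hlτ : 0 ≤ Real.log (1 / τ) := Real.log_nonneg (by rw [le_div_iff₀ hτ]; linarith)
  set K := C * (1 + Real.log z + Real.log (1 / τ)) with hK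
  have hK0 : 0 ≤ K := by positivity
  have hpt : ∀ t, 0 < t → ENNReal.ofReal (groupWeight k z τ t) * ENNReal.ofReal (shrinkK τ t) ≤
      ENNReal.ofReal (2 / z) * (ENNReal.ofReal K * ENNReal.ofReal (groupWeight k z τ t) +
        ENNReal.ofReal (Real.exp (z / 2 - K))) := by
    intro t ht
    have hg0 := groupWeight_nonneg k z τ t
    have hk0 := (shrinkK_pos (τ := τ) ht.le).le
    have hk1 := shrinkK_le_one (τ := τ) ht.le
    rw [← ENNReal.ofReal_mul hg0, ← ENNReal.ofReal_mul hK0,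
      ← ENNReal.ofReal_add (by positivity) (by positivity), ← ENNReal.ofReal_mul (by positivity)]
    refine ENNReal.ofReal_le_ofReal ?_
    have h1 : shrinkK τ t = 2 / z * (shrinkK τ t * z / 2) := by field_simp
    -- The inequality x ≤ K + e^{x-K} with x = κz/2. The group weight times e^x is at most e^{z/2},
    -- and e^{z/2-K} is below the group mass by the choice of K; so the mean of x under the weighted
    -- law is at most K + 1.
    have h2 : shrinkK τ t * z / 2 ≤ K + Real.exp (shrinkK τ t * z / 2 - K) := by
      have := Real.add_one_le_exp (shrinkK τ t * z / 2 - K)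
      linarith
    have h3 : groupWeight k z τ t * Real.exp (shrinkK τ t * z / 2 - K) ≤
        Real.exp (z / 2 - K) := by
      unfold groupWeight
      rw [mul_assoc, ← Real.exp_add, shrinkU_eq ht.le]
      calc √(shrinkK τ t) ^ k *
            Real.exp ((1 - shrinkK τ t) * z / 2 + (shrinkK τ t * z / 2 - K))
          ≤ 1 * Real.exp ((1 - shrinkK τ t) * z / 2 + (shrinkK τ t * z / 2 - K)) := by
            gcongr
            exact pow_le_one₀ (Real.sqrt_nonneg _)
              (Real.sqrt_le_iff.mpr ⟨zero_le_one, by simpa using hk1⟩)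
        _ = Real.exp (z / 2 - K) := by
            rw [one_mul]
            congr 1
            ring
    calc groupWeight k z τ t * shrinkK τ t
        = 2 / z * (groupWeight k z τ t * (shrinkK τ t * z / 2)) := by
          nth_rewrite 1 [h1]; ring
      _ ≤ 2 / z * (groupWeight k z τ t * (K + Real.exp (shrinkK τ t * z / 2 - K))) := by gcongr
      _ ≤ 2 / z * (K * groupWeight k z τ t + Real.exp (z / 2 - K)) := by
          gcongr
          nlinarith
  have hgw := (measurable_groupWeight_t k z τ).ennreal_ofReal
  calc ∫⁻ t, ENNReal.ofReal (groupWeight k z τ t) * ENNReal.ofReal (shrinkK τ t) ∂(localLaw a L)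
      ≤ ∫⁻ t, ENNReal.ofReal (2 / z) * (ENNReal.ofReal K * ENNReal.ofReal (groupWeight k z τ t) +
        ENNReal.ofReal (Real.exp (z / 2 - K))) ∂(localLaw a L) := by
        refine lintegral_mono_ae ?_
        filter_upwards [hL.ae_pos] with t ht using hpt t ht
    _ = ENNReal.ofReal (2 / z) * (ENNReal.ofReal K * groupMass a L k z τ +
        ENNReal.ofReal (Real.exp (z / 2 - K))) := by
        rw [lintegral_const_mul _ ((hgw.const_mul _).add_const _),
          lintegral_add_right _ measurable_const, lintegral_const_mul _ hgw, lintegral_const,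
          measure_univ, mul_one]
        rfl
    _ ≤ ENNReal.ofReal (2 / z) * (ENNReal.ofReal K * groupMass a L k z τ +
        ENNReal.ofReal 1 * groupMass a L k z τ) := by
        gcongr
        rw [ENNReal.ofReal_one, one_mul]
        exact hlow
    _ = ENNReal.ofReal (2 / z * (K + 1)) * groupMass a L k z τ := by
        rw [← add_mul, ← mul_assoc, ← ENNReal.ofReal_add hK0 zero_le_one,
          ← ENNReal.ofReal_mul (by positivity)]
    _ ≤ _ := by
        gcongr
        rw [div_mul_eq_mul_div]
        refine div_le_div_of_nonneg_right ?_ hz0.le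
        rw [hK]
        nlinarith

end GroupBounds

/-! ### The law of the data -/

section Noise

variable {n G : ℕ} {m : Fin G → ℕ} {X : Matrix (Fin n) (Idx m) ℝ} {c σ : ℝ}

/-- The law of the noise vector. -/
def noiseLaw (n : ℕ) (σ : ℝ) : Measure (Fin n → ℝ) :=
  Measure.pi fun _ => gaussianReal 0 (σ ^ 2).toNNReal

instance (n : ℕ) (σ : ℝ) : IsProbabilityMeasure (noiseLaw n σ) := by
  unfold noiseLaw
  infer_instance

lemma dataLaw_eq_map (X : Matrix (Fin n) (Idx m) ℝ) (β0 : Idx m → ℝ) (σ : ℝ) :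
    dataLaw X β0 σ = (noiseLaw n σ).map fun e => X *ᵥ β0 + e := by
  have h := Measure.pi_map_pi (μ := fun _ : Fin n => gaussianReal 0 (σ ^ 2).toNNReal)
    (f := fun i x => (X *ᵥ β0) i + x) (fun i => by fun_prop)
  unfold dataLaw noiseLaw
  simp only [gaussianReal_map_const_add, zero_add] at h
  rw [← h]
  rfl

/-- Compare characteristic functions: the exponential of a sum factorises over the independent
coordinates. -/
lemma map_dotProduct_noiseLaw (v : Fin n → ℝ) :
    (noiseLaw n σ).map (fun e => v ⬝ᵥ e) = gaussianReal 0 (σ ^ 2 * (v ⬝ᵥ v)).toNNReal := by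
  have hv : 0 ≤ v ⬝ᵥ v := Finset.sum_nonneg fun _ _ => mul_self_nonneg _
  have hm : Measurable fun e : Fin n → ℝ => v ⬝ᵥ e := by
    simp only [dotProduct]
    fun_prop
  have : IsProbabilityMeasure ((noiseLaw n σ).map (fun e => v ⬝ᵥ e)) :=
    Measure.isProbabilityMeasure_map hm.aemeasurable
  apply Measure.ext_of_charFun
  ext t
  rw [charFun_gaussianReal, charFun_apply_real, integral_map hm.aemeasurable (by fun_prop)]
  have h1 : ∀ e : Fin n → ℝ, Complex.exp (t * ((v ⬝ᵥ e : ℝ) : ℂ) * Complex.I) =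
      ∏ i, Complex.exp (((t * v i : ℝ) : ℂ) * (e i : ℂ) * Complex.I) := by
    intro e
    rw [← Complex.exp_sum]
    congr 1
    simp only [dotProduct, Complex.ofReal_sum, Complex.ofReal_mul, Finset.mul_sum, Finset.sum_mul]
    exact Finset.sum_congr rfl fun i _ => by ring
  simp_rw [h1]
  rw [noiseLaw, integral_fintype_prod_eq_prod (f := fun i (x : ℝ) =>
    Complex.exp (((t * v i : ℝ) : ℂ) * (x : ℂ) * Complex.I))]
  simp_rw [← charFun_apply_real, charFun_gaussianReal]
  rw [← Complex.exp_sum]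
  congr 1
  rw [Real.coe_toNNReal _ (by positivity), Real.coe_toNNReal _ (by positivity)]
  simp only [dotProduct, Complex.ofReal_zero, mul_zero, zero_mul, zero_sub, Complex.ofReal_sum,
    Complex.ofReal_mul, Finset.mul_sum, Finset.sum_mul, Finset.sum_div, ← Finset.sum_neg_distrib]
  exact Finset.sum_congr rfl fun i _ => by ring

lemma lintegral_exp_dotProduct (v : Fin n → ℝ) :
    ∫⁻ e, ENNReal.ofReal (Real.exp (v ⬝ᵥ e)) ∂(noiseLaw n σ) =
      ENNReal.ofReal (Real.exp (σ ^ 2 * (v ⬝ᵥ v) / 2)) := by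
  have hv : 0 ≤ v ⬝ᵥ v := Finset.sum_nonneg fun _ _ => mul_self_nonneg _
  have hm : Measurable fun e : Fin n → ℝ => v ⬝ᵥ e := by
    simp only [dotProduct]
    fun_prop
  have h1 : ∫⁻ e, ENNReal.ofReal (Real.exp (v ⬝ᵥ e)) ∂(noiseLaw n σ) =
      ∫⁻ x, ENNReal.ofReal (Real.exp x) ∂((noiseLaw n σ).map fun e => v ⬝ᵥ e) := by
    rw [lintegral_map (by fun_prop) hm]
  have hint := integrable_exp_mul_gaussianReal (μ := 0) (v := (σ ^ 2 * (v ⬝ᵥ v)).toNNReal) 1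
  simp only [one_mul] at hint
  have hmgf := congrFun (mgf_id_gaussianReal (μ := 0) (v := (σ ^ 2 * (v ⬝ᵥ v)).toNNReal)) 1
  simp only [mgf, id, one_mul, zero_add, one_pow, mul_one] at hmgf
  rw [h1, map_dotProduct_noiseLaw, ← ofReal_integral_eq_lintegral_ofReal hint
    (ae_of_all _ fun x => (Real.exp_pos x).le), hmgf, Real.coe_toNNReal _ (by positivity)]

lemma measurable_ofReal_groupWeight {α : Type*} [MeasurableSpace α] {f h : α → ℝ}
    (hf : Measurable f) (hh : Measurable h) (k : ℕ) (τ : ℝ) :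
    Measurable fun x => ENNReal.ofReal (groupWeight k (f x) τ (h x)) := by
  unfold groupWeight shrinkK shrinkU
  fun_prop

lemma kernelMass_smul {k : ℕ} (A : Matrix (Fin n) (Fin k) ℝ) (hσ : 0 < σ) {r : ℝ} (hr : 0 < r) :
    kernelMass A (r * σ) = ENNReal.ofReal (r ^ k) * kernelMass A σ := by
  unfold kernelMass
  rw [lintegral_comp_diagonal (D := fun _ => r) (fun _ => hr) 0
    continuous_gaussKernel.measurable.ennreal_ofReal]
  simp only [Finset.prod_const, Finset.card_univ, Fintype.card_fin, Pi.zero_apply, add_zero]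
  congr 1
  refine lintegral_congr fun x => ?_
  congr 1
  unfold gaussKernel
  have : (fun i => r * x i) = r • x := rfl
  rw [this, Matrix.mulVec_smul, smul_dotProduct, dotProduct_smul]
  congr 1
  simp only [smul_eq_mul]
  field_simp

/-- The moment generating function of the group statistic of pure noise. -/
lemma lintegral_groupWeight_noise (hX : BlockOrthogonal X) (hc : 0 < c) (hA : BoundedBelow X c)
    (hσ : 0 < σ) (g : Fin G) {v : ℝ} (hv : 0 < v) :
    ∫⁻ e, ENNReal.ofReal (groupWeight (m g) (groupStat X σ e g) 1 v) ∂(noiseLaw n σ) = 1 := by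
  set A := groupBlock X g with hAdef
  have hAb : BoundedBelow A c := hA.groupBlock g
  set u := shrinkU 1 v with hu
  have hu0 : 0 < u := shrinkU_pos one_pos hv
  have huv : u * (1 + v) = v := by
    rw [hu]; unfold shrinkU; field_simp
  have hsu : 0 < √u := Real.sqrt_pos.mpr hu0
  have hsv : 0 < √v := Real.sqrt_pos.mpr hv
  have hsu2 : √u ^ 2 = u := Real.sq_sqrt hu0.le
  have hsv2 : √v ^ 2 = v := Real.sq_sqrt hv.le
  -- The exponential of a squared norm is linearised as a Gaussian mixture of exponentials of linear
  -- forms in e; the shift of x by u times the fitted block completes the square.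
  have hpt : ∀ e, ENNReal.ofReal (Real.exp (u * groupStat X σ e g / 2)) * kernelMass A (√u * σ) =
      ∫⁻ x, ENNReal.ofReal (Real.exp (((σ ^ 2)⁻¹ • (A *ᵥ x)) ⬝ᵥ e)) *
        ENNReal.ofReal (gaussKernel A (√u * σ) x) := by
    intro e
    set b := groupPart (ols X e) g with hb
    have hnormal : ∀ x, (A *ᵥ x) ⬝ᵥ e = (A *ᵥ x) ⬝ᵥ (A *ᵥ b) := by
      intro x
      let w : Idx m → ℝ := fun p => if h : p.1 = g then x (h ▸ p.2) else 0
      have hw : groupPart w g = x := by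
        ext j
        simp [w, groupPart]
      have h := hX.groupImage_dotProduct_ols hc hA g w e
      unfold groupImage at h
      rw [hw] at h
      exact h.symm
    have hm : Measurable fun x => ENNReal.ofReal (Real.exp (((σ ^ 2)⁻¹ • (A *ᵥ x)) ⬝ᵥ e)) *
        ENNReal.ofReal (gaussKernel A (√u * σ) x) := by
      refine Measurable.mul (Continuous.measurable ?_).ennreal_ofReal
        continuous_gaussKernel.measurable.ennreal_ofReal
      simp only [dotProduct, Matrix.mulVec, Pi.smul_apply]
      fun_prop
    rw [kernelMass, ← lintegral_const_mul _ continuous_gaussKernel.measurable.ennreal_ofReal,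
      ← lintegral_add_right_eq_self (fun x => ENNReal.ofReal
        (Real.exp (((σ ^ 2)⁻¹ • (A *ᵥ x)) ⬝ᵥ e)) * ENNReal.ofReal (gaussKernel A (√u * σ) x))
        (u • b)]
    refine lintegral_congr fun x => ?_
    rw [← ENNReal.ofReal_mul (Real.exp_pos _).le, ← ENNReal.ofReal_mul (Real.exp_pos _).le]
    congr 1
    unfold gaussKernel
    rw [← Real.exp_add, ← Real.exp_add, smul_dotProduct, hnormal, Matrix.mulVec_add,
      Matrix.mulVec_smul]
    congr 1
    have hstat : groupStat X σ e g = ((A *ᵥ b) ⬝ᵥ (A *ᵥ b)) / σ ^ 2 := rfl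
    rw [hstat]
    simp only [add_dotProduct, dotProduct_add, smul_dotProduct, dotProduct_smul, smul_eq_mul]
    rw [dotProduct_comm (A *ᵥ b) (A *ᵥ x), mul_pow, hsu2]
    field_simp
    ring
  have hmeas : Measurable fun e => ENNReal.ofReal (Real.exp (u * groupStat X σ e g / 2)) := by
    have := (continuous_groupStat (X := X) σ g).measurable
    fun_prop
  -- Integrating over the noise first adds ‖Ax‖²/(2σ²) to the exponent -‖Ax‖²/(2uσ²). Since 1/u - 1
  -- = 1/v, what remains is the kernel with u replaced by v.
  have hE : (∫⁻ e, ENNReal.ofReal (Real.exp (u * groupStat X σ e g / 2)) ∂(noiseLaw n σ)) *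
      kernelMass A (√u * σ) = kernelMass A (√v * σ) := by
    rw [← lintegral_mul_const _ hmeas]
    simp_rw [hpt]
    rw [lintegral_lintegral_swap]
    · unfold kernelMass
      refine lintegral_congr fun x => ?_
      have hm2 : Measurable fun e : Fin n → ℝ =>
          ENNReal.ofReal (Real.exp (((σ ^ 2)⁻¹ • (A *ᵥ x)) ⬝ᵥ e)) := by
        simp only [dotProduct]
        fun_prop
      rw [lintegral_mul_const _ hm2, lintegral_exp_dotProduct,
        ← ENNReal.ofReal_mul (Real.exp_pos _).le]
      congr 1
      unfold gaussKernel
      rw [← Real.exp_add, smul_dotProduct, dotProduct_smul, mul_pow, mul_pow, hsu2, hsv2]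
      congr 1
      simp only [smul_eq_mul]
      generalize (A *ᵥ x) ⬝ᵥ (A *ᵥ x) = q
      field_simp
      linear_combination (q) * huv
    · have h1 : Measurable fun q : (Fin n → ℝ) × (Fin (m g) → ℝ) =>
          ENNReal.ofReal (Real.exp (((σ ^ 2)⁻¹ • (A *ᵥ q.2)) ⬝ᵥ q.1)) := by
        refine (Continuous.measurable ?_).ennreal_ofReal
        simp only [dotProduct, Matrix.mulVec, Pi.smul_apply]
        fun_prop
      have h2 : Measurable fun q : (Fin n → ℝ) × (Fin (m g) → ℝ) =>
          ENNReal.ofReal (gaussKernel A (√u * σ) q.2) :=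
        (continuous_gaussKernel.measurable.comp measurable_snd).ennreal_ofReal
      exact (h1.mul h2).aemeasurable
  rw [kernelMass_smul A hσ hsu, kernelMass_smul A hσ hsv, ← mul_assoc] at hE
  have hE2 := (ENNReal.mul_left_inj kernelMass_ne_zero (kernelMass_ne_top hc hAb hσ)).mp hE
  -- The two kernel masses have ratio (v/u)^{m/2}, which the factor κ^{m/2} cancels because κv = u.
  have hk : √(shrinkK 1 v) ^ m g * √v ^ m g = √u ^ m g := by
    rw [← mul_pow, ← Real.sqrt_mul (shrinkK_pos hv.le).le]
    congr 2
    rw [hu]; unfold shrinkU shrinkK; field_simp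
  have hgw : ∀ e, ENNReal.ofReal (groupWeight (m g) (groupStat X σ e g) 1 v) =
      ENNReal.ofReal (√(shrinkK 1 v) ^ m g) *
        ENNReal.ofReal (Real.exp (u * groupStat X σ e g / 2)) := fun e =>
    ENNReal.ofReal_mul (by positivity)
  simp_rw [hgw]
  rw [lintegral_const_mul _ hmeas]
  have hpos : ENNReal.ofReal (√u ^ m g) ≠ 0 := by
    rw [ne_eq, ENNReal.ofReal_eq_zero, not_le]; positivity
  refine (ENNReal.mul_left_inj hpos ENNReal.ofReal_ne_top).mp ?_
  rw [mul_assoc, hE2, ← ENNReal.ofReal_mul (by positivity), hk, one_mul]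

/-- Chernoff's bound for the group statistic of pure noise. -/
lemma noise_groupStat_ge_le (hX : BlockOrthogonal X) (hc : 0 < c) (hA : BoundedBelow X c)
    (hσ : 0 < σ) (g : Fin G) (x : ℝ) :
    noiseLaw n σ {e | x ≤ groupStat X σ e g} ≤
      ENNReal.ofReal (√2 ^ m g * Real.exp (-x / 4)) := by
  have h1 := lintegral_groupWeight_noise hX hc hA hσ g one_pos
  have hm : Measurable fun e =>
      ENNReal.ofReal (groupWeight (m g) (groupStat X σ e g) 1 1) :=
    measurable_ofReal_groupWeight (continuous_groupStat (X := X) σ g).measurable measurable_const _ _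
  have hK : shrinkK 1 1 = 1 / 2 := by unfold shrinkK; norm_num
  have hU : shrinkU 1 1 = 1 / 2 := by unfold shrinkU; norm_num
  -- Markov's inequality for the mean-one weight at v = 1, where κ = u = 1/2; this threshold is its
  -- value at statistic x.
  set ε := √(1 / 2) ^ m g * Real.exp (x / 4) with hε
  have hε0 : 0 < ε := by positivity
  have h2 := meas_ge_le_lintegral_div (μ := noiseLaw n σ) hm.aemeasurable
    (ε := ENNReal.ofReal ε) (by simpa using hε0) ENNReal.ofReal_ne_top
  rw [h1] at h2
  refine le_trans (measure_mono ?_) (h2.trans_eq ?_)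
  · intro e he
    refine ENNReal.ofReal_le_ofReal ?_
    simp only [groupWeight, hK, hU, hε]
    have hx : x ≤ groupStat X σ e g := he
    exact mul_le_mul_of_nonneg_left (Real.exp_le_exp.mpr (by linarith)) (by positivity)
  · rw [one_div, ← ENNReal.ofReal_inv_of_pos hε0, hε]
    congr 1
    rw [mul_inv, ← Real.exp_neg, ← inv_pow, one_div, Real.sqrt_inv, inv_inv, neg_div]

lemma measurable_tailMass_comp {g : Fin G} (k : ℕ) :
    Measurable fun e => tailMass k (groupStat X σ e g) := by
  have h1 : Measurable fun q : (Fin n → ℝ) × ℝ =>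
      ENNReal.ofReal (q.2 ^ (-(3 : ℝ) / 2) * shrinkU 1 q.2) *
        ENNReal.ofReal (groupWeight k (groupStat X σ q.1 g) 1 q.2) := by
    exact (measurable_tail.comp measurable_snd).mul (measurable_ofReal_groupWeight
      ((continuous_groupStat (X := X) σ g).measurable.comp measurable_fst) measurable_snd _ _)
  exact h1.lintegral_prod_right'

/-- After exchanging the integrals the noise average of the weight is 1 for every v, so the result
does not depend on the group size. -/
lemma lintegral_tailMass_noise (hX : BlockOrthogonal X) (hc : 0 < c) (hA : BoundedBelow X c)
    (hσ : 0 < σ) (g : Fin G) :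
    ∫⁻ e, tailMass (m g) (groupStat X σ e g) ∂(noiseLaw n σ) = tailTotal := by
  unfold tailMass tailTotal
  rw [lintegral_lintegral_swap]
  · refine setLIntegral_congr_fun measurableSet_Ioi fun v (hv : 0 < v) => ?_
    rw [lintegral_const_mul _ (measurable_ofReal_groupWeight
      (continuous_groupStat (X := X) σ g).measurable measurable_const _ _),
      lintegral_groupWeight_noise hX hc hA hσ g hv, mul_one]
  · exact ((measurable_tail.comp measurable_snd).mul (measurable_ofReal_groupWeight
      ((continuous_groupStat (X := X) σ g).measurable.comp measurable_fst)
      measurable_snd _ _)).aemeasurable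

/-- At v = 1 the mean-one weight is 2^{-m/2} e^{z/4}. -/
lemma lintegral_exp_quarter_noise (hX : BlockOrthogonal X) (hc : 0 < c) (hA : BoundedBelow X c)
    (hσ : 0 < σ) (g : Fin G) :
    ∫⁻ e, ENNReal.ofReal (Real.exp (groupStat X σ e g / 4)) ∂(noiseLaw n σ) =
      ENNReal.ofReal (√2 ^ m g) := by
  have h1 := lintegral_groupWeight_noise hX hc hA hσ g one_pos
  have hK : shrinkK 1 1 = 1 / 2 := by unfold shrinkK; norm_num
  have hU : shrinkU 1 1 = 1 / 2 := by unfold shrinkU; norm_num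
  have hm := (continuous_groupStat (X := X) σ g).measurable
  have h2 : ∀ e, ENNReal.ofReal (Real.exp (groupStat X σ e g / 4)) = ENNReal.ofReal (√2 ^ m g) *
      ENNReal.ofReal (groupWeight (m g) (groupStat X σ e g) 1 1) := by
    intro e
    rw [← ENNReal.ofReal_mul (by positivity), groupWeight, hK, hU, ← mul_assoc, ← mul_pow,
      ← Real.sqrt_mul (by norm_num)]
    norm_num
    congr 1
    ring_nf
  simp_rw [h2]
  rw [lintegral_const_mul _ (measurable_ofReal_groupWeight hm measurable_const _ _), h1, mul_one]

/-- Mills' bound. -/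
lemma gaussianReal_Ici_le {x : ℝ} (hx : 0 < x) :
    gaussianReal 0 1 (Ici x) ≤ ENNReal.ofReal (Real.exp (-x ^ 2 / 2) / x) := by
  -- On the tail 1 ≤ w/x, and inserting this factor makes the Gaussian density exactly integrable.
  have hderiv : ∀ w ∈ Ici x, HasDerivAt (fun w : ℝ => -Real.exp (-w ^ 2 / 2))
      (w * Real.exp (-w ^ 2 / 2)) w := by
    intro w _
    have h : HasDerivAt (fun w : ℝ => -w ^ 2 / 2) (-w) w := by
      have h2 : HasDerivAt (fun w : ℝ => -w ^ 2 / 2) _ w := (hasDerivAt_pow 2 w).neg.div_const 2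
      refine h2.congr_deriv ?_
      push_cast
      ring
    refine h.exp.neg.congr_deriv ?_
    ring
  have hpos : ∀ w ∈ Ioi x, 0 ≤ w * Real.exp (-w ^ 2 / 2) := fun w hw => by
    have : 0 < w := hx.trans hw
    positivity
  have hlim : Tendsto (fun w : ℝ => -Real.exp (-w ^ 2 / 2)) atTop (𝓝 0) := by
    rw [← neg_zero]
    refine (Real.tendsto_exp_atBot.comp ?_).neg
    have h2 : Tendsto (fun w : ℝ => w ^ 2 / 2) atTop atTop :=
      (tendsto_pow_atTop two_ne_zero).atTop_div_const two_pos
    refine (tendsto_neg_atTop_atBot.comp h2).congr fun w => ?_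
    simp only [Function.comp]
    ring
  have hint := integrableOn_Ioi_deriv_of_nonneg' hderiv hpos hlim
  have hval := integral_Ioi_of_hasDerivAt_of_tendsto' hderiv hint hlim
  have hval2 : ∫⁻ w in Ioi x, ENNReal.ofReal (w * Real.exp (-w ^ 2 / 2)) =
      ENNReal.ofReal (Real.exp (-x ^ 2 / 2)) := by
    rw [← ofReal_integral_eq_lintegral_ofReal hint, hval]
    · simp
    · filter_upwards [ae_restrict_mem measurableSet_Ioi] with w hw using hpos w hw
  rw [gaussianReal_apply _ one_ne_zero, ← restrict_Ioi_eq_restrict_Ici]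
  calc ∫⁻ w in Ioi x, gaussianPDF 0 1 w
      ≤ ∫⁻ w in Ioi x, ENNReal.ofReal (1 / x) * ENNReal.ofReal (w * Real.exp (-w ^ 2 / 2)) := by
        refine setLIntegral_mono' measurableSet_Ioi fun w (hw : x < w) => ?_
        have hw0 : 0 < w := hx.trans hw
        rw [gaussianPDF, ← ENNReal.ofReal_mul (by positivity)]
        refine ENNReal.ofReal_le_ofReal ?_
        rw [gaussianPDFReal]
        have h1 : (√(2 * Real.pi * ((1 : ℝ≥0) : ℝ)))⁻¹ ≤ 1 := by
          refine inv_le_one_of_one_le₀ (Real.one_le_sqrt.mpr ?_)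
          have := Real.pi_gt_three
          simp only [NNReal.coe_one]
          linarith
        have h2 : 1 ≤ 1 / x * w := by
          rw [div_mul_eq_mul_div, one_mul, le_div_iff₀ hx]
          linarith
        calc (√(2 * Real.pi * ((1 : ℝ≥0) : ℝ)))⁻¹ *
              Real.exp (-(w - 0) ^ 2 / (2 * ((1 : ℝ≥0) : ℝ)))
            ≤ 1 * Real.exp (-w ^ 2 / 2) := by
              simp only [NNReal.coe_one, mul_one, sub_zero] at h1 ⊢
              gcongr
          _ ≤ (1 / x * w) * Real.exp (-w ^ 2 / 2) := by gcongr
          _ = _ := by ring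
    _ = ENNReal.ofReal (1 / x) * ENNReal.ofReal (Real.exp (-x ^ 2 / 2)) := by
        rw [lintegral_const_mul _ (by fun_prop), hval2]
    _ = _ := by
        rw [← ENNReal.ofReal_mul (by positivity)]
        congr 1
        ring

/-- Gaussian tail bound for the statistic of a group of size one. -/
lemma noise_groupStat_ge_le_of_size_one (hX : BlockOrthogonal X) (hc : 0 < c)
    (hA : BoundedBelow X c) (hσ : 0 < σ) {g : Fin G} (hg : m g = 1) {x : ℝ} (hx : 0 < x) :
    noiseLaw n σ {e | x ^ 2 ≤ groupStat X σ e g} ≤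
      ENNReal.ofReal (2 * (Real.exp (-x ^ 2 / 2) / x)) := by
  let j : Fin (m g) := ⟨0, by omega⟩
  have hj : ∀ i : Fin (m g), i = j := fun i => by
    have := i.2
    ext
    change i.1 = 0
    omega
  let d : Idx m → ℝ := fun _ => 1
  set q := groupImage X g d with hq
  have hN : 0 < q ⬝ᵥ q := by
    refine lt_of_lt_of_le ?_ (hA.groupImage g d)
    refine mul_pos hc (Finset.sum_pos (fun i _ => ?_) ⟨j, Finset.mem_univ j⟩)
    simp [groupPart, d]
  have hb : ∀ e, groupImage X g (ols X e) = ols X e ⟨g, j⟩ • q := fun e =>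
    groupImage_of_groupPart_eq_smul X g _ fun i => by simp [hj i, d]
  -- The image of a one-column block is a line, so the statistic is the square of a single linear
  -- functional, normalised to be standard Gaussian under the noise.
  have hstat : ∀ e, groupStat X σ e g =
      (((σ * √(q ⬝ᵥ q))⁻¹ • q) ⬝ᵥ e) ^ 2 := by
    intro e
    have h1 := hX.groupImage_dotProduct_ols hc hA g d e
    rw [← hq, hb, dotProduct_smul, smul_eq_mul] at h1
    rw [groupStat, hb, smul_dotProduct, smul_dotProduct, dotProduct_smul, ← h1]
    simp only [smul_eq_mul, mul_pow, inv_pow]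
    rw [Real.sq_sqrt hN.le]
    field_simp
  set w := (σ * √(q ⬝ᵥ q))⁻¹ • q with hw
  have hww : σ ^ 2 * (w ⬝ᵥ w) = 1 := by
    rw [hw, smul_dotProduct, dotProduct_smul]
    simp only [smul_eq_mul]
    have := Real.sq_sqrt hN.le
    have h2 : 0 < √(q ⬝ᵥ q) := Real.sqrt_pos.mpr hN
    field_simp
    linarith
  have hlaw := map_dotProduct_noiseLaw (σ := σ) w
  rw [hww, Real.toNNReal_one] at hlaw
  have hm : Measurable fun e : Fin n → ℝ => w ⬝ᵥ e := by
    simp only [dotProduct]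
    fun_prop
  have hset : {e | x ^ 2 ≤ groupStat X σ e g} = (fun e => w ⬝ᵥ e) ⁻¹' (Ici x ∪ Iic (-x)) := by
    ext e
    simp only [mem_ofPred_eq, mem_preimage, mem_union, mem_Ici, mem_Iic, hstat]
    rw [sq_le_sq, abs_of_pos hx, le_abs]
    constructor
    · rintro (h | h)
      · exact Or.inl h
      · exact Or.inr (by linarith)
    · rintro (h | h)
      · exact Or.inl h
      · exact Or.inr (by linarith)
  have hneg : gaussianReal 0 1 (Iic (-x)) = gaussianReal 0 1 (Ici x) := by
    have h := gaussianReal_map_neg (μ := 0) (v := 1)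
    rw [neg_zero] at h
    conv_lhs => rw [← h]
    rw [Measure.map_apply measurable_neg measurableSet_Iic]
    congr 1
    ext z
    simp
  rw [hset, ← Measure.map_apply hm (measurableSet_Ici.union measurableSet_Iic), hlaw]
  refine (measure_union_le _ _).trans ?_
  rw [hneg, ← two_mul, ENNReal.ofReal_mul two_pos.le, ENNReal.ofReal_ofNat]
  gcongr
  exact gaussianReal_Ici_le hx

end Noise

/-! ### Selection of the groups -/

section Selection

variable {n G : ℕ} {m : Fin G → ℕ} {X : Matrix (Fin n) (Idx m) ℝ} {c σ a : ℝ} {L : ℝ → ℝ}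

lemma groupStat_mulVec_add_of_eq_zero (hc : 0 < c) (hA : BoundedBelow X c) {β : Idx m → ℝ}
    {g : Fin G} (hβ : groupPart β g = 0) (e : Fin n → ℝ) :
    groupStat X σ (X *ᵥ β + e) g = groupStat X σ e g := by
  unfold groupStat
  rw [hA.ols_mulVec_add hc, groupImage_add, groupImage_eq_zero X g hβ, zero_add]

/-- From ‖v + 2w‖² ≥ 0 one gets ‖v + w‖² ≥ ‖v‖²/2 - ‖w‖²: a strong signal survives moderate noise.
-/
lemma le_groupStat_mulVec_add (hc : 0 < c) (hA : BoundedBelow X c) (β : Idx m → ℝ) (g : Fin G)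
    (e : Fin n → ℝ) :
    groupImage X g β ⬝ᵥ groupImage X g β / (2 * σ ^ 2) - groupStat X σ e g ≤
      groupStat X σ (X *ᵥ β + e) g := by
  unfold groupStat
  rw [hA.ols_mulVec_add hc, groupImage_add]
  set v := groupImage X g β
  set w := groupImage X g (ols X e)
  have h : 0 ≤ (v + (2 : ℝ) • w) ⬝ᵥ (v + (2 : ℝ) • w) :=
    Finset.sum_nonneg fun _ _ => mul_self_nonneg _
  simp only [add_dotProduct, dotProduct_add, smul_dotProduct, dotProduct_smul, smul_eq_mul] at h ⊢
  rw [dotProduct_comm w v] at h ⊢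
  have h2 : v ⬝ᵥ v / (2 * σ ^ 2) - w ⬝ᵥ w / σ ^ 2 = (v ⬝ᵥ v / 2 - w ⬝ᵥ w) / σ ^ 2 := by
    rw [sub_div, div_div]
  rw [h2]
  exact div_le_div_of_nonneg_right (by linarith) (sq_nonneg σ)

/-- An inactive group is selected with probability `O(γ)`, if `γ` bounds the global parameter. -/
lemma exists_noise_selected_le (ha : 1 / 2 ≤ a) (hL : LocalPriorClass a L)
    (hLb : BoundedSlowlyVarying L) (hσ : 0 < σ) (s : ℕ) :
    ∃ K > 0, ∀ {n G : ℕ} {m : Fin G → ℕ} {X : Matrix (Fin n) (Idx m) ℝ} {c γ : ℝ} {π : Measure ℝ}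
      [IsProbabilityMeasure π] (β : Idx m → ℝ) (g : Fin G), BlockOrthogonal X → 0 < c →
      BoundedBelow X c → m g ≤ s → 0 < γ → γ ≤ 1 / 2 → (∀ᵐ τ ∂π, 0 < τ ∧ τ ≤ γ) →
      groupPart β g = 0 →
      noiseLaw n σ {e | ¬ shrinkWeight X σ a L π (X *ᵥ β + e) g ≤ 1 / 2} ≤
        ENNReal.ofReal (K * γ) := by
  obtain ⟨d, hd, hmass⟩ := exists_le_groupMass hL s
  obtain ⟨M, hM, hN⟩ := exists_lintegral_shrinkU_le ha hL hLb
  set T := tailTotal.toReal with hT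
  have hTT : tailTotal = ENNReal.ofReal T := (ENNReal.ofReal_toReal tailTotal_lt_top.ne).symm
  have hT0 : 0 ≤ T := ENNReal.toReal_nonneg
  refine ⟨(√2 ^ s + M * T) / (d / 2), by positivity, ?_⟩
  intro n G m X c γ π _ β g hX hc hA hmg hγ hγ2 hπ hβ
  set Ψ : (Fin n → ℝ) → ℝ≥0∞ := fun e => ENNReal.ofReal γ *
    (ENNReal.ofReal (Real.exp (groupStat X σ e g / 4)) +
      ENNReal.ofReal M * tailMass (m g) (groupStat X σ e g)) with hΨ
  have hm1 : Measurable fun e => ENNReal.ofReal (Real.exp (groupStat X σ e g / 4)) :=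
    (Real.measurable_exp.comp
      ((continuous_groupStat (X := X) σ g).measurable.div_const 4)).ennreal_ofReal
  have hm2 : Measurable fun e => ENNReal.ofReal M * tailMass (m g) (groupStat X σ e g) :=
    (measurable_tailMass_comp (X := X) (σ := σ) (g := g) (m g)).const_mul _
  have hΨm : Measurable Ψ := (hm1.add hm2).const_mul _
  -- `Ψ` dominates the numerator for all τ ≤ γ at once, and d bounds the denominator below.
  -- Selection therefore forces `Ψ` to reach d/2, an event controlled by the mean of `Ψ`.
  have hsub : {e | ¬ shrinkWeight X σ a L π (X *ᵥ β + e) g ≤ 1 / 2} ⊆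
      {e | ENNReal.ofReal (d / 2) ≤ Ψ e} := by
    intro e he
    by_contra hlt
    have hlt : Ψ e ≤ ENNReal.ofReal (d / 2) := (not_le.mp hlt).le
    apply he
    refine shrinkWeight_le hX hc hA hσ hL (hπ.mono fun _ h => h.1) _ g (by norm_num) ?_
    filter_upwards [hπ] with τ hτ
    rw [groupStat_mulVec_add_of_eq_zero hc hA hβ]
    have hz := groupStat_nonneg (X := X) σ e g
    refine (hN (m g) _ τ hz hτ.1 (hτ.2.trans hγ2)).trans ?_
    calc _ ≤ Ψ e := by
          simp only [hΨ]
          gcongr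
          exact hτ.2
      _ ≤ ENNReal.ofReal (d / 2) := hlt
      _ = ENNReal.ofReal (1 / 2) * ENNReal.ofReal d := by
          rw [← ENNReal.ofReal_mul (p := 1 / 2) (by norm_num)]; congr 1; ring
      _ ≤ _ := by
          gcongr
          exact hmass (m g) hmg _ τ hz hτ.1 (hτ.2.trans (hγ2.trans (by norm_num)))
  have hd2 : 0 < d / 2 := by positivity
  refine (measure_mono hsub).trans ((meas_ge_le_lintegral_div hΨm.aemeasurable
    (by simpa using hd2) ENNReal.ofReal_ne_top).trans ?_)
  rw [ENNReal.div_le_iff (by simpa using hd2) ENNReal.ofReal_ne_top]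
  simp only [hΨ]
  have hm3 : Measurable fun e => ENNReal.ofReal (Real.exp (groupStat X σ e g / 4)) +
      ENNReal.ofReal M * tailMass (m g) (groupStat X σ e g) := hm1.add hm2
  rw [lintegral_const_mul _ hm3, lintegral_add_left hm1,
    lintegral_const_mul _ (measurable_tailMass_comp (X := X) (σ := σ) (g := g) (m g)),
    lintegral_exp_quarter_noise hX hc hA hσ, lintegral_tailMass_noise hX hc hA hσ, hTT,
    ← ENNReal.ofReal_mul hM.le, ← ENNReal.ofReal_add (by positivity) (by positivity),
    ← ENNReal.ofReal_mul hγ.le, ← ENNReal.ofReal_mul (by positivity)]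
  refine ENNReal.ofReal_le_ofReal ?_
  have h1 : (√2 ^ m g : ℝ) ≤ √2 ^ s :=
    pow_le_pow_right₀ (Real.one_le_sqrt.mpr (by norm_num)) hmg
  calc γ * (√2 ^ m g + M * T) ≤ γ * (√2 ^ s + M * T) := by gcongr
    _ = _ := by field_simp

/-- For a group of size one, the bound improves by a factor `√(log (1 / γ))`. -/
lemma exists_noise_selected_le_of_size_one (ha : 1 / 2 ≤ a) (hL : LocalPriorClass a L)
    (hLb : BoundedSlowlyVarying L) (hσ : 0 < σ) :
    ∃ K > 0, ∃ κ > 0, ∀ {n G : ℕ} {m : Fin G → ℕ} {X : Matrix (Fin n) (Idx m) ℝ} {c γ : ℝ}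
      {π : Measure ℝ} [IsProbabilityMeasure π] (β : Idx m → ℝ) (g : Fin G), BlockOrthogonal X →
      0 < c → BoundedBelow X c → m g = 1 → 0 < γ → γ ≤ κ → (∀ᵐ τ ∂π, 0 < τ ∧ τ ≤ γ) →
      groupPart β g = 0 →
      noiseLaw n σ {e | ¬ shrinkWeight X σ a L π (X *ᵥ β + e) g ≤ 1 / 2} ≤
        ENNReal.ofReal (K * (γ / √(Real.log (1 / γ)))) := by
  obtain ⟨d, hd, hmass⟩ := exists_le_groupMass hL 1
  obtain ⟨M, hM, hN⟩ := exists_lintegral_shrinkU_le ha hL hLb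
  set T := tailTotal.toReal with hT
  have hTT : tailTotal = ENNReal.ofReal T := (ENNReal.ofReal_toReal tailTotal_lt_top.ne).symm
  have hT0 : 0 ≤ T := ENNReal.toReal_nonneg
  set B := 1 + M * T with hB
  have hB0 : 0 < B := by positivity
  -- Chosen so that γB e^{z/2} ≤ d/2 exactly when e^{z/2} ≤ b/γ; selection then needs z ≥ 2 log(b/γ)
  -- = x².
  set b := d / (2 * B) with hb
  have hb0 : 0 < b := by positivity
  -- The bound γ ≤ b² gives log(1/γ) ≤ x². In Mills' bound e^{-x²/2} = γ/b, and the division by x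
  -- yields the gain √(log(1/γ)).
  refine ⟨2 / b, by positivity, min (1 / 2) (b ^ 2), by positivity, ?_⟩
  intro n G m X c γ π _ β g hX hc hA hmg hγ hγκ hπ hβ
  have hγ2 : γ ≤ 1 / 2 := hγκ.trans (min_le_left _ _)
  have hγb : γ ≤ b ^ 2 := hγκ.trans (min_le_right _ _)
  have hl0 : 0 < Real.log (1 / γ) := Real.log_pos (by rw [lt_div_iff₀ hγ]; linarith)
  have hl : Real.log (1 / γ) ≤ 2 * Real.log (b / γ) := by
    have : 2 * Real.log (b / γ) = Real.log ((b / γ) ^ 2) := by rw [Real.log_pow]; norm_num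
    rw [this]
    refine Real.log_le_log (by positivity) ?_
    rw [div_pow, div_le_div_iff₀ hγ (by positivity)]
    nlinarith
  set x := √(2 * Real.log (b / γ)) with hx
  have hx0 : 0 < x := Real.sqrt_pos.mpr (hl0.trans_le hl)
  have hx2 : x ^ 2 = 2 * Real.log (b / γ) := Real.sq_sqrt (hl0.trans_le hl).le
  have hsub : {e | ¬ shrinkWeight X σ a L π (X *ᵥ β + e) g ≤ 1 / 2} ⊆
      {e | x ^ 2 ≤ groupStat X σ e g} := by
    intro e he
    by_contra hlt
    have hlt : groupStat X σ e g < x ^ 2 := not_le.mp hlt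
    apply he
    refine shrinkWeight_le hX hc hA hσ hL (hπ.mono fun _ h => h.1) _ g (by norm_num) ?_
    filter_upwards [hπ] with τ hτ
    rw [groupStat_mulVec_add_of_eq_zero hc hA hβ]
    have hz := groupStat_nonneg (X := X) σ e g
    refine (hN (m g) _ τ hz hτ.1 (hτ.2.trans hγ2)).trans ?_
    set z := groupStat X σ e g
    have hexp : Real.exp (z / 2) ≤ b / γ := by
      rw [← Real.exp_log (show 0 < b / γ by positivity)]
      exact Real.exp_le_exp.mpr (by linarith)
    calc _ ≤ ENNReal.ofReal γ * (ENNReal.ofReal (Real.exp (z / 2)) +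
          ENNReal.ofReal M * (tailTotal * ENNReal.ofReal (Real.exp (z / 2)))) := by
          gcongr
          · exact hτ.2
          · linarith
          · exact tailMass_le (m g) hz
      _ = ENNReal.ofReal (γ * (B * Real.exp (z / 2))) := by
          rw [hTT, ← ENNReal.ofReal_mul hT0, ← ENNReal.ofReal_mul hM.le,
            ← ENNReal.ofReal_add (by positivity) (by positivity), ← ENNReal.ofReal_mul hγ.le]
          congr 1
          rw [hB]; ring
      _ ≤ ENNReal.ofReal (1 / 2 * d) := by
          refine ENNReal.ofReal_le_ofReal ?_
          calc γ * (B * Real.exp (z / 2)) ≤ γ * (B * (b / γ)) := by gcongr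
            _ = 1 / 2 * d := by rw [hb]; field_simp
      _ = ENNReal.ofReal (1 / 2) * ENNReal.ofReal d := by
          rw [← ENNReal.ofReal_mul (p := 1 / 2) (by norm_num)]
      _ ≤ _ := by
          gcongr
          exact hmass (m g) hmg.le _ τ hz hτ.1 (hτ.2.trans (hγ2.trans (by norm_num)))
  refine (measure_mono hsub).trans
    ((noise_groupStat_ge_le_of_size_one hX hc hA hσ hmg hx0).trans (ENNReal.ofReal_le_ofReal ?_))
  have he : Real.exp (-x ^ 2 / 2) = γ / b := by
    rw [hx2, show -(2 * Real.log (b / γ)) / 2 = -Real.log (b / γ) by ring, Real.exp_neg,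
      Real.exp_log (by positivity), inv_div]
  rw [he]
  have hxl : √(Real.log (1 / γ)) ≤ x := Real.sqrt_le_sqrt hl
  have hsq : 0 < √(Real.log (1 / γ)) := Real.sqrt_pos.mpr hl0
  calc 2 * (γ / b / x) ≤ 2 * (γ / b / √(Real.log (1 / γ))) := by gcongr
    _ = _ := by field_simp

/-- The probability that an inactive group of size at most `s` is selected. -/
lemma exists_noise_selected_le_rpow_log (ha : 1 / 2 ≤ a) (hL : LocalPriorClass a L)
    (hLb : BoundedSlowlyVarying L) (hσ : 0 < σ) (s : ℕ) :
    ∃ K > 0, ∃ κ > 0, ∀ {n G : ℕ} {m : Fin G → ℕ} {X : Matrix (Fin n) (Idx m) ℝ} {c γ : ℝ}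
      {π : Measure ℝ} [IsProbabilityMeasure π] (β : Idx m → ℝ) (g : Fin G), BlockOrthogonal X →
      0 < c → BoundedBelow X c → 1 ≤ m g → m g ≤ s → 0 < γ → γ ≤ κ →
      (∀ᵐ τ ∂π, 0 < τ ∧ τ ≤ γ) → groupPart β g = 0 →
      noiseLaw n σ {e | ¬ shrinkWeight X σ a L π (X *ᵥ β + e) g ≤ 1 / 2} ≤
        ENNReal.ofReal (K * (γ * Real.log (1 / γ) ^ ((s : ℝ) / 2 - 1))) := by
  -- For s = 1 the exponent s/2 - 1 is -1/2 and the Gaussian tail is required. For s ≥ 2 it is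
  -- nonnegative, so the logarithmic factor is at least 1 once γ ≤ 1/e, and the Markov bound
  -- suffices.
  rcases Nat.lt_or_ge s 2 with hs | hs
  · obtain ⟨K, hK, κ, hκ, h⟩ := exists_noise_selected_le_of_size_one ha hL hLb hσ
    refine ⟨K, hK, min κ 1, by positivity, ?_⟩
    intro n G m X c γ π _ β g hX hc hA hm1 hms hγ hγκ hπ hβ
    have hs1 : s = 1 := by omega
    have hl0 : 0 ≤ Real.log (1 / γ) :=
      Real.log_nonneg (by rw [le_div_iff₀ hγ]; linarith [hγκ.trans (min_le_right _ _)])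
    refine (h β g hX hc hA (by omega) hγ (hγκ.trans (min_le_left _ _)) hπ hβ).trans_eq ?_
    rw [hs1, div_eq_mul_inv γ, Real.sqrt_eq_rpow, ← Real.rpow_neg hl0]
    norm_num
  · obtain ⟨K, hK, h⟩ := exists_noise_selected_le ha hL hLb hσ s
    refine ⟨K, hK, min (1 / 2) (Real.exp (-1)), by positivity, ?_⟩
    intro n G m X c γ π _ β g hX hc hA _ hms hγ hγκ hπ hβ
    refine (h β g hX hc hA hms hγ (hγκ.trans (min_le_left _ _)) hπ hβ).trans
      (ENNReal.ofReal_le_ofReal ?_)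
    have hl : 1 ≤ Real.log (1 / γ) := by
      rw [one_div, Real.log_inv]
      have := Real.log_le_log hγ (hγκ.trans (min_le_right _ _))
      rw [Real.log_exp] at this
      linarith
    have hs' : (2 : ℝ) ≤ s := by exact_mod_cast hs
    have h1 := Real.one_le_rpow hl (show (0 : ℝ) ≤ (s : ℝ) / 2 - 1 by linarith)
    have h2 : γ ≤ γ * Real.log (1 / γ) ^ ((s : ℝ) / 2 - 1) := le_mul_of_one_le_right hγ.le h1
    gcongr

/-- An active group with a large statistic is hardly shrunk. -/
lemma exists_one_sub_shrinkWeight_le (ha : 0 ≤ a) (hL : LocalPriorClass a L)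
    (hLb : BoundedSlowlyVarying L) (hσ : 0 < σ) (s : ℕ) {B b : ℝ} (hb : 0 < b) :
    ∃ Z, 4 ≤ Z ∧ ∀ {n G : ℕ} {m : Fin G → ℕ} {X : Matrix (Fin n) (Idx m) ℝ} {c γ : ℝ}
      {π : Measure ℝ} [IsProbabilityMeasure π] (y : Fin n → ℝ) (g : Fin G), BlockOrthogonal X →
      0 < c → BoundedBelow X c → m g ≤ s → 0 < γ → (∀ᵐ τ ∂π, γ ≤ τ ∧ τ ≤ 1) →
      Z ≤ groupStat X σ y g → Real.log (1 / γ) ≤ B * Real.log (groupStat X σ y g / b) →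
      1 - shrinkWeight X σ a L π y g ≤ groupStat X σ y g ^ (-(7 : ℝ) / 8) := by
  obtain ⟨z₀, C, hz₀, hC, h⟩ := exists_lintegral_shrinkK_le hL hLb ha s
  -- The logarithms are beaten by z^{1/8}. Any exponent below 1/4 would still leave a total bias
  -- tending to zero in the end.
  have hev : ∀ᶠ z : ℝ in atTop, C * (1 + Real.log z + B * Real.log (z / b)) ≤ z ^ ((1 : ℝ) / 8) := by
    have hlog := isLittleO_log_rpow_atTop (show (0 : ℝ) < 1 / 8 by norm_num)
    have h1 : (fun _ : ℝ => (1 - B * Real.log b)) =o[atTop] fun z : ℝ => z ^ ((1 : ℝ) / 8) :=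
      isLittleO_const_left.mpr (Or.inr (tendsto_norm_atTop_atTop.comp
        (tendsto_rpow_atTop (by norm_num))))
    have h2 := ((h1.add (hlog.const_mul_left (1 + B))).const_mul_left C).def one_pos
    filter_upwards [h2, eventually_gt_atTop 0] with z hz hz0
    rw [Real.norm_of_nonneg (Real.rpow_nonneg hz0.le _), one_mul] at hz
    refine le_trans (le_of_eq ?_) ((le_abs_self _).trans hz)
    rw [Real.log_div hz0.ne' hb.ne']
    ring
  obtain ⟨Z, hZ⟩ := eventually_atTop.mp hev
  refine ⟨max 4 (max z₀ Z), le_max_left _ _, ?_⟩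
  intro n G m X c γ π _ y g hX hc hA hms hγ hπ hZz hlog
  set z := groupStat X σ y g
  have hz4 : 4 ≤ z := (le_max_left _ _).trans hZz
  have hz0 : 0 < z := by linarith
  have hzz : z₀ ≤ z := ((le_max_left _ _).trans (le_max_right _ _)).trans hZz
  have hzZ : Z ≤ z := ((le_max_right _ _).trans (le_max_right _ _)).trans hZz
  refine one_sub_shrinkWeight_le hX hc hA hσ hL (hπ.mono fun τ hτ => hγ.trans_le hτ.1) y g
    (Real.rpow_nonneg hz0.le _) ?_
  filter_upwards [hπ] with τ hτ
  have hτ0 := hγ.trans_le hτ.1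
  refine (h (m g) hms z τ hzz hτ0 hτ.2).trans (mul_le_mul_left ?_ _)
  refine ENNReal.ofReal_le_ofReal ?_
  have hτl : Real.log (1 / τ) ≤ Real.log (1 / γ) :=
    Real.log_le_log (by positivity) (one_div_le_one_div_of_le hγ hτ.1)
  calc C * (1 + Real.log z + Real.log (1 / τ)) / z
      ≤ C * (1 + Real.log z + B * Real.log (z / b)) / z := by gcongr; linarith
    _ ≤ z ^ ((1 : ℝ) / 8) / z := by
        gcongr
        exact hZ z hzZ
    _ = z ^ (-(7 : ℝ) / 8) := by
        rw [div_eq_iff hz0.ne']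
        nth_rewrite 3 [← Real.rpow_one z]
        rw [← Real.rpow_add hz0]
        norm_num

end Selection

/-! ### The scaled error -/

section ScaledError

variable {n G : ℕ} {m : Fin G → ℕ} {X : Matrix (Fin n) (Idx m) ℝ} {c : ℝ} {β0 : Idx m → ℝ}

/-- The part of a coefficient vector that is supported on the active groups of `β0`. -/
def activePart (β0 v : Idx m → ℝ) : Idx m → ℝ :=
  open Classical in fun p => if p.1 ∈ activeSet β0 then v p else 0

/-- Extension of a vector on the active coordinates by zero. -/
def extendActive (w : ActiveIdx β0 → ℝ) : Idx m → ℝ :=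
  open Classical in fun p => if h : p.1 ∈ activeSet β0 then w ⟨p, h⟩ else 0

lemma extendActive_restrict (v : Idx m → ℝ) :
    extendActive (fun p : ActiveIdx β0 => v p.1) = activePart β0 v := by
  ext p
  unfold extendActive activePart
  split_ifs <;> rfl

lemma sum_activeIdx (f : Idx m → ℝ) (hf : ∀ p, p.1 ∉ activeSet β0 → f p = 0) :
    ∑ p : ActiveIdx β0, f p.1 = ∑ p, f p := by
  classical
  rw [← Finset.sum_filter_of_ne (p := fun p : Idx m => p.1 ∈ activeSet β0)
    (fun p _ hp => by by_contra h; exact hp (hf p h))]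
  exact (Finset.sum_subtype _ (fun p => by simp) f).symm

lemma activeDesign_mulVec (w : ActiveIdx β0 → ℝ) :
    activeDesign X β0 *ᵥ w = X *ᵥ extendActive w := by
  ext i
  simp only [Matrix.mulVec, dotProduct]
  rw [← sum_activeIdx (β0 := β0) (fun p => X i p * extendActive w p)]
  · refine Finset.sum_congr rfl fun p _ => ?_
    unfold extendActive
    rw [dif_pos p.2]
    rfl
  · intro p hp
    simp [extendActive, hp]

lemma extendActive_dotProduct_self (w : ActiveIdx β0 → ℝ) :
    extendActive w ⬝ᵥ extendActive w = w ⬝ᵥ w := by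
  simp only [dotProduct]
  rw [← sum_activeIdx (β0 := β0) (fun p => extendActive w p * extendActive w p)]
  · refine Finset.sum_congr rfl fun p _ => ?_
    unfold extendActive
    rw [dif_pos p.2]
    rfl
  · intro p hp
    simp [extendActive, hp]

lemma BoundedBelow.activeDesign (hA : BoundedBelow X c) :
    BoundedBelow (activeDesign X β0) c := by
  intro w
  rw [activeDesign_mulVec, ← extendActive_dotProduct_self]
  exact hA _

lemma groupImage_activePart_of_mem {g : Fin G} (hg : g ∈ activeSet β0) (v : Idx m → ℝ) :
    groupImage X g (activePart β0 v) = groupImage X g v := by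
  simpa using groupImage_of_groupPart_eq_smul X g 1 (v := activePart β0 v) (w := v)
    (fun j => by simp [activePart, hg])

lemma groupPart_extendActive_of_notMem {g : Fin G} (hg : g ∉ activeSet β0)
    (w : ActiveIdx β0 → ℝ) : groupPart (extendActive w) g = 0 := by
  ext j
  simp [groupPart, extendActive, hg]

lemma groupImage_activePart_of_notMem {g : Fin G} (hg : g ∉ activeSet β0) (v : Idx m → ℝ) :
    groupImage X g (activePart β0 v) = 0 := by
  rw [← extendActive_restrict]
  exact groupImage_eq_zero X g (groupPart_extendActive_of_notMem hg _)

/-- The square root of the Gram matrix of the active columns. -/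
def gramSqrt (X : Matrix (Fin n) (Idx m) ℝ) (β0 : Idx m → ℝ) :
    Matrix (ActiveIdx β0) (ActiveIdx β0) ℝ :=
  CFC.sqrt ((activeDesign X β0)ᵀ * activeDesign X β0)

lemma gramSqrt_mul_self :
    gramSqrt X β0 * gramSqrt X β0 = (activeDesign X β0)ᵀ * activeDesign X β0 := by
  have h : (0 : Matrix (ActiveIdx β0) (ActiveIdx β0) ℝ) ≤
      (activeDesign X β0)ᵀ * activeDesign X β0 := by
    rw [Matrix.nonneg_iff_posSemidef]
    simpa [Matrix.conjTranspose_eq_transpose_of_trivial] using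
      Matrix.posSemidef_conjTranspose_mul_self (activeDesign X β0)
  exact CFC.sqrt_mul_sqrt_self _ h

lemma transpose_gramSqrt : (gramSqrt X β0)ᵀ = gramSqrt X β0 := by
  have h : (gramSqrt X β0).PosSemidef := by
    rw [← Matrix.nonneg_iff_posSemidef]
    exact CFC.sqrt_nonneg _
  simpa [Matrix.conjTranspose_eq_transpose_of_trivial] using h.isHermitian.eq

lemma isUnit_det_gramSqrt (hc : 0 < c) (hA : BoundedBelow X c) :
    IsUnit (gramSqrt X β0).det := by
  have h := (hA.activeDesign (β0 := β0)).isUnit_det hc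
  rw [← gramSqrt_mul_self, Matrix.det_mul] at h
  exact isUnit_of_mul_isUnit_left h

/-- The square root and the active design induce the same inner product, so norms involving the root
can be computed in data space. -/
lemma gramSqrt_mulVec_dotProduct (v w : ActiveIdx β0 → ℝ) :
    (gramSqrt X β0 *ᵥ v) ⬝ᵥ (gramSqrt X β0 *ᵥ w) =
      (activeDesign X β0 *ᵥ v) ⬝ᵥ (activeDesign X β0 *ᵥ w) := by
  rw [Matrix.dotProduct_mulVec, Matrix.vecMul_mulVec, transpose_gramSqrt, gramSqrt_mul_self,
    ← Matrix.vecMul_mulVec, ← Matrix.dotProduct_mulVec]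

/-- By block orthogonality the active coordinates of the full least squares estimator solve the
normal equations of the active columns alone. -/
lemma activeDesign_mulVec_dotProduct_ols (hX : BlockOrthogonal X) (hc : 0 < c)
    (hA : BoundedBelow X c) (w : ActiveIdx β0 → ℝ) (e : Fin n → ℝ) :
    (activeDesign X β0 *ᵥ w) ⬝ᵥ (activeDesign X β0 *ᵥ fun p => ols X e p.1) =
      (activeDesign X β0 *ᵥ w) ⬝ᵥ e := by
  rw [activeDesign_mulVec, activeDesign_mulVec, ← hA.mulVec_dotProduct_ols hc _ e,
    extendActive_restrict, hX.mulVec_dotProduct_mulVec, hX.mulVec_dotProduct_mulVec]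
  refine Finset.sum_congr rfl fun g _ => ?_
  by_cases hg : g ∈ activeSet β0
  · rw [groupImage_activePart_of_mem hg]
  · rw [groupImage_eq_zero X g (groupPart_extendActive_of_notMem hg w)]
    simp

/-- The least squares part of the scaled error is a linear functional of the noise given by a
unit vector. -/
lemma exists_direction (hX : BlockOrthogonal X) (hc : 0 < c) (hA : BoundedBelow X c)
    (α : ActiveIdx β0 → ℝ) : ∃ v : Fin n → ℝ, v ⬝ᵥ v = α ⬝ᵥ α ∧
      ∀ e, α ⬝ᵥ (gramSqrt X β0 *ᵥ fun p => ols X e p.1) = v ⬝ᵥ e := by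
  have hα : gramSqrt X β0 *ᵥ ((gramSqrt X β0)⁻¹ *ᵥ α) = α := by
    rw [Matrix.mulVec_mulVec, Matrix.mul_nonsing_inv _ (isUnit_det_gramSqrt hc hA),
      Matrix.one_mulVec]
  -- The direction is X_A Σ_A^{-1/2} α, and X_A Σ_A^{-1/2} is an isometry.
  refine ⟨activeDesign X β0 *ᵥ ((gramSqrt X β0)⁻¹ *ᵥ α), ?_, fun e => ?_⟩
  · rw [← gramSqrt_mulVec_dotProduct, hα]
  · rw [← activeDesign_mulVec_dotProduct_ols hX hc hA, ← gramSqrt_mulVec_dotProduct, hα]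

/-- Cauchy–Schwarz, after which the squared norm is a sum over the active groups by orthogonality of
the blocks. -/
lemma sq_dotProduct_gramSqrt_le (hX : BlockOrthogonal X) (α : ActiveIdx β0 → ℝ) (r : Idx m → ℝ)
    {q : ℝ} (hq : ∀ g ∈ activeSet β0, groupImage X g r ⬝ᵥ groupImage X g r ≤ q) :
    (α ⬝ᵥ (gramSqrt X β0 *ᵥ fun p => r p.1)) ^ 2 ≤ (α ⬝ᵥ α) * ((activeSet β0).ncard * q) := by
  classical
  have h1 : (α ⬝ᵥ (gramSqrt X β0 *ᵥ fun p => r p.1)) ^ 2 ≤ (α ⬝ᵥ α) *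
      ((gramSqrt X β0 *ᵥ fun p => r p.1) ⬝ᵥ (gramSqrt X β0 *ᵥ fun p => r p.1)) := by
    simp only [dotProduct, ← sq]
    exact Finset.sum_mul_sq_le_sq_mul_sq _ _ _
  refine h1.trans (mul_le_mul_of_nonneg_left ?_ (Finset.sum_nonneg fun _ _ => mul_self_nonneg _))
  rw [gramSqrt_mulVec_dotProduct, activeDesign_mulVec, extendActive_restrict,
    hX.mulVec_dotProduct_mulVec,
    ← Finset.sum_filter_of_ne (p := fun g => g ∈ activeSet β0) (fun g _ hg => by
      by_contra h
      exact hg (by rw [groupImage_activePart_of_notMem h, dotProduct_zero]))]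
  have hcard : ((activeSet β0).ncard : ℝ) =
      ((Finset.univ.filter fun g => g ∈ activeSet β0).card : ℝ) := by
    rw [Set.ncard_eq_toFinset_card', Set.toFinset]
    congr 2
    ext; simp
  rw [hcard, ← nsmul_eq_mul]
  refine Finset.sum_le_card_nsmul _ _ _ fun g hg => ?_
  have hg : g ∈ activeSet β0 := (Finset.mem_filter.mp hg).2
  rw [groupImage_activePart_of_mem hg]
  exact hq g hg

end ScaledError

/-! ### Slutsky's theorem for random variables on varying spaces -/

/-- The spaces are realised as the coordinates of one infinite product, where Slutsky's theorem
applies; convergence in distribution and the probabilities in the hypothesis depend on the marginals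
only. -/
lemma tendstoInDistribution_of_sub_of_map_eq {Ω : ℕ → Type} [∀ n, MeasurableSpace (Ω n)]
    {μ : (n : ℕ) → Measure (Ω n)} [∀ n, IsProbabilityMeasure (μ n)] {ν : Measure ℝ}
    [IsProbabilityMeasure ν] {U V : (n : ℕ) → Ω n → ℝ} (hU : ∀ n, Measurable (U n))
    (hV : ∀ n, Measurable (V n)) (hmap : ∀ᶠ n in atTop, (μ n).map (U n) = ν)
    (h : ∀ ε, 0 < ε → Tendsto (fun n => μ n {x | ε ≤ |V n x - U n x|}) atTop (𝓝 0)) :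
    TendstoInDistribution V atTop (id : ℝ → ℝ) μ ν := by
  have hp := fun n => measurePreserving_eval_infinitePi μ n
  have hUV : TendstoInDistribution (fun n (ω : (n : ℕ) → Ω n) => V n (ω n)) atTop (id : ℝ → ℝ)
      (fun _ => Measure.infinitePi μ) ν := by
    refine tendstoInDistribution_of_tendstoInMeasure_sub
      (X := fun n (ω : (n : ℕ) → Ω n) => U n (ω n)) _ _ ⟨?_, aemeasurable_id, ?_⟩ ?_ ?_
    · exact fun n => ((hU n).comp (measurable_pi_apply n)).aemeasurable
    · refine tendsto_const_nhds.congr' ?_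
      filter_upwards [hmap] with n hn
      refine Subtype.ext ?_
      have : (Measure.infinitePi μ).map (fun ω => U n (ω n)) = ν := by
        rw [← hn, ← (hp n).map_eq, Measure.map_map (hU n) (measurable_pi_apply n)]
        rfl
      simpa using this.symm
    · rw [tendstoInMeasure_iff_norm]
      intro ε hε
      refine (h ε hε).congr fun n => ?_
      have hs : MeasurableSet {x | ε ≤ |V n x - U n x|} :=
        measurableSet_le measurable_const ((hV n).sub (hU n)).norm
      rw [← (hp n).measure_preimage hs.nullMeasurableSet]
      simp
    · exact fun n => ((hV n).comp (measurable_pi_apply n)).aemeasurable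
  refine ⟨fun n => (hV n).aemeasurable, aemeasurable_id, hUV.tendsto.congr fun n => ?_⟩
  refine Subtype.ext ?_
  change (Measure.infinitePi μ).map (fun ω => V n (ω n)) = (μ n).map (V n)
  rw [← (hp n).map_eq, Measure.map_map (hV n) (measurable_pi_apply n)]
  rfl

/-! ### The half-thresholding estimator -/

section Estimator

variable {n G : ℕ} {m : Fin G → ℕ} {X : Matrix (Fin n) (Idx m) ℝ} {c σ a : ℝ} {L : ℝ → ℝ}
  {π : Measure ℝ} [IsProbabilityMeasure π] {β0 : Idx m → ℝ}

lemma htEstimator_of_selected (hX : BlockOrthogonal X) (hc : 0 < c) (hA : BoundedBelow X c)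
    (hσ : 0 < σ) (hL : LocalPriorClass a L) (hπ : ∀ᵐ τ ∂π, 0 < τ) {y : Fin n → ℝ} {p : Idx m}
    (h : 1 / 2 < shrinkWeight X σ a L π y p.1) :
    htEstimator X σ a L π y p = shrinkWeight X σ a L π y p.1 * ols X y p := by
  rw [htEstimator, if_pos h, posteriorMean_eq hX hc hA hσ hL hπ]

lemma measurable_htEstimator (hX : BlockOrthogonal X) (hc : 0 < c) (hA : BoundedBelow X c)
    (hσ : 0 < σ) (hL : LocalPriorClass a L) (hπ : ∀ᵐ τ ∂π, 0 < τ) (p : Idx m) :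
    Measurable fun y => htEstimator X σ a L π y p := by
  have h1 := measurable_shrinkWeight hX hc hA hσ hL hπ p.1
  have h2 : Measurable fun y => shrinkWeight X σ a L π y p.1 * ols X y p :=
    h1.mul ((measurable_pi_apply p).comp (continuous_ols (X := X)).measurable)
  simp only [htEstimator, posteriorMean_eq hX hc hA hσ hL hπ]
  exact Measurable.ite (measurableSet_lt measurable_const h1) h2 measurable_const

lemma measurable_scaledError {Ω : Type*} [MeasurableSpace Ω] (α : EuclideanSpace ℝ (ActiveIdx β0))
    {b : Ω → Idx m → ℝ} (hb : ∀ p, Measurable fun ω => b ω p) :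
    Measurable fun ω => scaledError X β0 α (b ω) := by
  simp only [scaledError, dotProduct, Matrix.mulVec]
  refine Finset.measurable_sum _ fun i _ => Measurable.const_mul ?_ _
  exact Finset.measurable_sum _ fun p _ => ((hb p.1).sub_const _).const_mul _

/-- A selected group could still have a zero estimate if its least squares block vanished; a
positive statistic excludes this. -/
lemma activeSet_htEstimator (hX : BlockOrthogonal X) (hc : 0 < c) (hA : BoundedBelow X c)
    (hσ : 0 < σ) (hL : LocalPriorClass a L) (hπ : ∀ᵐ τ ∂π, 0 < τ) {y : Fin n → ℝ}
    (hin : ∀ g ∉ activeSet β0, shrinkWeight X σ a L π y g ≤ 1 / 2)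
    (hact : ∀ g ∈ activeSet β0, 1 / 2 < shrinkWeight X σ a L π y g ∧ 0 < groupStat X σ y g) :
    activeSet (htEstimator X σ a L π y) = activeSet β0 := by
  ext g
  by_cases hg : g ∈ activeSet β0
  · refine iff_of_true ?_ hg
    obtain ⟨h1, h2⟩ := hact g hg
    intro h0
    have h3 : groupPart (ols X y) g = 0 := by
      ext j
      have h4 : htEstimator X σ a L π y ⟨g, j⟩ = 0 := congrFun h0 j
      rw [htEstimator_of_selected hX hc hA hσ hL hπ (p := ⟨g, j⟩) h1] at h4
      exact (mul_eq_zero.mp h4).resolve_left (by linarith)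
    rw [groupStat, groupImage_eq_zero X g h3] at h2
    simp at h2
  · refine iff_of_false ?_ hg
    intro h
    apply h
    ext j
    exact if_neg (hin g hg).not_gt

/-- On selected groups the error is the least squares error minus (1 - weight) times the least
squares estimator. The first part is v·e; the second is the shrinkage bias, with squared image (1 -
weight)²σ²z on each group. -/
lemma sq_scaledError_sub_le (hX : BlockOrthogonal X) (hc : 0 < c) (hA : BoundedBelow X c)
    (hσ : 0 < σ) (hL : LocalPriorClass a L) (hπ : ∀ᵐ τ ∂π, 0 < τ)
    {α : EuclideanSpace ℝ (ActiveIdx β0)} {v e : Fin n → ℝ} {q : ℝ}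
    (hv : α.ofLp ⬝ᵥ (gramSqrt X β0 *ᵥ fun p => ols X e p.1) = v ⬝ᵥ e)
    (hact : ∀ g ∈ activeSet β0, 1 / 2 < shrinkWeight X σ a L π (X *ᵥ β0 + e) g)
    (hq : ∀ g ∈ activeSet β0, (1 - shrinkWeight X σ a L π (X *ᵥ β0 + e) g) ^ 2 *
      groupStat X σ (X *ᵥ β0 + e) g ≤ q) :
    (scaledError X β0 α (htEstimator X σ a L π (X *ᵥ β0 + e)) - v ⬝ᵥ e) ^ 2 ≤
      (α.ofLp ⬝ᵥ α.ofLp) * ((activeSet β0).ncard * (σ ^ 2 * q)) := by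
  set y := X *ᵥ β0 + e with hy
  set r : Idx m → ℝ := fun p => (1 - shrinkWeight X σ a L π y p.1) * ols X y p with hr
  have h1 : (fun p : ActiveIdx β0 => htEstimator X σ a L π y p.1 - β0 p.1) =
      (fun p : ActiveIdx β0 => ols X e p.1) - fun p => r p.1 := by
    ext p
    have h2 : ols X y p.1 = β0 p.1 + ols X e p.1 := by
      rw [hy, hA.ols_mulVec_add hc]; rfl
    simp only [Pi.sub_apply, hr]
    rw [htEstimator_of_selected hX hc hA hσ hL hπ (hact _ p.2), h2]
    ring
  have h3 : scaledError X β0 α (htEstimator X σ a L π y) - v ⬝ᵥ e =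
      -(α.ofLp ⬝ᵥ (gramSqrt X β0 *ᵥ fun p => r p.1)) := by
    rw [scaledError, h1, Matrix.mulVec_sub, dotProduct_sub, ← hv, gramSqrt]
    ring
  rw [h3, neg_sq]
  refine sq_dotProduct_gramSqrt_le hX α.ofLp r fun g hg => ?_
  rw [groupImage_of_groupPart_eq_smul X g (1 - shrinkWeight X σ a L π y g) (w := ols X y)
    (fun j => rfl), smul_dotProduct, dotProduct_smul, smul_eq_mul, smul_eq_mul]
  have h4 : groupImage X g (ols X y) ⬝ᵥ groupImage X g (ols X y) =
      σ ^ 2 * groupStat X σ y g := by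
    rw [groupStat]; field_simp
  rw [h4]
  calc _ = σ ^ 2 * ((1 - shrinkWeight X σ a L π y g) ^ 2 * groupStat X σ y g) := by ring
    _ ≤ _ := mul_le_mul_of_nonneg_left (hq g hg) (sq_nonneg σ)

end Estimator

/-! ### The oracle property -/

/-- With probability tending to one, no inactive group is selected, and the active groups are
selected with negligible shrinkage. -/
theorem exists_good_event
    (σ : ℝ) (hσ : 0 < σ)
    (a : ℝ) (ha : 1 / 2 ≤ a) (L : ℝ → ℝ) (hL : LocalPriorClass a L) (hLb : BoundedSlowlyVarying L)
    (G : ℕ → ℕ) (m : (n : ℕ) → Fin (G n) → ℕ) (hm : ∀ n : ℕ, 1 ≤ n → ∀ g, 1 ≤ m n g)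
    (s : ℕ) (hs : ∀ n : ℕ, 1 ≤ n → ∀ g, m n g ≤ s)
    (X : (n : ℕ) → Matrix (Fin n) (Idx (m n)) ℝ) (hX : ∀ n : ℕ, 1 ≤ n → BlockOrthogonal (X n))
    (β0 : (n : ℕ) → Idx (m n) → ℝ) (C₁ : ℝ) (hC₁ : 0 < C₁)
    (hA : ∀ n : ℕ, 1 ≤ n → BoundedBelow (X n) (C₁ * n))
    (C₃ : ℝ) (hC₃ : 0 < C₃)
    (hβ : ∀ n : ℕ, 1 ≤ n → ∀ g ∈ activeSet (β0 n), ∀ j, C₃ < |groupPart (β0 n) g j|)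
    (γ₁ γ₂ : ℕ → ℝ) (hγ₁ : ∀ n, 1 ≤ n → 0 < γ₁ n) (hγ₂ : ∀ n, 1 ≤ n → 0 < γ₂ n)
    (hγ₂0 : Tendsto γ₂ atTop (𝓝 0))
    (hupper : Tendsto (fun n => (G n : ℝ) * γ₂ n * Real.log (1 / γ₂ n) ^ ((s : ℝ) / 2 - 1))
      atTop (𝓝 0))
    (hlog : (fun n => Real.log (1 / γ₁ n)) =O[atTop] fun n => Real.log (G n : ℝ))
    (π : ℕ → Measure ℝ) [∀ n, IsProbabilityMeasure (π n)]
    (hπ : ∀ n : ℕ, 1 ≤ n → ∀ᵐ τ ∂(π n), τ ∈ Set.Icc (γ₁ n) (γ₂ n)) :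
    ∃ δ > 0, ∃ E : (n : ℕ) → Set (Fin n → ℝ),
      Tendsto (fun n => noiseLaw n σ (E n)ᶜ) atTop (𝓝 0) ∧
      ∀ᶠ n in atTop, ∀ e ∈ E n,
        (∀ g ∉ activeSet (β0 n),
          shrinkWeight (X n) σ a L (π n) (X n *ᵥ β0 n + e) g ≤ 1 / 2) ∧
        ∀ g ∈ activeSet (β0 n),
          1 / 2 < shrinkWeight (X n) σ a L (π n) (X n *ᵥ β0 n + e) g ∧
          0 < groupStat (X n) σ (X n *ᵥ β0 n + e) g ∧
          (1 - shrinkWeight (X n) σ a L (π n) (X n *ᵥ β0 n + e) g) ^ 2 *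
            groupStat (X n) σ (X n *ᵥ β0 n + e) g ≤ (δ * n) ^ (-(3 : ℝ) / 4) := by
  -- Half the squared signal of an active group, in units of σ², is at least 2δn; noise below δn
  -- leaves a statistic of at least δn.
  set δ := C₁ * C₃ ^ 2 / (4 * σ ^ 2) with hδ
  have hδ0 : 0 < δ := by positivity
  obtain ⟨K, hK, κ, hκ, hin⟩ := exists_noise_selected_le_rpow_log ha hL hLb hσ s
  obtain ⟨B, hB, hlogB⟩ := hlog.exists_pos
  obtain ⟨Z, hZ4, hact⟩ := exists_one_sub_shrinkWeight_le (B := B) (le_trans (by norm_num) ha)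
    hL hLb hσ s hδ0
  have hGn : ∀ n, 1 ≤ n → (G n : ℝ) ≤ n := fun n hn => by
    have hn' : (0 : ℝ) < n := by exact_mod_cast hn
    exact_mod_cast (hA n hn).groups_le (by positivity) (hm n hn)
  refine ⟨δ, hδ0, fun n => {e | (∀ g ∉ activeSet (β0 n),
      shrinkWeight (X n) σ a L (π n) (X n *ᵥ β0 n + e) g ≤ 1 / 2) ∧
      ∀ g ∈ activeSet (β0 n), groupStat (X n) σ e g < δ * n}, ?_, ?_⟩
  -- The two terms are union bounds over the groups: false selections, controlled by the range of
  -- γ₂, and excessive noise on active groups, exponentially small in n and counted at most n times.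
  · have hlim : Tendsto (fun n : ℕ => ENNReal.ofReal
        (K * ((G n : ℝ) * γ₂ n * Real.log (1 / γ₂ n) ^ ((s : ℝ) / 2 - 1)) +
          √2 ^ s * ((n : ℝ) ^ (1 : ℝ) * Real.exp (-(δ / 4) * n)))) atTop (𝓝 0) := by
      have h1 := (tendsto_rpow_mul_exp_neg_mul_atTop_nhds_zero 1 (δ / 4) (by positivity)).comp
        tendsto_natCast_atTop_atTop
      have h2 := (hupper.const_mul K).add (h1.const_mul (√2 ^ s))
      rw [mul_zero, mul_zero, add_zero] at h2
      simpa using ENNReal.tendsto_ofReal h2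
    refine tendsto_of_tendsto_of_tendsto_of_le_of_le' tendsto_const_nhds hlim
      (Eventually.of_forall fun _ => zero_le) ?_
    filter_upwards [eventually_ge_atTop 1, hγ₂0.eventually_le_const hκ,
      hγ₂0.eventually_le_const one_pos] with n hn hγκ hγ1
    have hn' : (0 : ℝ) < n := by exact_mod_cast hn
    have hc : 0 < C₁ * n := by positivity
    have hγ0 := hγ₂ n hn
    have hl0 : 0 ≤ Real.log (1 / γ₂ n) :=
      Real.log_nonneg (by rw [le_div_iff₀ hγ0]; linarith)
    have hπn : ∀ᵐ τ ∂(π n), 0 < τ ∧ τ ≤ γ₂ n :=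
      (hπ n hn).mono fun τ hτ => ⟨(hγ₁ n hn).trans_le hτ.1, hτ.2⟩
    set b₁ := K * (γ₂ n * Real.log (1 / γ₂ n) ^ ((s : ℝ) / 2 - 1)) with hb₁
    set b₂ := √2 ^ s * Real.exp (-(δ * n) / 4) with hb₂
    have hb₁0 : 0 ≤ b₁ := by positivity
    have hb₂0 : 0 ≤ b₂ := by positivity
    have hsub : {e | (∀ g ∉ activeSet (β0 n),
        shrinkWeight (X n) σ a L (π n) (X n *ᵥ β0 n + e) g ≤ 1 / 2) ∧
        ∀ g ∈ activeSet (β0 n), groupStat (X n) σ e g < δ * n}ᶜ ⊆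
        ⋃ g : Fin (G n), {e | (g ∉ activeSet (β0 n) ∧
          ¬ shrinkWeight (X n) σ a L (π n) (X n *ᵥ β0 n + e) g ≤ 1 / 2) ∨
          (g ∈ activeSet (β0 n) ∧ δ * n ≤ groupStat (X n) σ e g)} := by
      intro e he
      rw [mem_iUnion]
      by_contra! h
      apply he
      refine ⟨fun g hg => ?_, fun g hg => ?_⟩
      · by_contra h2
        exact h g (Or.inl ⟨hg, not_le.mp h2⟩)
      · by_contra h2
        exact h g (Or.inr ⟨hg, not_lt.mp h2⟩)
    refine (measure_mono hsub).trans ((measure_iUnion_fintype_le _ _).trans ?_)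
    have hterm : ∀ g ∈ (Finset.univ : Finset (Fin (G n))),
        noiseLaw n σ {e | (g ∉ activeSet (β0 n) ∧
          ¬ shrinkWeight (X n) σ a L (π n) (X n *ᵥ β0 n + e) g ≤ 1 / 2) ∨
          (g ∈ activeSet (β0 n) ∧ δ * n ≤ groupStat (X n) σ e g)} ≤
        ENNReal.ofReal (b₁ + b₂) := by
      intro g _
      by_cases hg : g ∈ activeSet (β0 n)
      · simp only [hg, not_true_eq_false, false_and, true_and, false_or]
        refine (noise_groupStat_ge_le (hX n hn) hc (hA n hn) hσ g _).trans
          (ENNReal.ofReal_le_ofReal ?_)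
        have h1 : (√2 ^ m n g : ℝ) ≤ √2 ^ s :=
          pow_le_pow_right₀ (Real.one_le_sqrt.mpr (by norm_num)) (hs n hn g)
        calc √2 ^ m n g * Real.exp (-(δ * n) / 4) ≤ b₂ := by rw [hb₂]; gcongr
          _ ≤ b₁ + b₂ := by linarith
      · simp only [hg, not_false_eq_true, false_and, true_and, or_false]
        refine (hin (β0 n) g (hX n hn) hc (hA n hn) (hm n hn g) (hs n hn g) hγ0 hγκ hπn
          (not_not.mp hg)).trans (ENNReal.ofReal_le_ofReal ?_)
        linarith
    refine (Finset.sum_le_card_nsmul _ _ _ hterm).trans ?_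
    rw [Finset.card_univ, Fintype.card_fin, nsmul_eq_mul, ← ENNReal.ofReal_natCast,
      ← ENNReal.ofReal_mul (Nat.cast_nonneg _)]
    refine ENNReal.ofReal_le_ofReal ?_
    calc (G n : ℝ) * (b₁ + b₂) ≤ (G n : ℝ) * b₁ + n * b₂ := by
          rw [mul_add]
          gcongr
          exact_mod_cast hGn n hn
      _ = _ := by
          rw [hb₁, hb₂, Real.rpow_one, show -(δ / 4) * (n : ℝ) = -(δ * n) / 4 by ring]
          ring
  · have hδn : ∀ᶠ n : ℕ in atTop, Z ≤ δ * n :=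
      (tendsto_natCast_atTop_atTop.const_mul_atTop hδ0).eventually_ge_atTop Z
    filter_upwards [eventually_ge_atTop 1, hδn, hlogB.bound,
      hγ₂0.eventually_le_const one_pos] with n hn hZn hlogn hγ1 e he
    refine ⟨he.1, fun g hg => ?_⟩
    have hn' : (0 : ℝ) < n := by exact_mod_cast hn
    have hc : 0 < C₁ * n := by positivity
    set y := X n *ᵥ β0 n + e
    have hβg : C₃ ^ 2 ≤ groupPart (β0 n) g ⬝ᵥ groupPart (β0 n) g := by
      let j : Fin (m n g) := ⟨0, hm n hn g⟩
      calc C₃ ^ 2 ≤ |groupPart (β0 n) g j| ^ 2 := by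
            have := hβ n hn g hg j
            gcongr
        _ = groupPart (β0 n) g j * groupPart (β0 n) g j := by rw [sq_abs, sq]
        _ ≤ _ := Finset.single_le_sum (f := fun j => groupPart (β0 n) g j * groupPart (β0 n) g j)
            (fun _ _ => mul_self_nonneg _) (Finset.mem_univ j)
    have hz : δ * n ≤ groupStat (X n) σ y g := by
      have h1 := le_groupStat_mulVec_add (σ := σ) hc (hA n hn) (β0 n) g e
      have h2 := (hA n hn).groupImage g (β0 n)
      have h3 : C₁ * n * C₃ ^ 2 ≤ groupImage (X n) g (β0 n) ⬝ᵥ groupImage (X n) g (β0 n) :=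
        (mul_le_mul_of_nonneg_left hβg hc.le).trans h2
      have h4 : 2 * (δ * n) ≤
          groupImage (X n) g (β0 n) ⬝ᵥ groupImage (X n) g (β0 n) / (2 * σ ^ 2) := by
        rw [le_div_iff₀ (by positivity)]
        refine le_trans (le_of_eq ?_) h3
        rw [hδ]; field_simp; norm_num
      have h5 := he.2 g hg
      linarith
    set z := groupStat (X n) σ y g
    have hzZ : Z ≤ z := hZn.trans hz
    have hz4 : 4 ≤ z := hZ4.trans hzZ
    have hz0 : 0 < z := by linarith
    -- The chain G ≤ n ≤ z/δ expresses the lower end of the prior of τ through the statistic.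
    have hlog' : Real.log (1 / γ₁ n) ≤ B * Real.log (z / δ) := by
      refine (le_abs_self _).trans (hlogn.trans (mul_le_mul_of_nonneg_left ?_ hB.le))
      rw [Real.norm_of_nonneg (Real.log_natCast_nonneg _)]
      have hGpos : 0 < (G n : ℝ) := by
        have := g.pos
        exact_mod_cast this
      refine Real.log_le_log hGpos ((hGn n hn).trans ?_)
      rw [le_div_iff₀ hδ0]
      linarith
    have hπ1 : ∀ᵐ τ ∂(π n), γ₁ n ≤ τ ∧ τ ≤ 1 :=
      (hπ n hn).mono fun τ hτ => ⟨hτ.1, hτ.2.trans hγ1⟩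
    have hπ0 : ∀ᵐ τ ∂(π n), 0 < τ := (hπ n hn).mono fun τ hτ => (hγ₁ n hn).trans_le hτ.1
    have hS := hact y g (hX n hn) hc (hA n hn) (hs n hn g) (hγ₁ n hn) hπ1 hzZ hlog'
    have hS1 := shrinkWeight_le_one (hX n hn) hc (hA n hn) hσ hL hπ0 y g
    refine ⟨?_, hz0, ?_⟩
    -- The threshold z ≥ 4 is used here: 4^{-7/8} < 4^{-1/2} = 1/2.
    · have h1 : z ^ (-(7 : ℝ) / 8) ≤ 4 ^ (-(7 : ℝ) / 8) :=
        Real.rpow_le_rpow_of_nonpos (by norm_num) hz4 (by norm_num)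
      have h2 : (4 : ℝ) ^ (-(7 : ℝ) / 8) < 4 ^ (-(1 : ℝ) / 2) :=
        Real.rpow_lt_rpow_of_exponent_lt (by norm_num) (by norm_num)
      have h3 : (4 : ℝ) ^ (-(1 : ℝ) / 2) = 1 / 2 := by
        rw [show (4 : ℝ) = 2 ^ (2 : ℝ) by norm_num, ← Real.rpow_mul (by norm_num)]
        norm_num [Real.rpow_neg_one]
      linarith
    · calc (1 - shrinkWeight (X n) σ a L (π n) y g) ^ 2 * z
          ≤ (z ^ (-(7 : ℝ) / 8)) ^ 2 * z := by
            gcongr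
        _ = z ^ (-(3 : ℝ) / 4) := by
            rw [← Real.rpow_mul_natCast hz0.le]
            nth_rewrite 2 [← Real.rpow_one z]
            rw [← Real.rpow_add hz0]
            norm_num
        _ ≤ (δ * n) ^ (-(3 : ℝ) / 4) :=
            Real.rpow_le_rpow_of_nonpos (by positivity) hz (by norm_num)

end

end GroupHT

/-! ### Selection consistency and asymptotic normality. -/

theorem theorem6
    -- the known error standard deviation and the local prior
    (σ : ℝ) (hσ : 0 < σ)
    (a : ℝ) (ha : 1 / 2 ≤ a) (L : ℝ → ℝ) (hL : LocalPriorClass a L) (hLb : BoundedSlowlyVarying L)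
    -- the sequence of designs and of true coefficients, indexed by the sample size
    (G : ℕ → ℕ) (m : (n : ℕ) → Fin (G n) → ℕ) (hm : ∀ n : ℕ, 1 ≤ n → ∀ g, 1 ≤ m n g)
    (s : ℕ) (hs : IsLUB {k : ℕ | ∃ n : ℕ, 1 ≤ n ∧ ∃ g : Fin (G n), k = m n g} s)
    (X : (n : ℕ) → Matrix (Fin n) (Idx (m n)) ℝ) (hX : ∀ n : ℕ, 1 ≤ n → BlockOrthogonal (X n))
    (β0 : (n : ℕ) → Idx (m n) → ℝ)
    -- the eigenvalues of `XᵀX / n` are bounded away from zero and infinity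
    (C₁ C₂ : ℝ) (hC₁ : 0 < C₁)
    (hC : ∀ n : ℕ, 1 ≤ n → spectrum ℝ ((n : ℝ)⁻¹ • ((X n)ᵀ * X n)) ⊆ Set.Icc C₁ C₂)
    -- the coefficients of the active groups are bounded away from zero
    (C₃ : ℝ) (hC₃ : 0 < C₃)
    (hβ : ∀ n : ℕ, 1 ≤ n → ∀ g ∈ activeSet (β0 n), ∀ j, C₃ < |groupPart (β0 n) g j|)
    -- growth of the number of active groups
    (ε₁ ε₂ : ℝ) (hε₁ : 0 < ε₁) (hε : ε₁ < ε₂) (hε₂ : ε₂ < 1 / 2)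
    (hA₁ : (fun n => (G n : ℝ) ^ ε₁) =O[atTop] fun n => ((activeSet (β0 n)).ncard : ℝ))
    (hA₂ : (fun n => ((activeSet (β0 n)).ncard : ℝ)) =O[atTop] fun n => (G n : ℝ) ^ ε₂)
    -- the non-degenerate prior of the global parameter, supported on `[γ₁ n, γ₂ n]`
    (γ₁ γ₂ : ℕ → ℝ) (hγ : GlobalPriorRange G (fun n => (activeSet (β0 n)).ncard) s γ₁ γ₂)
    (π : ℕ → Measure ℝ) [∀ n, IsProbabilityMeasure (π n)]
    (hπ : ∀ n : ℕ, 1 ≤ n → π n (Set.Icc (γ₁ n) (γ₂ n)) = 1)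
    (hπnd : ∀ n : ℕ, 1 ≤ n → ∀ t, π n ≠ Measure.dirac t) :
    -- selection consistency
    Tendsto (fun n => dataLaw (X n) (β0 n) σ
        {y | activeSet (htEstimator (X n) σ a L (π n) y) = activeSet (β0 n)}) atTop (𝓝 1) ∧
    -- asymptotic normality along every sequence of unit directions
    ∀ α : (n : ℕ) → EuclideanSpace ℝ (ActiveIdx (β0 n)), (∀ᶠ n in atTop, ‖α n‖ = 1) →
      TendstoInDistribution
        (fun n y => scaledError (X n) (β0 n) (α n) (htEstimator (X n) σ a L (π n) y)) atTop
        (id : ℝ → ℝ) (fun n => dataLaw (X n) (β0 n) σ) (gaussianReal 0 (σ ^ 2).toNNReal) := by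
  have hA : ∀ n, 1 ≤ n → BoundedBelow (X n) (C₁ * n) := fun n hn =>
    boundedBelow_of_spectrum hn (hC n hn)
  have hms : ∀ n, 1 ≤ n → ∀ g, m n g ≤ s := fun n hn g => hs.1 ⟨n, hn, g, rfl⟩
  have hπI : ∀ n, 1 ≤ n → ∀ᵐ τ ∂(π n), τ ∈ Set.Icc (γ₁ n) (γ₂ n) := fun n hn => by
    change Set.Icc (γ₁ n) (γ₂ n) ∈ ae (π n)
    exact mem_ae_iff.mpr ((prob_compl_eq_zero_iff measurableSet_Icc).mpr (hπ n hn))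
  have hπ0 : ∀ n, 1 ≤ n → ∀ᵐ τ ∂(π n), 0 < τ := fun n hn =>
    (hπI n hn).mono fun τ hτ => (hγ.pos n hn).trans_le hτ.1
  -- An interval of full prior probability is nonempty.
  have hγ₂ : ∀ n, 1 ≤ n → 0 < γ₂ n := fun n hn => by
    obtain ⟨τ, hτ⟩ := (hπI n hn).exists
    exact (hγ.pos n hn).trans_le (hτ.1.trans hτ.2)
  have hc : ∀ n : ℕ, 1 ≤ n → 0 < C₁ * n := fun n hn => by
    have : (0 : ℝ) < n := by exact_mod_cast hn
    positivity
  obtain ⟨δ, hδ, E, hE, hgood⟩ := exists_good_event σ hσ a ha L hL hLb G m hm s hms X hX β0 C₁ hC₁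
    hA C₃ hC₃ hβ γ₁ γ₂ hγ.pos hγ₂ hγ.upper_tendsto hγ.upper hγ.lower_log.1 π hπI
  have hshift : ∀ n, Measurable fun e => X n *ᵥ β0 n + e := fun n => measurable_const_add _
  refine ⟨?_, fun α hα => ?_⟩
  · have hlow : Tendsto (fun n => 1 - noiseLaw n σ (E n)ᶜ) atTop (𝓝 1) := by
      simpa using ENNReal.Tendsto.sub tendsto_const_nhds hE (Or.inl ENNReal.one_ne_top)
    refine tendsto_of_tendsto_of_tendsto_of_le_of_le' hlow tendsto_const_nhds ?_
      (Eventually.of_forall fun _ => prob_le_one)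
    filter_upwards [hgood, eventually_ge_atTop 1] with n hn hn1
    rw [dataLaw_eq_map]
    refine le_trans ?_ (Measure.le_map_apply (hshift n).aemeasurable _)
    rw [tsub_le_iff_right, ← measure_univ (μ := noiseLaw n σ)]
    refine (measure_mono fun e _ => ?_).trans (measure_union_le _ _)
    by_cases he : e ∈ E n
    · refine Or.inl (activeSet_htEstimator (hX n hn1) (hc n hn1) (hA n hn1) hσ hL (hπ0 n hn1)
        (hn e he).1 fun g hg => ?_)
      exact ⟨((hn e he).2 g hg).1, ((hn e he).2 g hg).2.1⟩
    · exact Or.inr he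
  · have hdir : ∀ n, ∃ v : Fin n → ℝ, 1 ≤ n → v ⬝ᵥ v = (α n).ofLp ⬝ᵥ (α n).ofLp ∧
        ∀ e, (α n).ofLp ⬝ᵥ (gramSqrt (X n) (β0 n) *ᵥ fun p => ols (X n) e p.1) = v ⬝ᵥ e := by
      intro n
      by_cases hn : 1 ≤ n
      · obtain ⟨v, hv⟩ := exists_direction (hX n hn) (hc n hn) (hA n hn) (α n).ofLp
        exact ⟨v, fun _ => hv⟩
      · exact ⟨0, fun h => absurd h hn⟩
    choose v hv using hdir
    have hα1 : ∀ᶠ n in atTop, (α n).ofLp ⬝ᵥ (α n).ofLp = 1 := by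
      filter_upwards [hα] with n hn
      have h := EuclideanSpace.real_norm_sq_eq (α n)
      rw [hn] at h
      simp only [dotProduct, ← sq]
      linarith
    have hUm : ∀ n, Measurable fun y => v n ⬝ᵥ (y - X n *ᵥ β0 n) := fun n => by
      simp only [dotProduct, Pi.sub_apply]
      fun_prop
    have hVm : ∀ n, Measurable fun y =>
        scaledError (X n) (β0 n) (α n) (htEstimator (X n) σ a L (π n) y) := by
      intro n
      -- For n = 0 the data space is a single point, so measurability needs no assumption on the
      -- design.
      rcases Nat.eq_zero_or_pos n with rfl | hn
      · exact Subsingleton.measurable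
      · exact measurable_scaledError (α n)
          (measurable_htEstimator (hX n hn) (hc n hn) (hA n hn) hσ hL (hπ0 n hn))
    refine tendstoInDistribution_of_sub_of_map_eq hUm hVm ?_ fun ε hε0 => ?_
    · filter_upwards [hα1, eventually_ge_atTop 1] with n hn hn1
      rw [dataLaw_eq_map, Measure.map_map (hUm n) (hshift n)]
      have h : (fun y => v n ⬝ᵥ (y - X n *ᵥ β0 n)) ∘ (fun e => X n *ᵥ β0 n + e) =
          fun e => v n ⬝ᵥ e := by
        ext e
        simp
      rw [h, map_dotProduct_noiseLaw, (hv n hn1).1, hn, mul_one]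
    · obtain ⟨K, hK, hAK⟩ := hA₂.exists_pos
      -- The exponent is 1/2 - 3/4: O(n^{1/2}) active groups, each with squared bias of order
      -- n^{-3/4}.
      have hrate : Tendsto (fun n : ℕ =>
          K * (σ ^ 2 * δ ^ (-(3 : ℝ) / 4)) * (n : ℝ) ^ (-(1 / 4 : ℝ))) atTop (𝓝 0) := by
        have h := ((tendsto_rpow_neg_atTop (show (0 : ℝ) < 1 / 4 by norm_num)).comp
          tendsto_natCast_atTop_atTop).const_mul (K * (σ ^ 2 * δ ^ (-(3 : ℝ) / 4)))
        simpa using h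
      refine tendsto_of_tendsto_of_tendsto_of_le_of_le' tendsto_const_nhds hE
        (Eventually.of_forall fun _ => zero_le) ?_
      filter_upwards [hgood, eventually_ge_atTop 1, hα1, hAK.bound,
        hrate.eventually_lt_const (show 0 < ε ^ 2 by positivity)] with n hn hn1 hαn hAn hsmall
      have hn' : (1 : ℝ) ≤ n := by exact_mod_cast hn1
      have hn0 : (0 : ℝ) < n := by linarith
      have hset : MeasurableSet {y | ε ≤ |scaledError (X n) (β0 n) (α n)
          (htEstimator (X n) σ a L (π n) y) - v n ⬝ᵥ (y - X n *ᵥ β0 n)|} :=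
        measurableSet_le measurable_const ((hVm n).sub (hUm n)).abs
      rw [dataLaw_eq_map, Measure.map_apply (hshift n) hset]
      -- On the good event the squared difference is below ε², so a deviation of size ε can occur
      -- only on the complement.
      refine measure_mono fun e he hEe => ?_
      have he : ε ≤ |scaledError (X n) (β0 n) (α n)
          (htEstimator (X n) σ a L (π n) (X n *ᵥ β0 n + e)) -
          v n ⬝ᵥ (X n *ᵥ β0 n + e - X n *ᵥ β0 n)| := he
      rw [add_sub_cancel_left] at he
      have hG : (G n : ℝ) ≤ n := by
        exact_mod_cast (hA n hn1).groups_le (hc n hn1) (hm n hn1)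
      have hcard : ((activeSet (β0 n)).ncard : ℝ) ≤ K * (n : ℝ) ^ (1 / 2 : ℝ) := by
        rw [Real.norm_of_nonneg (Nat.cast_nonneg _),
          Real.norm_of_nonneg (Real.rpow_nonneg (Nat.cast_nonneg _) _)] at hAn
        refine hAn.trans (mul_le_mul_of_nonneg_left ?_ hK.le)
        exact (Real.rpow_le_rpow (Nat.cast_nonneg _) hG (hε₁.trans hε).le).trans
          (Real.rpow_le_rpow_of_exponent_le hn' hε₂.le)
      have hb := sq_scaledError_sub_le (hX n hn1) (hc n hn1) (hA n hn1) hσ hL (hπ0 n hn1)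
        ((hv n hn1).2 e) (fun g hg => ((hn e hEe).2 g hg).1)
        (fun g hg => ((hn e hEe).2 g hg).2.2)
      rw [hαn, one_mul] at hb
      have hsq : ε ^ 2 ≤ (scaledError (X n) (β0 n) (α n)
          (htEstimator (X n) σ a L (π n) (X n *ᵥ β0 n + e)) - v n ⬝ᵥ e) ^ 2 := by
        rw [← sq_abs (_ - _)]
        gcongr
      have hfin : ((activeSet (β0 n)).ncard : ℝ) * (σ ^ 2 * (δ * n) ^ (-(3 : ℝ) / 4)) ≤
          K * (σ ^ 2 * δ ^ (-(3 : ℝ) / 4)) * (n : ℝ) ^ (-(1 / 4 : ℝ)) := by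
        calc _ ≤ K * (n : ℝ) ^ (1 / 2 : ℝ) * (σ ^ 2 * (δ * n) ^ (-(3 : ℝ) / 4)) := by gcongr
          _ = K * (σ ^ 2 * δ ^ (-(3 : ℝ) / 4)) *
              ((n : ℝ) ^ (1 / 2 : ℝ) * (n : ℝ) ^ (-(3 : ℝ) / 4)) := by
            rw [Real.mul_rpow hδ.le hn0.le]; ring
          _ = _ := by
            rw [← Real.rpow_add hn0]; norm_num
      linarith
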